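/- **Setting.** Let $N$ be a bounded normal operator on a Krein space $(\mathcal K,[\cdot,\cdot])$, i.e. $NN^*=N^*N$ for the Krein space adjoint $N^*$, and put $A=\frac{N+N^*}{2}$, $B=\frac{N-N^*}{2i}$. Assume that $N$ is definitizable, and fix nonzero polynomials $p,q\in\mathbb R[z]$ with $[p(A)x,x]\ge 0$ and $[q(B)x,x]\ge 0$ for all $x\in\mathcal K$. Let $\mathcal V$, $\mathcal V_1$, $\mathcal V_2$ be the Hilbert space completions of $\mathcal K/\ker(p(A)+q(B))$, $\mathcal K/\ker p(A)$, $\mathcal K/\ker q(B)$ with respect to $[(p(A)+q(B))\cdot,\cdot]$, $[p(A)\cdot,\cdot]$, $[q(B)\cdot,\cdot]$. Let $T:\mathcal V\to\mathcal K$ be the (injective) adjoint of the canonical map $\mathcal K\to\mathcal V$, so that $TT^*=p(A)+q(B)$, and let $R_j:\mathcal V_j\to\mathcal V$ be the adjoint of the contraction $\mathcal V\to\mathcal V_j$ induced by the identity of $\mathcal K$ ($j=1,2$). Let $\Theta(N)=T^{-1}NT$ be the unique bounded operator on $\mathcal V$ with $T\,\Theta(N)=NT$; it is normal. Let $E$ be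 its spectral measure, and write $\sigma=\sigma(\Theta(N))$ and $\Xi(D)=TDT^*$ for $D\in B(\mathcal V)$. Let $\mathfrak d_p(\xi)$, $\mathfrak d_q(\eta)$ be the multiplicities of $\xi,\eta\in\mathbb C$ as zeros of $p$, $q$. Put $Z=\{x+iy: x,y\in\mathbb R,\ p(x)=0=q(y)\}$ and $Z^i=\{(\xi,\eta)\in\mathbb C^2: p(\xi)=0=q(\eta)\}\setminus\mathbb R^2$. **Functions.** $\mathcal M_N$ is the set of functions $\phi$ on the disjoint union $(\sigma\cup Z)\,\dot\cup\,Z^i$ such that * $\phi(z)\in\mathbb C$ for $z\in\sigma\setminus Z$; * $\phi(z)=(\phi(z)_{k,l})$ is a complex tuple with index set $(\{0,\dots,m-1\}\times\{0,\dots,n-1\})\cup\{(m,0),(0,n)\}$, where $m=\mathfrak d_p(\operatorname{Re}z)$, $n=\mathfrak d_q(\operatorname{Im}z)$, for $z\in Z$; * $\phi(\xi,\eta)$ is a complex tuple with index set $\{0,\dots,\mathfrak d_p(\xi)-1\}\times\{0,\dots,\mathfrak d_q(\eta)-1\}$ for $(\xi,\eta)\in Z^i$. Addition and scalar multiplication are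 pointwise and entrywise. Multiplication is pointwise, given on tuples by $(ab)_{k,l}=\sum_{c\le k,\,d\le l}a_{c,d}b_{k-c,l-d}$. The involution is $\phi^\#(z)=\overline{\phi(z)}$ on $\sigma\cup Z$ and $\phi^\#(\xi,\eta)=\overline{\phi(\bar\xi,\bar\eta)}$ on $Z^i$, with entrywise conjugation. With these operations $\mathcal M_N$ is a commutative unital $*$-algebra. For $s\in\mathbb C[z,w]$ let $s_N\in\mathcal M_N$ be given by $s_N(z)=s(\operatorname{Re}z,\operatorname{Im}z)$ on $\sigma\setminus Z$ and by the entries $\frac1{k!\,l!}\frac{\partial^{k+l}s}{\partial z^k\partial w^l}$, evaluated at $(\operatorname{Re}z,\operatorname{Im}z)$ for $z\in Z$ and at $(\xi,\eta)$ for $(\xi,\eta)\in Z^i$. $\mathcal F_N$ is the set of those $\phi\in\mathcal M_N$ that are Borel measurable and bounded on $\sigma\setminus Z$ and satisfy, for each $w\in\sigma\cap Z$, with $m=\mathfrak d_p(\operatorname{Re}w)$ and $n=\mathfrak d_q(\operatorname{Im}w)$, $$\phi(z)-\sum_{k=0}^{m-1}\sum_{l=0}^{n-1}\phi(w)_{k,l}\operatorname{Re}(z-w)^k\operatorname{Im}(z-w)^l=O\big(\max(|\operatorname{Re}(z-w)|^m,|\operatorname{Im}(z-w)|^n)\big)$$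 as $z\to w$ in $\sigma\setminus Z$. It is a unital $*$-subalgebra of $\mathcal M_N$. **Functional calculus.** A decomposition of $\phi\in\mathcal F_N$ consists of $s\in\mathbb C[z,w]$ and a function $g$ on $\sigma$, with values in $\mathbb C$ on $\sigma\setminus Z$ (bounded and Borel measurable there) and values $g(w)=(g_1(w),g_2(w))\in\mathbb C^2$ on $\sigma\cap Z$, such that * $\phi-s_N$ vanishes on $Z^i$, and all its entries at points of $Z$ vanish except possibly those with indices $(m,0)$ and $(0,n)$; * $\phi(z)=s_N(z)+(p(\operatorname{Re}z)+q(\operatorname{Im}z))\,g(z)$ for $z\in\sigma\setminus Z$; * for $w\in\sigma\cap Z$, with $r(z,w)=p(z)+q(w)$, one has $\phi(w)_{m,0}=s_N(w)_{m,0}+r_N(w)_{m,0}\,g_1(w)$ and $\phi(w)_{0,n}=s_N(w)_{0,n}+r_N(w)_{0,n}\,g_2(w)$. Define $$\phi(N):=s(A,B)+\Xi\Big(\int_{\sigma\setminus Z}g\,dE+\sum_{w\in\sigma\cap Z}\big(g_1(w)R_1R_1^*E\{w\}+g_2(w)R_2R_2^*E\{w\}\big)\Big).$$ **Theorem.** The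 operator $\Theta(N)$ exists, every $\phi\in\mathcal F_N$ has a decomposition, and $\phi(N)$ does not depend on its choice. The mapping $\phi\mapsto\phi(N)$ is a (unital) $*$-homomorphism from $\mathcal F_N$ into the bicommutant $\{N,N^*\}''\subseteq B(\mathcal K)$: it is linear and multiplicative, and $\phi^\#(N)=\phi(N)^*$ with the Krein space adjoint. Moreover, $s_N\in\mathcal F_N$ and $s_N(N)=s(A,B)$ for every $s\in\mathbb C[z,w]$. -/

import Mathlib

open scoped ComplexConjugate Topology Polynomial

noncomputable section

/-! ## Krein spaces and Krein adjoints -/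

/-- A Krein space structure on `K`: the Hilbert space topology of `K` together with a fundamental
symmetry `J`. The indefinite inner product is `[x, y] = ⟨J x, y⟩`; every Krein space arises in this
way from any of its fundamental decompositions. -/
structure KreinStructure (K : Type*) [NormedAddCommGroup K] [InnerProductSpace ℂ K]
    [CompleteSpace K] where
  /-- the fundamental symmetry -/
  symm : K →L[ℂ] K
  isSelfAdjoint : IsSelfAdjoint symm
  symm_mul_symm : symm * symm = 1

namespace KreinStructure

variable {K : Type*} [NormedAddCommGroup K] [InnerProductSpace ℂ K] [CompleteSpace K]
  (J : KreinStructure K)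

/-- The Krein space inner product `[x, y]`, linear in `x` and conjugate linear in `y`. -/
def form (x y : K) : ℂ := inner ℂ y (J.symm x)

/-- The Krein space adjoint of a bounded operator. -/
def adj (C : K →L[ℂ] K) : K →L[ℂ] K := J.symm * ContinuousLinearMap.adjoint C * J.symm

theorem symm_symm (x : K) : J.symm (J.symm x) = x := by
  have h := congrArg (fun C : K →L[ℂ] K => C x) J.symm_mul_symm
  simpa using h

theorem inner_symm (x y : K) : inner ℂ (J.symm x) y = inner ℂ x (J.symm y) := by
  have h := J.isSelfAdjoint.adjoint_eq
  conv_rhs => rw [← h]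
  rw [ContinuousLinearMap.adjoint_inner_right]

theorem form_adj (C : K →L[ℂ] K) (x y : K) : J.form (C x) y = J.form x (J.adj C y) := by
  simp only [form, adj, mul_apply_eq_comp]
  rw [inner_symm, J.symm_symm, ContinuousLinearMap.adjoint_inner_left, inner_symm]

/-- The real part `A = (N + N*) / 2`. -/
def rePart (N : K →L[ℂ] K) : K →L[ℂ] K := (1 / 2 : ℂ) • (N + J.adj N)

/-- The imaginary part `B = (N - N*) / (2i)`. -/
def imPart (N : K →L[ℂ] K) : K →L[ℂ] K := (1 / (2 * Complex.I)) • (N - J.adj N)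

end KreinStructure

/-- `r(A)` for a polynomial `r` with real coefficients. -/
def realPolyEval {K : Type*} [NormedAddCommGroup K] [InnerProductSpace ℂ K]
    (r : ℝ[X]) (A : K →L[ℂ] K) : K →L[ℂ] K :=
  Polynomial.aeval A (r.map (algebraMap ℝ ℂ))

/-- `s(A, B)` for a polynomial `s ∈ ℂ[z, w]` (used for commuting `A` and `B`). -/
def biPolyEval {K : Type*} [NormedAddCommGroup K] [InnerProductSpace ℂ K]
    (s : MvPolynomial (Fin 2) ℂ) (A B : K →L[ℂ] K) : K →L[ℂ] K :=
  ∑ m ∈ s.support, s.coeff m • (A ^ m 0 * B ^ m 1)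

namespace KreinStructure

variable {K : Type*} [NormedAddCommGroup K] [InnerProductSpace ℂ K] [CompleteSpace K]
  (J : KreinStructure K)

/-- The real polynomial `r` is definitizing for the selfadjoint operator `A`: it is not the zero
polynomial and `[r(A) x, x] ≥ 0` for all `x` (this number is real, since `r(A)` is selfadjoint). -/
def IsDefinitizing (r : ℝ[X]) (A : K →L[ℂ] K) : Prop :=
  r ≠ 0 ∧ ∀ x, 0 ≤ (J.form (realPolyEval r A x) x).re

theorem adj_add (C D : K →L[ℂ] K) : J.adj (C + D) = J.adj C + J.adj D := by
  simp [adj, mul_add, add_mul]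

theorem adj_sub (C D : K →L[ℂ] K) : J.adj (C - D) = J.adj C - J.adj D := by
  simp [adj, mul_sub, sub_mul]

theorem adj_smul (c : ℂ) (C : K →L[ℂ] K) : J.adj (c • C) = conj c • J.adj C := by
  simp [adj, ContinuousLinearMap.adjoint.map_smulₛₗ]

theorem adj_adj (C : K →L[ℂ] K) : J.adj (J.adj C) = C := by
  have h : ContinuousLinearMap.adjoint J.symm = J.symm := J.isSelfAdjoint.adjoint_eq
  ext x
  simp only [adj, ← ContinuousLinearMap.star_eq_adjoint, star_mul, star_star]
  rw [ContinuousLinearMap.star_eq_adjoint, h]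
  simp [J.symm_symm]

theorem adj_mul (C D : K →L[ℂ] K) : J.adj (C * D) = J.adj D * J.adj C := by
  ext x
  simp only [adj, ← ContinuousLinearMap.star_eq_adjoint, star_mul]
  simp [J.symm_symm]

theorem adj_one : J.adj 1 = 1 := by
  ext x
  simp only [adj, ← ContinuousLinearMap.star_eq_adjoint, star_one]
  simp [J.symm_symm]

theorem adj_rePart (N : K →L[ℂ] K) : J.adj (J.rePart N) = J.rePart N := by
  have h2 : (starRingEnd ℂ) 2 = 2 := map_ofNat _ 2
  simp [rePart, adj_smul, adj_add, adj_adj, add_comm, h2]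

theorem adj_imPart (N : K →L[ℂ] K) : J.adj (J.imPart N) = J.imPart N := by
  simp only [imPart, adj_smul, adj_sub, adj_adj]
  have h2 : (starRingEnd ℂ) 2 = 2 := map_ofNat _ 2
  rw [← neg_sub N, smul_neg, ← neg_smul]
  congr 1
  simp [h2]

theorem adj_pow {A : K →L[ℂ] K} (hA : J.adj A = A) (n : ℕ) : J.adj (A ^ n) = A ^ n := by
  induction n with
  | zero => simp [adj_one]
  | succ n ih => rw [pow_succ, adj_mul, ih, hA, ← pow_succ, ← pow_succ']

theorem adj_realPolyEval {A : K →L[ℂ] K} (hA : J.adj A = A) (r : ℝ[X]) :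
    J.adj (realPolyEval r A) = realPolyEval r A := by
  induction r using Polynomial.induction_on' with
  | add a b ha hb =>
    simp only [realPolyEval, Polynomial.map_add, map_add] at *
    rw [adj_add, ha, hb]
  | monomial n a =>
    simp only [realPolyEval, Polynomial.map_monomial, Polynomial.aeval_monomial]
    rw [← Algebra.smul_def, adj_smul, adj_pow J hA]
    simp

theorem isPositive_of_adj_eq {G : K →L[ℂ] K} (hG : J.adj G = G)
    (h : ∀ x, 0 ≤ (J.form (G x) x).re) : (J.symm * G).IsPositive := by
  have hsym : ∀ x y : K, inner ℂ (J.symm (G x)) y = inner ℂ x (J.symm (G y)) := by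
    intro x y
    have h1 := J.form_adj G y x
    rw [hG] at h1
    simp only [form] at h1
    rw [h1, inner_symm]
  refine ⟨fun x y => hsym x y, fun x => ?_⟩
  have h2 := h x
  simp only [form] at h2
  rw [ContinuousLinearMap.reApplyInnerSelf_apply]
  simpa [hsym] using h2

end KreinStructure

/-! ## The Hilbert space completion of a semidefinite form -/

section Gram

variable {K : Type*} [NormedAddCommGroup K] [InnerProductSpace ℂ K]

/-- The space `K` with the semidefinite inner product `⟨x, S y⟩` for a positive operator `S`. -/
def GramSpace (S : K →L[ℂ] K) (_hS : S.IsPositive) : Type _ := K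

variable (S : K →L[ℂ] K) (hS : S.IsPositive)

instance : AddCommGroup (GramSpace S hS) := inferInstanceAs (AddCommGroup K)

instance : Module ℂ (GramSpace S hS) := inferInstanceAs (Module ℂ K)

/-- The identity map onto `GramSpace S hS`. -/
def toGram : K →ₗ[ℂ] GramSpace S hS := LinearMap.id

/-- The identity map from `GramSpace S hS`. -/
def ofGram : GramSpace S hS →ₗ[ℂ] K := LinearMap.id

/-- The semidefinite inner product of `GramSpace S hS`. -/
abbrev gramCore : PreInnerProductSpace.Core ℂ (GramSpace S hS) where
  inner x y := inner ℂ (ofGram S hS x) (S (ofGram S hS y))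
  conj_inner_symm x y := by
    rw [inner_conj_symm]
    exact hS.inner_left_eq_inner_right _ _
  re_inner_nonneg x := hS.re_inner_nonneg_right _
  add_left x y z := by rw [map_add, inner_add_left]
  smul_left x y r := by rw [map_smul, inner_smul_left]

instance : SeminormedAddCommGroup (GramSpace S hS) :=
  InnerProductSpace.Core.toSeminormedAddCommGroup (c := gramCore S hS)

instance : InnerProductSpace ℂ (GramSpace S hS) := InnerProductSpace.ofCore (gramCore S hS)

/-- The (Hausdorff) completion of `GramSpace S hS`, that is the Hilbert space completion of
`K / ker S` with respect to `⟨x, S y⟩`. -/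
abbrev GramCompletion := UniformSpace.Completion (GramSpace S hS)

theorem gram_inner (x y : GramSpace S hS) :
    inner ℂ x y = inner ℂ (ofGram S hS x) (S (ofGram S hS y)) := rfl

theorem gram_norm_sq (x : GramSpace S hS) :
    ‖x‖ ^ 2 = (inner ℂ (ofGram S hS x) (S (ofGram S hS x)) : ℂ).re := by
  rw [← gram_inner]
  exact norm_sq_eq_re_inner (𝕜 := ℂ) x

theorem norm_toGram_le (x : K) : ‖toGram S hS x‖ ≤ √‖S‖ * ‖x‖ := by
  refine le_of_sq_le_sq ?_ (by positivity)
  rw [gram_norm_sq, mul_pow, Real.sq_sqrt (norm_nonneg _)]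
  calc (inner ℂ x (S x) : ℂ).re ≤ ‖(inner ℂ x (S x) : ℂ)‖ := Complex.re_le_norm _
    _ ≤ ‖x‖ * ‖S x‖ := norm_inner_le_norm _ _
    _ ≤ ‖x‖ * (‖S‖ * ‖x‖) := by gcongr; exact S.le_opNorm x
    _ = ‖S‖ * ‖x‖ ^ 2 := by ring

/-- The bounded map `K → V` with dense range, where `V` is the completion with respect to
`⟨x, S y⟩`. -/
def gramEmbed : K →L[ℂ] GramCompletion S hS :=
  UniformSpace.Completion.toComplL.comp
    ((toGram S hS).mkContinuous (√‖S‖) (norm_toGram_le S hS))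

/-- For positive operators `S ≤ S'` the contraction from the completion for `S'` to the completion
for `S` that extends the identity of `K`. -/
def gramRestrict (S S' : K →L[ℂ] K) (hS : S.IsPositive) (hS' : S'.IsPositive)
    (h : (S' - S).IsPositive) : GramCompletion S' hS' →L[ℂ] GramCompletion S hS :=
  ((toGram S hS ∘ₗ ofGram S' hS').mkContinuous 1 (fun x => by
    refine le_of_sq_le_sq ?_ (by positivity)
    rw [one_mul, gram_norm_sq, gram_norm_sq]
    have h := h.re_inner_nonneg_right (ofGram S' hS' x)
    rw [sub_apply, inner_sub_right, map_sub] at h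
    exact sub_nonneg.1 h)).completion

theorem gramRestrict_gramEmbed (S S' : K →L[ℂ] K) (hS : S.IsPositive) (hS' : S'.IsPositive)
    (h : (S' - S).IsPositive) (x : K) :
    gramRestrict S S' hS hS' h (gramEmbed S' hS' x) = gramEmbed S hS x :=
  ContinuousLinearMap.completion_apply_coe _ _

theorem inner_gramEmbed (x y : K) :
    inner ℂ (gramEmbed S hS x) (gramEmbed S hS y) = inner ℂ x (S y) :=
  UniformSpace.Completion.inner_coe _ _

end Gram

/-! ## Jets -/

/-- Jets with entries indexed by a lower set of `ℕ × ℕ`. -/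
def Jet (I : LowerSet (ℕ × ℕ)) : Type := I → ℂ

namespace Jet

variable {I : LowerSet (ℕ × ℕ)}

/-- The entry with index `(k, l)`, and `0` if `(k, l)` is not an index. -/
def coeff (a : Jet I) (k l : ℕ) : ℂ :=
  open scoped Classical in if h : (k, l) ∈ I then a ⟨(k, l), h⟩ else 0

theorem ext_coeff {a b : Jet I} (h : ∀ k l, (k, l) ∈ I → a.coeff k l = b.coeff k l) : a = b := by
  funext i
  have h1 := h i.1.1 i.1.2 i.2
  have h2 : ((i.1.1, i.1.2) : ℕ × ℕ) ∈ I := i.2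
  simpa [coeff, h2] using h1

/-- The jet with given entries. -/
def ofFun (I : LowerSet (ℕ × ℕ)) (f : ℕ → ℕ → ℂ) : Jet I := fun i => f i.1.1 i.1.2

theorem coeff_ofFun (f : ℕ → ℕ → ℂ) {k l : ℕ} (h : (k, l) ∈ I) :
    (ofFun I f).coeff k l = f k l := by simp [coeff, ofFun, h]

instance : AddCommGroup (Jet I) := inferInstanceAs (AddCommGroup (I → ℂ))

instance : Module ℂ (Jet I) := inferInstanceAs (Module ℂ (I → ℂ))

/-- The truncated Cauchy product. -/
instance : Mul (Jet I) where
  mul a b := ofFun I fun k l =>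
    ∑ c ∈ Finset.range (k + 1), ∑ d ∈ Finset.range (l + 1), a.coeff c d * b.coeff (k - c) (l - d)

instance : One (Jet I) where
  one := ofFun I fun k l => if k = 0 ∧ l = 0 then 1 else 0

theorem coeff_add (a b : Jet I) (k l : ℕ) : (a + b).coeff k l = a.coeff k l + b.coeff k l := by
  by_cases h : (k, l) ∈ I
  · simp only [coeff, h, dif_pos]; rfl
  · simp [coeff, h]

theorem coeff_smul (r : ℂ) (a : Jet I) (k l : ℕ) : (r • a).coeff k l = r * a.coeff k l := by
  by_cases h : (k, l) ∈ I
  · simp only [coeff, h, dif_pos]; rfl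
  · simp [coeff, h]

theorem coeff_zero (k l : ℕ) : (0 : Jet I).coeff k l = 0 := by
  by_cases h : (k, l) ∈ I
  · simp only [coeff, h, dif_pos]; rfl
  · simp [coeff, h]

theorem coeff_mul (a b : Jet I) {k l : ℕ} (h : (k, l) ∈ I) :
    (a * b).coeff k l = ∑ c ∈ Finset.range (k + 1), ∑ d ∈ Finset.range (l + 1),
      a.coeff c d * b.coeff (k - c) (l - d) := coeff_ofFun _ h

theorem coeff_one {k l : ℕ} (h : (k, l) ∈ I) :
    (1 : Jet I).coeff k l = if k = 0 ∧ l = 0 then 1 else 0 := coeff_ofFun _ h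

/-- The truncation of a formal power series in two variables. -/
def ofSeries (I : LowerSet (ℕ × ℕ)) (f : PowerSeries (PowerSeries ℂ)) : Jet I :=
  ofFun I fun k l => PowerSeries.coeff l (PowerSeries.coeff k f)

theorem ofSeries_surjective : Function.Surjective (ofSeries I) := by
  intro a
  refine ⟨PowerSeries.mk fun k => PowerSeries.mk fun l => a.coeff k l, ?_⟩
  refine ext_coeff fun k l h => ?_
  simp [ofSeries, coeff_ofFun _ h]

theorem ofSeries_mul (f g : PowerSeries (PowerSeries ℂ)) :
    ofSeries I (f * g) = ofSeries I f * ofSeries I g := by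
  refine ext_coeff fun k l h => ?_
  rw [coeff_mul _ _ h, ofSeries, coeff_ofFun _ h, PowerSeries.coeff_mul, map_sum,
    Finset.Nat.sum_antidiagonal_eq_sum_range_succ_mk]
  refine Finset.sum_congr rfl fun c hc => ?_
  rw [PowerSeries.coeff_mul, Finset.Nat.sum_antidiagonal_eq_sum_range_succ_mk]
  refine Finset.sum_congr rfl fun d hd => ?_
  simp only [Finset.mem_range, Nat.lt_succ_iff] at hc hd
  have h1 : (c, d) ∈ I := I.lower (show (c, d) ≤ (k, l) from ⟨hc, hd⟩) h
  have h2 : (k - c, l - d) ∈ I :=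
    I.lower (show (k - c, l - d) ≤ (k, l) from ⟨Nat.sub_le _ _, Nat.sub_le _ _⟩) h
  simp [ofSeries, coeff_ofFun _ h1, coeff_ofFun _ h2]

theorem ofSeries_add (f g : PowerSeries (PowerSeries ℂ)) :
    ofSeries I (f + g) = ofSeries I f + ofSeries I g := by
  refine ext_coeff fun k l h => ?_
  simp [coeff_add, ofSeries, coeff_ofFun _ h]

theorem ofSeries_one : ofSeries I 1 = 1 := by
  refine ext_coeff fun k l h => ?_
  rw [coeff_one h, ofSeries, coeff_ofFun _ h, PowerSeries.coeff_one]
  by_cases hk : k = 0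
  · simp [hk, PowerSeries.coeff_one]
  · simp [hk]

theorem ofSeries_zero : ofSeries I 0 = 0 := by
  refine ext_coeff fun k l h => ?_
  simp [coeff_zero, ofSeries, coeff_ofFun _ h]

instance : CommRing (Jet I) :=
  { (inferInstance : AddCommGroup (Jet I)), (inferInstance : Mul (Jet I)),
    (inferInstance : One (Jet I)) with
    mul_assoc := by
      intro a b c
      obtain ⟨f, rfl⟩ := ofSeries_surjective a
      obtain ⟨g, rfl⟩ := ofSeries_surjective b
      obtain ⟨h, rfl⟩ := ofSeries_surjective c
      simp only [← ofSeries_mul, mul_assoc]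
    mul_comm := by
      intro a b
      obtain ⟨f, rfl⟩ := ofSeries_surjective a
      obtain ⟨g, rfl⟩ := ofSeries_surjective b
      simp only [← ofSeries_mul, mul_comm]
    one_mul := by
      intro a
      obtain ⟨f, rfl⟩ := ofSeries_surjective a
      simp only [← ofSeries_mul, ← ofSeries_one, one_mul]
    mul_one := by
      intro a
      obtain ⟨f, rfl⟩ := ofSeries_surjective a
      simp only [← ofSeries_mul, ← ofSeries_one, mul_one]
    zero_mul := by
      intro a
      obtain ⟨f, rfl⟩ := ofSeries_surjective a
      simp only [← ofSeries_mul, ← ofSeries_zero, zero_mul]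
    mul_zero := by
      intro a
      obtain ⟨f, rfl⟩ := ofSeries_surjective a
      simp only [← ofSeries_mul, ← ofSeries_zero, mul_zero]
    left_distrib := by
      intro a b c
      obtain ⟨f, rfl⟩ := ofSeries_surjective a
      obtain ⟨g, rfl⟩ := ofSeries_surjective b
      obtain ⟨h, rfl⟩ := ofSeries_surjective c
      simp only [← ofSeries_mul, ← ofSeries_add, mul_add]
    right_distrib := by
      intro a b c
      obtain ⟨f, rfl⟩ := ofSeries_surjective a
      obtain ⟨g, rfl⟩ := ofSeries_surjective b
      obtain ⟨h, rfl⟩ := ofSeries_surjective c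
      simp only [← ofSeries_mul, ← ofSeries_add, add_mul] }

theorem smul_mul (r : ℂ) (a b : Jet I) : r • a * b = r • (a * b) := by
  refine ext_coeff fun k l h => ?_
  simp only [coeff_smul, coeff_mul _ _ h, Finset.mul_sum, mul_assoc]

instance : Algebra ℂ (Jet I) :=
  Algebra.ofModule smul_mul fun r a b => by rw [mul_comm, smul_mul, mul_comm]

/-- Entrywise complex conjugation. -/
def conjugate {I' : LowerSet (ℕ × ℕ)} (a : Jet I) : Jet I' := ofFun I' fun k l => conj (a.coeff k l)

theorem coeff_conjugate (a : Jet I) {I' : LowerSet (ℕ × ℕ)} (hI : I = I') (k l : ℕ) :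
    (a.conjugate : Jet I').coeff k l = conj (a.coeff k l) := by
  subst hI
  by_cases h : (k, l) ∈ I
  · exact coeff_ofFun _ h
  · simp [coeff, h]

theorem conjugate_mul (a b : Jet I) {I' : LowerSet (ℕ × ℕ)} (hI : I = I') :
    ((a * b).conjugate : Jet I') = a.conjugate * b.conjugate := by
  refine ext_coeff fun k l h => ?_
  simp only [coeff_conjugate _ hI, coeff_mul _ _ h, coeff_mul a b (hI ▸ h), map_sum, map_mul]

theorem conjugate_add (a b : Jet I) {I' : LowerSet (ℕ × ℕ)} (hI : I = I') :
    ((a + b).conjugate : Jet I') = a.conjugate + b.conjugate := by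
  refine ext_coeff fun k l h => ?_
  simp only [coeff_conjugate _ hI, coeff_add, map_add]

theorem conjugate_smul (r : ℂ) (a : Jet I) {I' : LowerSet (ℕ × ℕ)} (hI : I = I') :
    ((r • a).conjugate : Jet I') = conj r • (a.conjugate : Jet I') := by
  refine ext_coeff fun k l h => ?_
  simp only [coeff_conjugate _ hI, coeff_smul, map_mul]

theorem conjugate_conjugate (a : Jet I) {I' : LowerSet (ℕ × ℕ)} (hI : I = I') :
    ((a.conjugate : Jet I').conjugate : Jet I) = a := by
  refine ext_coeff fun k l h => ?_
  simp only [coeff_conjugate _ hI.symm, coeff_conjugate _ hI, Complex.conj_conj]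

end Jet

/-- The index set `({0, …, m-1} × {0, …, n-1}) ∪ {(m, 0), (0, n)}` of the jets at the points of
`Z_p + i Z_q` (where `m, n ≥ 1`); for `m = n = 0` it is `{(0, 0)}`, so that the jets are complex
numbers. -/
def extIndex (m n : ℕ) : LowerSet (ℕ × ℕ) where
  carrier := {i | (i.1 < m ∧ i.2 < n) ∨ (i.1 ≤ m ∧ i.2 = 0) ∨ (i.1 = 0 ∧ i.2 ≤ n)}
  lower' := by
    rintro ⟨a, b⟩ ⟨c, d⟩ ⟨h1, h2⟩ h
    simp only [Set.mem_ofPred_eq] at *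
    omega

/-- The index set `{0, …, m-1} × {0, …, n-1}`. -/
def rectIndex (m n : ℕ) : LowerSet (ℕ × ℕ) where
  carrier := {i | i.1 < m ∧ i.2 < n}
  lower' := by
    rintro ⟨a, b⟩ ⟨c, d⟩ ⟨h1, h2⟩ h
    simp only [Set.mem_ofPred_eq] at *
    omega

theorem mem_extIndex_iff {m n : ℕ} (hm : 1 ≤ m) (hn : 1 ≤ n) (i : ℕ × ℕ) :
    i ∈ extIndex m n ↔ (i.1 < m ∧ i.2 < n) ∨ i = (m, 0) ∨ i = (0, n) := by
  obtain ⟨a, b⟩ := i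
  change (_ ∨ _ ∨ _) ↔ _
  simp only [Prod.mk.injEq]
  omega

theorem mem_extIndex_zero_iff (i : ℕ × ℕ) : i ∈ extIndex 0 0 ↔ i = (0, 0) := by
  obtain ⟨a, b⟩ := i
  change (_ ∨ _ ∨ _) ↔ _
  simp only [Prod.mk.injEq]
  omega

/-! ## The function classes -/

/-- The set `Z_p + i Z_q` of all `x + i y` with real zeros `x` of `p` and `y` of `q`. -/
def realZeros (p q : ℝ[X]) : Set ℂ := {z | p.eval z.re = 0 ∧ q.eval z.im = 0}

/-- The set of pairs `(ξ, η)` of complex zeros of `p` and `q` which are not both real. -/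
def nonrealZeros (p q : ℝ[X]) : Set (ℂ × ℂ) :=
  {ζ | (p.map (algebraMap ℝ ℂ)).eval ζ.1 = 0 ∧ (q.map (algebraMap ℝ ℂ)).eval ζ.2 = 0 ∧
    ¬ (ζ.1.im = 0 ∧ ζ.2.im = 0)}

/-- The index set of the jets at `z ∈ ℂ`: the extended jets at the points of `Z_p + i Z_q`, and
complex numbers elsewhere. -/
def realIndex (p q : ℝ[X]) (z : ℂ) : LowerSet (ℕ × ℕ) :=
  open scoped Classical in
  if z ∈ realZeros p q then extIndex (p.rootMultiplicity z.re) (q.rootMultiplicity z.im)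
  else extIndex 0 0

/-- The index set of the jets at `(ξ, η) ∈ ℂ²`. -/
def nonrealIndex (p q : ℝ[X]) (ζ : ℂ × ℂ) : LowerSet (ℕ × ℕ) :=
  rectIndex ((p.map (algebraMap ℝ ℂ)).rootMultiplicity ζ.1)
    ((q.map (algebraMap ℝ ℂ)).rootMultiplicity ζ.2)

theorem zero_mem_realIndex (p q : ℝ[X]) (z : ℂ) : (0, 0) ∈ realIndex p q z := by
  unfold realIndex
  split_ifs
  · exact Or.inr (Or.inl ⟨Nat.zero_le _, rfl⟩)
  · exact Or.inr (Or.inl ⟨le_rfl, rfl⟩)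

theorem eval_conj_map (p : ℝ[X]) (z : ℂ) :
    (p.map (algebraMap ℝ ℂ)).eval (conj z) = conj ((p.map (algebraMap ℝ ℂ)).eval z) := by
  simp only [Polynomial.eval_map_algebraMap]
  exact Polynomial.aeval_algHom_apply Complex.conjAe.toAlgHom z p

theorem conj_mem_nonrealZeros {p q : ℝ[X]} {ζ : ℂ × ℂ} (h : ζ ∈ nonrealZeros p q) :
    (conj ζ.1, conj ζ.2) ∈ nonrealZeros p q := by
  obtain ⟨h1, h2, h3⟩ := h
  refine ⟨?_, ?_, ?_⟩
  · rw [eval_conj_map, h1, map_zero]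
  · rw [eval_conj_map, h2, map_zero]
  · simpa using h3

theorem rootMultiplicity_conj (p : ℝ[X]) (z : ℂ) :
    (p.map (algebraMap ℝ ℂ)).rootMultiplicity (conj z) =
      (p.map (algebraMap ℝ ℂ)).rootMultiplicity z := by
  rw [Polynomial.eq_rootMultiplicity_map (f := starRingEnd ℂ) (RingHom.injective _) z,
    Polynomial.map_map]
  congr 2
  ext x
  simp

theorem nonrealIndex_conj (p q : ℝ[X]) (ζ : ℂ × ℂ) :
    nonrealIndex p q (conj ζ.1, conj ζ.2) = nonrealIndex p q ζ := by
  simp only [nonrealIndex, rootMultiplicity_conj]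

/-- The algebra of all jet-valued functions on the disjoint union of `σ ∪ (Z_p + i Z_q)` and the
set of nonreal pairs of zeros. -/
def Symbols (p q : ℝ[X]) (σ : Set ℂ) : Type :=
  ((z : ↥(σ ∪ realZeros p q)) → Jet (realIndex p q z)) ×
    ((ζ : ↥(nonrealZeros p q)) → Jet (nonrealIndex p q ζ))

namespace Symbols

variable {p q : ℝ[X]} {σ : Set ℂ}

instance : CommRing (Symbols p q σ) :=
  inferInstanceAs (CommRing (((z : ↥(σ ∪ realZeros p q)) → Jet (realIndex p q z)) ×
    ((ζ : ↥(nonrealZeros p q)) → Jet (nonrealIndex p q ζ))))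

instance : Algebra ℂ (Symbols p q σ) :=
  inferInstanceAs (Algebra ℂ (((z : ↥(σ ∪ realZeros p q)) → Jet (realIndex p q z)) ×
    ((ζ : ↥(nonrealZeros p q)) → Jet (nonrealIndex p q ζ))))

/-- The involution `φ#`: `φ#(z)` is the conjugate of `φ(z)` at the points of the complex plane, and
`φ#(ξ, η)` is the conjugate of `φ(conj ξ, conj η)` at the nonreal pairs of zeros. -/
instance : Star (Symbols p q σ) where
  star φ := (fun z => (φ.1 z).conjugate,
    fun ζ => (φ.2 ⟨(conj ζ.1.1, conj ζ.1.2), conj_mem_nonrealZeros ζ.2⟩).conjugate)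

theorem ext' {φ ψ : Symbols p q σ} (h1 : ∀ z, φ.1 z = ψ.1 z) (h2 : ∀ ζ, φ.2 ζ = ψ.2 ζ) : φ = ψ :=
  Prod.ext (funext h1) (funext h2)

theorem snd_congr (φ : Symbols p q σ) {ζ ζ' : ↥(nonrealZeros p q)} (h : ζ = ζ') (k l : ℕ) :
    (φ.2 ζ).coeff k l = (φ.2 ζ').coeff k l := by rw [h]

instance : StarRing (Symbols p q σ) where
  star_involutive φ := by
    refine ext' (fun z => Jet.conjugate_conjugate _ rfl) (fun ζ => ?_)
    refine Jet.ext_coeff fun k l _ => ?_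
    change (Jet.conjugate (Jet.conjugate _)).coeff k l = _
    have h2 := nonrealIndex_conj p q (conj ζ.1.1, conj ζ.1.2)
    rw [Jet.coeff_conjugate _ (nonrealIndex_conj p q ζ.1), Jet.coeff_conjugate _ h2,
      Complex.conj_conj]
    refine snd_congr φ ?_ k l
    simp
  star_mul φ ψ := by
    rw [mul_comm]
    refine ext' (fun z => ?_) (fun ζ => ?_)
    · exact Jet.conjugate_mul _ _ rfl
    · exact Jet.conjugate_mul _ _ (nonrealIndex_conj p q ζ.1)
  star_add φ ψ := by
    refine ext' (fun z => ?_) (fun ζ => ?_)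
    · exact Jet.conjugate_add _ _ rfl
    · exact Jet.conjugate_add _ _ (nonrealIndex_conj p q ζ.1)

instance : StarModule ℂ (Symbols p q σ) where
  star_smul r φ := by
    refine ext' (fun z => ?_) (fun ζ => ?_)
    · exact Jet.conjugate_smul _ _ rfl
    · exact Jet.conjugate_smul _ _ (nonrealIndex_conj p q ζ.1)

/-- The entry of `φ(z)` with index `(k, l)`; in particular `φ.entry z 0 0` is the complex number
`φ(z)` if `z ∈ σ` lies outside of `Z_p + i Z_q`. -/
def entry (φ : Symbols p q σ) (z : ℂ) (k l : ℕ) : ℂ :=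
  open scoped Classical in if h : z ∈ σ ∪ realZeros p q then (φ.1 ⟨z, h⟩).coeff k l else 0

theorem entry_of_mem (φ : Symbols p q σ) {z : ℂ} (h : z ∈ σ ∪ realZeros p q) (k l : ℕ) :
    φ.entry z k l = (φ.1 ⟨z, h⟩).coeff k l := by simp [entry, h]

theorem entry_add (φ ψ : Symbols p q σ) (z : ℂ) (k l : ℕ) :
    (φ + ψ).entry z k l = φ.entry z k l + ψ.entry z k l := by
  by_cases h : z ∈ σ ∪ realZeros p q
  · simp only [entry_of_mem _ h]; exact Jet.coeff_add _ _ _ _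
  · simp [entry, h]

theorem entry_mul (φ ψ : Symbols p q σ) {z : ℂ} {k l : ℕ} (h : (k, l) ∈ realIndex p q z) :
    (φ * ψ).entry z k l = ∑ c ∈ Finset.range (k + 1), ∑ d ∈ Finset.range (l + 1),
      φ.entry z c d * ψ.entry z (k - c) (l - d) := by
  by_cases hz : z ∈ σ ∪ realZeros p q
  · simp only [entry_of_mem _ hz]; exact Jet.coeff_mul _ _ h
  · simp [entry, hz]

theorem entry_mul_zero (φ ψ : Symbols p q σ) (z : ℂ) :
    (φ * ψ).entry z 0 0 = φ.entry z 0 0 * ψ.entry z 0 0 := by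
  simp [entry_mul φ ψ (zero_mem_realIndex p q z)]

theorem entry_star (φ : Symbols p q σ) (z : ℂ) (k l : ℕ) :
    (star φ).entry z k l = conj (φ.entry z k l) := by
  by_cases h : z ∈ σ ∪ realZeros p q
  · simp only [entry_of_mem _ h]; exact Jet.coeff_conjugate _ rfl _ _
  · simp [entry, h]

theorem entry_algebraMap (r : ℂ) {z : ℂ} (hz : z ∈ σ ∪ realZeros p q) {k l : ℕ}
    (h : (k, l) ∈ realIndex p q z) :
    (algebraMap ℂ (Symbols p q σ) r).entry z k l = if k = 0 ∧ l = 0 then r else 0 := by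
  rw [entry_of_mem _ hz, Algebra.algebraMap_eq_smul_one]
  refine (Jet.coeff_smul _ _ _ _).trans ?_
  have h1 : ((1 : Symbols p q σ).1 ⟨z, hz⟩).coeff k l = if k = 0 ∧ l = 0 then 1 else 0 :=
    Jet.coeff_one h
  rw [h1]
  simp

/-- The jet of a polynomial `s ∈ ℂ[z, w]` at `(a, b)`: its entry with index `(k, l)` is
`(∂^{k+l} s / ∂z^k ∂w^l)(a, b) / (k! l!)`. -/
def taylorCoeff (s : MvPolynomial (Fin 2) ℂ) (a b : ℂ) (k l : ℕ) : ℂ :=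
  1 / ((k.factorial : ℂ) * (l.factorial : ℂ)) *
    MvPolynomial.eval ![a, b] ((MvPolynomial.pderiv 0)^[k] ((MvPolynomial.pderiv 1)^[l] s))

/-- The polynomial `s ∈ ℂ[z, w]` as a jet-valued function `s_N`. -/
def ofPoly (s : MvPolynomial (Fin 2) ℂ) : Symbols p q σ :=
  (fun z => Jet.ofFun _ (taylorCoeff s (z.1.re : ℂ) (z.1.im : ℂ)),
    fun ζ => Jet.ofFun _ (taylorCoeff s ζ.1.1 ζ.1.2))

/-- The Taylor polynomial `∑_{k < m, l < n} φ(w)_{k,l} Re(z-w)^k Im(z-w)^l`, where `m` and `n` are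
the multiplicities of `Re w` and `Im w` as zeros of `p` and `q`. -/
def taylorSum (φ : Symbols p q σ) (w z : ℂ) : ℂ :=
  ∑ k ∈ Finset.range (p.rootMultiplicity w.re), ∑ l ∈ Finset.range (q.rootMultiplicity w.im),
    φ.entry w k l * ((z - w).re : ℂ) ^ k * ((z - w).im : ℂ) ^ l

/-- The gauge `max (|Re(z-w)|^m) (|Im(z-w)|^n)`, with `m` and `n` as in `taylorSum`. -/
def gauge (p q : ℝ[X]) (w z : ℂ) : ℝ :=
  max (|(z - w).re| ^ p.rootMultiplicity w.re) (|(z - w).im| ^ q.rootMultiplicity w.im)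

/-- Membership in the function class: `φ` is measurable and bounded on `σ \ (Z_p + i Z_q)`, and at
each `w ∈ σ ∩ (Z_p + i Z_q)` the difference of `φ` and its Taylor polynomial at `w` is
`O(max (|Re(z-w)|^m) (|Im(z-w)|^n))` as `z → w` in `σ \ (Z_p + i Z_q)`. (The set `Z_p + i Z_q` is
finite, so near `w` its only point is `w`.) -/
structure IsAdmissible (φ : Symbols p q σ) : Prop where
  measurable : Measurable fun z : ↥(σ \ realZeros p q) => φ.entry z 0 0
  bounded : ∃ C : ℝ, ∀ z ∈ σ \ realZeros p q, ‖φ.entry z 0 0‖ ≤ C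
  growth : ∀ w ∈ σ ∩ realZeros p q,
    (fun z => φ.entry z 0 0 - φ.taylorSum w z) =O[𝓝[σ \ realZeros p q] w] gauge p q w

theorem entry_isBigO_one {φ : Symbols p q σ} (h : φ.IsAdmissible) (w : ℂ) :
    (fun z => φ.entry z 0 0) =O[𝓝[σ \ realZeros p q] w] (fun _ => (1 : ℝ)) := by
  obtain ⟨C, hC⟩ := h.bounded
  refine Asymptotics.IsBigO.of_bound C ?_
  filter_upwards [self_mem_nhdsWithin] with z hz
  simpa using hC z hz

theorem taylorSum_isBigO_one (φ : Symbols p q σ) (w : ℂ) (s : Set ℂ) :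
    (fun z => φ.taylorSum w z) =O[𝓝[s] w] (fun _ => (1 : ℝ)) := by
  have hc : Continuous fun z => φ.taylorSum w z := by
    unfold taylorSum
    fun_prop
  exact ((hc.tendsto w).mono_left nhdsWithin_le_nhds).isBigO_one ℝ

theorem gauge_nonneg (w z : ℂ) : 0 ≤ gauge p q w z := le_max_of_le_left (by positivity)

theorem monomial_isBigO_gauge (r : ℂ) (w : ℂ) (s : Set ℂ) {k l : ℕ}
    (h : p.rootMultiplicity w.re ≤ k ∨ q.rootMultiplicity w.im ≤ l) :
    (fun z : ℂ => r * ((z - w).re : ℂ) ^ k * ((z - w).im : ℂ) ^ l) =O[𝓝[s] w] gauge p q w := by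
  refine Asymptotics.IsBigO.of_bound ‖r‖ ?_
  have hball : ∀ᶠ z in 𝓝[s] w, z ∈ Metric.ball w 1 :=
    nhdsWithin_le_nhds (Metric.ball_mem_nhds w one_pos)
  filter_upwards [hball] with z hz
  have hz' : ‖z - w‖ ≤ 1 := by
    rw [Metric.mem_ball, dist_eq_norm] at hz
    exact hz.le
  have h1 : |(z - w).re| ≤ 1 := (Complex.abs_re_le_norm _).trans hz'
  have h2 : |(z - w).im| ≤ 1 := (Complex.abs_im_le_norm _).trans hz'
  rw [norm_mul, norm_mul, norm_pow, norm_pow, Complex.norm_real, Complex.norm_real, mul_assoc,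
    Real.norm_of_nonneg (gauge_nonneg w z), Real.norm_eq_abs, Real.norm_eq_abs]
  refine mul_le_mul_of_nonneg_left ?_ (norm_nonneg r)
  rcases h with h | h
  · refine le_max_of_le_left ?_
    calc |(z - w).re| ^ k * |(z - w).im| ^ l ≤ |(z - w).re| ^ k * 1 := by
          gcongr; exact pow_le_one₀ (abs_nonneg _) h2
      _ ≤ _ := by rw [mul_one]; exact pow_le_pow_of_le_one (abs_nonneg _) h1 h
  · refine le_max_of_le_right ?_
    calc |(z - w).re| ^ k * |(z - w).im| ^ l ≤ 1 * |(z - w).im| ^ l := by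
          gcongr; exact pow_le_one₀ (abs_nonneg _) h1
      _ ≤ _ := by rw [one_mul]; exact pow_le_pow_of_le_one (abs_nonneg _) h2 h

theorem sum_diag (m : ℕ) (f : ℕ → ℕ → ℂ) :
    ∑ k ∈ Finset.range m, ∑ c ∈ Finset.range (k + 1), f c (k - c) =
      ∑ c ∈ Finset.range m, ∑ e ∈ Finset.range m, if c + e < m then f c e else 0 := by
  rw [Finset.sum_range_diag_flip]
  refine Finset.sum_congr rfl fun c _ => ?_
  rw [← Finset.sum_filter]
  refine Finset.sum_congr ?_ fun _ _ => rfl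
  ext e
  simp only [Finset.mem_range, Finset.mem_filter]
  omega

theorem taylorSum_mul_isBigO (φ ψ : Symbols p q σ) {w : ℂ} (hw : w ∈ realZeros p q) (s : Set ℂ) :
    (fun z => φ.taylorSum w z * ψ.taylorSum w z - (φ * ψ).taylorSum w z) =O[𝓝[s] w]
      gauge p q w := by
  set m := p.rootMultiplicity w.re with hm
  set n := q.rootMultiplicity w.im with hn
  have hidx : ∀ k l, k < m → l < n → (k, l) ∈ realIndex p q w := by
    intro k l hk hl
    rw [realIndex, if_pos hw]
    exact Or.inl ⟨hk, hl⟩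
  have key : ∀ z, φ.taylorSum w z * ψ.taylorSum w z - (φ * ψ).taylorSum w z =
      ∑ c ∈ Finset.range m, ∑ e ∈ Finset.range m, ∑ d ∈ Finset.range n, ∑ f ∈ Finset.range n,
        (if c + e < m ∧ d + f < n then 0 else
          φ.entry w c d * ψ.entry w e f * ((z - w).re : ℂ) ^ (c + e) *
            ((z - w).im : ℂ) ^ (d + f)) := by
    intro z
    set X : ℂ := ((z - w).re : ℂ) with hX
    set Y : ℂ := ((z - w).im : ℂ) with hY
    have e1 : (φ * ψ).taylorSum w z =
        ∑ c ∈ Finset.range m, ∑ e ∈ Finset.range m, ∑ d ∈ Finset.range n, ∑ f ∈ Finset.range n,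
          (if c + e < m ∧ d + f < n then
            φ.entry w c d * ψ.entry w e f * X ^ (c + e) * Y ^ (d + f) else 0) := by
      have e2 : (φ * ψ).taylorSum w z = ∑ k ∈ Finset.range m, ∑ c ∈ Finset.range (k + 1),
          ∑ l ∈ Finset.range n, ∑ d ∈ Finset.range (l + 1),
            φ.entry w c d * ψ.entry w (k - c) (l - d) * X ^ (c + (k - c)) *
              Y ^ (d + (l - d)) := by
        unfold taylorSum
        refine Finset.sum_congr rfl fun k hk => ?_
        rw [Finset.sum_comm]
        refine Finset.sum_congr rfl fun l hl => ?_
        rw [entry_mul φ ψ (hidx k l (Finset.mem_range.1 hk) (Finset.mem_range.1 hl)),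
          Finset.sum_mul, Finset.sum_mul]
        refine Finset.sum_congr rfl fun c hc => ?_
        rw [Finset.sum_mul, Finset.sum_mul]
        refine Finset.sum_congr rfl fun d hd => ?_
        have hc' : c + (k - c) = k := by have := Finset.mem_range.1 hc; omega
        have hd' : d + (l - d) = l := by have := Finset.mem_range.1 hd; omega
        rw [hc', hd']
      rw [e2, sum_diag m (fun c e => ∑ l ∈ Finset.range n, ∑ d ∈ Finset.range (l + 1),
            φ.entry w c d * ψ.entry w e (l - d) * X ^ (c + e) * Y ^ (d + (l - d)))]
      refine Finset.sum_congr rfl fun c _ => Finset.sum_congr rfl fun e _ => ?_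
      rw [sum_diag n (fun d f => φ.entry w c d * ψ.entry w e f * X ^ (c + e) * Y ^ (d + f))]
      by_cases h : c + e < m
      · simp [h]
      · simp [h]
    have e3 : φ.taylorSum w z * ψ.taylorSum w z =
        ∑ c ∈ Finset.range m, ∑ e ∈ Finset.range m, ∑ d ∈ Finset.range n, ∑ f ∈ Finset.range n,
            φ.entry w c d * ψ.entry w e f * X ^ (c + e) * Y ^ (d + f) := by
      unfold taylorSum
      rw [Finset.sum_mul_sum]
      refine Finset.sum_congr rfl fun c _ => Finset.sum_congr rfl fun e _ => ?_
      rw [Finset.sum_mul_sum]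
      refine Finset.sum_congr rfl fun d _ => Finset.sum_congr rfl fun f _ => ?_
      ring
    rw [e1, e3]
    simp only [← Finset.sum_sub_distrib]
    refine Finset.sum_congr rfl fun c _ => Finset.sum_congr rfl fun e _ =>
      Finset.sum_congr rfl fun d _ => Finset.sum_congr rfl fun f _ => ?_
    split_ifs <;> simp
  simp only [key]
  refine Asymptotics.IsBigO.fun_sum fun c _ => ?_
  refine Asymptotics.IsBigO.fun_sum fun e _ => ?_
  refine Asymptotics.IsBigO.fun_sum fun d _ => ?_
  refine Asymptotics.IsBigO.fun_sum fun f _ => ?_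
  by_cases h : c + e < m ∧ d + f < n
  · simp only [h, and_self, if_true]
    exact Asymptotics.isBigO_zero _ _
  · simp only [h, if_false]
    exact monomial_isBigO_gauge _ w s (by omega)

theorem IsAdmissible.mul {φ ψ : Symbols p q σ} (hφ : φ.IsAdmissible) (hψ : ψ.IsAdmissible) :
    (φ * ψ).IsAdmissible where
  measurable := by
    simp only [entry_mul_zero]
    exact hφ.measurable.mul hψ.measurable
  bounded := by
    obtain ⟨C, hC⟩ := hφ.bounded
    obtain ⟨D, hD⟩ := hψ.bounded
    refine ⟨C * D, fun z hz => ?_⟩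
    rw [entry_mul_zero, norm_mul]
    exact mul_le_mul (hC z hz) (hD z hz) (norm_nonneg _) ((norm_nonneg _).trans (hC z hz))
  growth w hw := by
    have h1 := (hφ.growth w hw).mul (entry_isBigO_one hψ w)
    have h2 := (taylorSum_isBigO_one φ w (σ \ realZeros p q)).mul (hψ.growth w hw)
    have h3 := taylorSum_mul_isBigO φ ψ hw.2 (σ \ realZeros p q)
    simp only [mul_one] at h1
    simp only [one_mul] at h2
    refine ((h1.add h2).add h3).congr_left fun z => ?_
    rw [entry_mul_zero]
    ring

theorem taylorSum_add (φ ψ : Symbols p q σ) (w z : ℂ) :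
    (φ + ψ).taylorSum w z = φ.taylorSum w z + ψ.taylorSum w z := by
  simp only [taylorSum, entry_add, add_mul, Finset.sum_add_distrib]

theorem IsAdmissible.add {φ ψ : Symbols p q σ} (hφ : φ.IsAdmissible) (hψ : ψ.IsAdmissible) :
    (φ + ψ).IsAdmissible where
  measurable := by
    simp only [entry_add]
    exact hφ.measurable.add hψ.measurable
  bounded := by
    obtain ⟨C, hC⟩ := hφ.bounded
    obtain ⟨D, hD⟩ := hψ.bounded
    refine ⟨C + D, fun z hz => ?_⟩
    rw [entry_add]
    exact norm_add_le_of_le (hC z hz) (hD z hz)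
  growth w hw := by
    refine ((hφ.growth w hw).add (hψ.growth w hw)).congr_left fun z => ?_
    rw [entry_add, taylorSum_add]
    ring

theorem IsAdmissible.star {φ : Symbols p q σ} (hφ : φ.IsAdmissible) :
    (star φ).IsAdmissible where
  measurable := by
    simp only [entry_star]
    exact Complex.continuous_conj.measurable.comp hφ.measurable
  bounded := by
    obtain ⟨C, hC⟩ := hφ.bounded
    refine ⟨C, fun z hz => ?_⟩
    rw [entry_star, RCLike.norm_conj]
    exact hC z hz
  growth w hw := by
    have h : ∀ z, (Star.star φ).entry z 0 0 - (Star.star φ).taylorSum w z =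
        conj (φ.entry z 0 0 - φ.taylorSum w z) := by
      intro z
      simp only [taylorSum, entry_star, map_sub, map_sum, map_mul, map_pow, Complex.conj_ofReal]
    simp only [h]
    have h2 := (hφ.growth w hw).norm_left
    rw [← Asymptotics.isBigO_norm_left]
    simpa only [RCLike.norm_conj] using h2

theorem isAdmissible_algebraMap (hp : p ≠ 0) (hq : q ≠ 0) (r : ℂ) :
    (algebraMap ℂ (Symbols p q σ) r).IsAdmissible where
  measurable := by
    have h : (fun z : ↥(σ \ realZeros p q) => (algebraMap ℂ (Symbols p q σ) r).entry z 0 0) =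
        fun _ => r := by
      funext z
      rw [entry_algebraMap r (Or.inl z.2.1) (zero_mem_realIndex p q z)]
      simp
    rw [h]
    exact measurable_const
  bounded := by
    refine ⟨‖r‖, fun z hz => ?_⟩
    rw [entry_algebraMap r (Or.inl hz.1) (zero_mem_realIndex p q z)]
    simp
  growth w hw := by
    have hm : 0 < p.rootMultiplicity w.re := (Polynomial.rootMultiplicity_pos hp).2 hw.2.1
    have hn : 0 < q.rootMultiplicity w.im := (Polynomial.rootMultiplicity_pos hq).2 hw.2.2
    have hT : ∀ z, (algebraMap ℂ (Symbols p q σ) r).taylorSum w z = r := by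
      intro z
      unfold taylorSum
      rw [Finset.sum_eq_single_of_mem 0 (Finset.mem_range.2 hm),
        Finset.sum_eq_single_of_mem 0 (Finset.mem_range.2 hn)]
      · rw [entry_algebraMap r (Or.inr hw.2) (zero_mem_realIndex p q w)]
        simp
      · intro l hl hl0
        rw [entry_algebraMap r (Or.inr hw.2)]
        · simp [hl0]
        · rw [realIndex, if_pos hw.2]
          exact Or.inl ⟨hm, Finset.mem_range.1 hl⟩
      · intro k hk hk0
        refine Finset.sum_eq_zero fun l hl => ?_
        rw [entry_algebraMap r (Or.inr hw.2)]
        · simp [hk0]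
        · rw [realIndex, if_pos hw.2]
          exact Or.inl ⟨Finset.mem_range.1 hk, Finset.mem_range.1 hl⟩
    refine (Asymptotics.isBigO_zero _ _).congr' ?_ Filter.EventuallyEq.rfl
    filter_upwards [self_mem_nhdsWithin] with z hz
    rw [hT, entry_algebraMap r (Or.inl hz.1) (zero_mem_realIndex p q z)]
    simp

/-- The `*`-algebra of all admissible functions. -/
def admissible (p q : ℝ[X]) (hp : p ≠ 0) (hq : q ≠ 0) (σ : Set ℂ) :
    StarSubalgebra ℂ (Symbols p q σ) where
  carrier := {φ | φ.IsAdmissible}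
  mul_mem' := IsAdmissible.mul
  add_mem' := IsAdmissible.add
  algebraMap_mem' := isAdmissible_algebraMap hp hq
  star_mem' := IsAdmissible.star

end Symbols

/-! ## Spectral measures -/

/-- A spectral measure on the Borel subsets of `ℂ`: a strongly countably additive, multiplicative,
orthogonal projection valued map with value `1` at `ℂ`. Only its values at Borel sets matter. -/
structure SpectralMeasure (H : Type*) [NormedAddCommGroup H] [InnerProductSpace ℂ H]
    [CompleteSpace H] where
  /-- the projection of a set -/
  proj : Set ℂ → H →L[ℂ] H
  isStarProjection : ∀ Δ, MeasurableSet Δ → IsStarProjection (proj Δ)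
  proj_univ : proj Set.univ = 1
  proj_inter : ∀ Δ Δ', MeasurableSet Δ → MeasurableSet Δ' → proj (Δ ∩ Δ') = proj Δ * proj Δ'
  hasSum_proj : ∀ Δ : ℕ → Set ℂ, (∀ n, MeasurableSet (Δ n)) → Pairwise (Function.onFun Disjoint Δ) →
    ∀ x, HasSum (fun n => proj (Δ n) x) (proj (⋃ n, Δ n) x)

namespace SpectralMeasure

variable {H : Type*} [NormedAddCommGroup H] [InnerProductSpace ℂ H] [CompleteSpace H]
  (E : SpectralMeasure H)

theorem inner_proj {Δ : Set ℂ} (hΔ : MeasurableSet Δ) (x : H) :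
    inner ℂ x (E.proj Δ x) = ((‖E.proj Δ x‖ ^ 2 : ℝ) : ℂ) := by
  have h := E.isStarProjection Δ hΔ
  have h1 : E.proj Δ (E.proj Δ x) = E.proj Δ x :=
    congrArg (fun C : H →L[ℂ] H => C x) h.isIdempotentElem.eq
  have h2 := h.isSelfAdjoint.adjoint_eq
  calc inner ℂ x (E.proj Δ x) = inner ℂ x (E.proj Δ (E.proj Δ x)) := by rw [h1]
    _ = inner ℂ (E.proj Δ x) (E.proj Δ x) := by
      conv_lhs => rw [← h2]
      rw [ContinuousLinearMap.adjoint_inner_right, h2]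
    _ = _ := by rw [inner_self_eq_norm_sq_to_K]; norm_cast

theorem proj_empty : E.proj ∅ = 0 := by
  ext x
  have h := E.hasSum_proj (fun _ => ∅) (fun _ => MeasurableSet.empty)
    (fun _ _ _ => disjoint_bot_left) x
  exact summable_const_iff _ |>.1 h.summable

/-- The measure `Δ ↦ ⟨E(Δ) x, x⟩`. -/
def scalar (x : H) : MeasureTheory.Measure ℂ :=
  MeasureTheory.Measure.ofMeasurable (fun Δ _ => ENNReal.ofReal (‖E.proj Δ x‖ ^ 2))
    (by simp [proj_empty])
    (by
      intro f hf hd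
      have h := E.hasSum_proj f hf hd x
      have h1 : HasSum (fun n => ‖E.proj (f n) x‖ ^ 2) (‖E.proj (⋃ n, f n) x‖ ^ 2) := by
        have h2 := (innerSL ℂ x).hasSum h
        have h3 := Complex.hasSum_re h2
        simp only [innerSL_apply_apply] at h3
        rw [E.inner_proj (MeasurableSet.iUnion hf), Complex.ofReal_re] at h3
        refine h3.congr_fun ?_
        intro n
        rw [E.inner_proj (hf n), Complex.ofReal_re]
      rw [← h1.tsum_eq, ENNReal.ofReal_tsum_of_nonneg (fun n => by positivity) h1.summable])

/-- The bounded operator `I` is the integral `∫ h dE` of the bounded Borel function `h`, that is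
`⟨I x, x⟩ = ∫ h d⟨E x, x⟩` for all `x`. -/
def IsIntegral (h : ℂ → ℂ) (I : H →L[ℂ] H) : Prop :=
  ∀ x, inner ℂ x (I x) = ∫ z, h z ∂(E.scalar x)

/-- `E` is the spectral measure of the normal operator `M`: it is supported on the spectrum of `M`
and `M = ∫ z dE`. -/
def IsSpectralMeasureOf (M : H →L[ℂ] H) : Prop :=
  E.proj (spectrum ℂ M)ᶜ = 0 ∧ E.IsIntegral (fun z => z) M

end SpectralMeasure

/-! ## Definitizable normal operators -/

/-- A bounded normal definitizable operator `N` on a Krein space, together with fixed real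
definitizing polynomials `p` and `q` of its real part and of its imaginary part. -/
structure DefinitizableNormal {K : Type*} [NormedAddCommGroup K] [InnerProductSpace ℂ K]
    [CompleteSpace K] (J : KreinStructure K) where
  /-- the operator -/
  N : K →L[ℂ] K
  normal : N * J.adj N = J.adj N * N
  /-- the definitizing polynomial of the real part -/
  p : ℝ[X]
  /-- the definitizing polynomial of the imaginary part -/
  q : ℝ[X]
  definitizing_p : J.IsDefinitizing p (J.rePart N)
  definitizing_q : J.IsDefinitizing q (J.imPart N)

namespace DefinitizableNormal

variable {K : Type*} [NormedAddCommGroup K] [InnerProductSpace ℂ K] [CompleteSpace K]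
  {J : KreinStructure K} (D : DefinitizableNormal J)

/-- The real part of `N`. -/
def A : K →L[ℂ] K := J.rePart D.N

/-- The imaginary part of `N`. -/
def B : K →L[ℂ] K := J.imPart D.N

/-- The operator `J p(A)`, so that `⟨x, J p(A) y⟩ = [x, p(A) y]`. -/
def gramA : K →L[ℂ] K := J.symm * realPolyEval D.p D.A

/-- The operator `J q(B)`, so that `⟨x, J q(B) y⟩ = [x, q(B) y]`. -/
def gramB : K →L[ℂ] K := J.symm * realPolyEval D.q D.B

theorem gramA_pos : D.gramA.IsPositive :=
  J.isPositive_of_adj_eq (J.adj_realPolyEval (J.adj_rePart D.N) D.p) D.definitizing_p.2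

theorem gramB_pos : D.gramB.IsPositive :=
  J.isPositive_of_adj_eq (J.adj_realPolyEval (J.adj_imPart D.N) D.q) D.definitizing_q.2

theorem gramSum_pos : (D.gramA + D.gramB).IsPositive := D.gramA_pos.add D.gramB_pos

/-- The Hilbert space completion `V₁` of `K / ker p(A)` with respect to `[p(A) x, y]`. -/
abbrev V₁ : Type _ := GramCompletion D.gramA D.gramA_pos

/-- The Hilbert space completion `V₂` of `K / ker q(B)` with respect to `[q(B) x, y]`. -/
abbrev V₂ : Type _ := GramCompletion D.gramB D.gramB_pos

/-- The Hilbert space completion `V` of `K / ker (p(A) + q(B))` with respect to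
`[(p(A) + q(B)) x, y]`. -/
abbrev V : Type _ := GramCompletion (D.gramA + D.gramB) D.gramSum_pos

/-- The embedding of `K` into `V`; it is the adjoint `T*` of `T`. -/
def Tstar : K →L[ℂ] D.V := gramEmbed (D.gramA + D.gramB) D.gramSum_pos

/-- The adjoint `T : V → K` of the embedding of `K` into `V`, with respect to the inner product of
`V` and the Krein space inner product of `K`. -/
def T : D.V →L[ℂ] K := J.symm ∘L ContinuousLinearMap.adjoint D.Tstar

theorem form_T (v : D.V) (x : K) : J.form (D.T v) x = inner ℂ (D.Tstar x) v := by
  simp [KreinStructure.form, T, J.symm_symm, ContinuousLinearMap.adjoint_inner_right]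

/-- `T T* = p(A) + q(B)`. -/
theorem T_Tstar : D.T ∘L D.Tstar = realPolyEval D.p D.A + realPolyEval D.q D.B := by
  ext x
  have h2 : ContinuousLinearMap.adjoint D.Tstar (D.Tstar x) = (D.gramA + D.gramB) x := by
    refine ext_inner_left ℂ fun y => ?_
    rw [ContinuousLinearMap.adjoint_inner_right]
    exact inner_gramEmbed _ D.gramSum_pos y x
  change J.symm (ContinuousLinearMap.adjoint D.Tstar (D.Tstar x)) = _
  rw [h2]
  simp [gramA, gramB, J.symm_symm]

/-- The adjoint `R₁* : V → V₁`, the bounded extension of `T* x ↦ T₁* x`. -/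
def R₁star : D.V →L[ℂ] D.V₁ :=
  gramRestrict D.gramA (D.gramA + D.gramB) D.gramA_pos D.gramSum_pos
    (by rw [add_sub_cancel_left]; exact D.gramB_pos)

/-- The adjoint `R₂* : V → V₂`, the bounded extension of `T* x ↦ T₂* x`. -/
def R₂star : D.V →L[ℂ] D.V₂ :=
  gramRestrict D.gramB (D.gramA + D.gramB) D.gramB_pos D.gramSum_pos
    (by rw [add_sub_cancel_right]; exact D.gramA_pos)

/-- The operator `R₁ R₁*` on `V`. -/
def RR₁ : D.V →L[ℂ] D.V := ContinuousLinearMap.adjoint D.R₁star ∘L D.R₁star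

/-- The operator `R₂ R₂*` on `V`. -/
def RR₂ : D.V →L[ℂ] D.V := ContinuousLinearMap.adjoint D.R₂star ∘L D.R₂star

/-- `Θ(C) = T⁻¹ C T`, the bounded operator `M` on `V` with `T M = C T` (unique, since `T` is
injective); it exists if `C` commutes with `T T*`. -/
def theta (C : K →L[ℂ] K) : D.V →L[ℂ] D.V :=
  open scoped Classical in if h : ∃ M : D.V →L[ℂ] D.V, D.T ∘L M = C ∘L D.T then h.choose else 0

/-- `Ξ(M) = T M T*`. -/
def xi (M : D.V →L[ℂ] D.V) : K →L[ℂ] K := D.T ∘L M ∘L D.Tstar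

/-- The spectrum of `Θ(N)`. -/
def sigma : Set ℂ := spectrum ℂ (D.theta D.N)

/-- The set `Z_p + i Z_q` of critical points in the complex plane. -/
def Z : Set ℂ := realZeros D.p D.q

/-- The algebra `M_N` of jet-valued functions. -/
abbrev M : Type := Symbols D.p D.q D.sigma

/-- The function class `F_N`. -/
abbrev F : StarSubalgebra ℂ D.M :=
  Symbols.admissible D.p D.q D.definitizing_p.1 D.definitizing_q.1 D.sigma

/-- The function `s_N`. -/
abbrev polyN (s : MvPolynomial (Fin 2) ℂ) : D.M := Symbols.ofPoly s

/-- The polynomial `p(z) + q(w)`. -/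
def pq : MvPolynomial (Fin 2) ℂ :=
  Polynomial.aeval (MvPolynomial.X 0) (D.p.map (algebraMap ℝ ℂ)) +
    Polynomial.aeval (MvPolynomial.X 1) (D.q.map (algebraMap ℝ ℂ))

/-- Membership in the ideal of those functions whose entries vanish at the points of `Z_p + i Z_q`
and at the nonreal pairs of zeros, except possibly for the entries with index `(m, 0)` and `(0, n)`
at the points of `Z_p + i Z_q`. -/
def IsResidual (φ : D.M) : Prop :=
  (∀ z ∈ D.Z, ∀ k < D.p.rootMultiplicity z.re, ∀ l < D.q.rootMultiplicity z.im,
    φ.entry z k l = 0) ∧ ∀ ζ, φ.2 ζ = 0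

/-- The decomposition `φ = s_N + (p_N + q_N) g` on `σ(Θ(N))`, where `φ - s_N` is residual and `g` is
bounded and measurable with values in `ℂ` outside of `Z_p + i Z_q`, and has the values
`(g₁, g₂) ∈ ℂ²` at the points of `Z_p + i Z_q`. At these points `(p_N + q_N) g` has the entries
`(p_N + q_N)_{m,0} g₁` and `(p_N + q_N)_{0,n} g₂`, and its other entries are zero. -/
structure IsDecomposition (φ : D.M) (s : MvPolynomial (Fin 2) ℂ) (g g₁ g₂ : ℂ → ℂ) : Prop where
  residual : D.IsResidual (φ - D.polyN s)
  measurable : Measurable fun z : ↥(D.sigma \ D.Z) => g z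
  bounded : ∃ C : ℝ, ∀ z ∈ D.sigma \ D.Z, ‖g z‖ ≤ C
  eq_off : ∀ z ∈ D.sigma \ D.Z,
    φ.entry z 0 0 = (D.polyN s).entry z 0 0 + (D.polyN D.pq).entry z 0 0 * g z
  eq_fst : ∀ z ∈ D.sigma ∩ D.Z, φ.entry z (D.p.rootMultiplicity z.re) 0 =
    (D.polyN s).entry z (D.p.rootMultiplicity z.re) 0 +
      (D.polyN D.pq).entry z (D.p.rootMultiplicity z.re) 0 * g₁ z
  eq_snd : ∀ z ∈ D.sigma ∩ D.Z, φ.entry z 0 (D.q.rootMultiplicity z.im) =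
    (D.polyN s).entry z 0 (D.q.rootMultiplicity z.im) +
      (D.polyN D.pq).entry z 0 (D.q.rootMultiplicity z.im) * g₂ z

/-- The operator `L` is the integral of `(g, g₁, g₂)` over `σ(Θ(N))` with respect to the spectral
measure `E` and `R₁`, `R₂`: the integral of `g` over `σ(Θ(N)) \ (Z_p + i Z_q)` plus the sum of all
`g₁(w) R₁ R₁* E{w} + g₂(w) R₂ R₂* E{w}` over the finite set `σ(Θ(N)) ∩ (Z_p + i Z_q)`. -/
def IsJetIntegral (E : SpectralMeasure D.V) (g g₁ g₂ : ℂ → ℂ) (L : D.V →L[ℂ] D.V) : Prop :=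
  ∃ I : D.V →L[ℂ] D.V, E.IsIntegral (Set.indicator (D.sigma \ D.Z) g) I ∧
    L = I + ∑ᶠ (w : ℂ) (_ : w ∈ D.sigma ∩ D.Z),
      (g₁ w • (D.RR₁ * E.proj {w}) + g₂ w • (D.RR₂ * E.proj {w}))

/-- The operator `S` is a value of `φ(N) = s(A, B) + Ξ(∫ g dE)`, where `E` is the spectral measure
of `Θ(N)` and `φ = s_N + (p_N + q_N) g` is some decomposition of `φ`. -/
def IsValue (φ : D.M) (S : K →L[ℂ] K) : Prop :=
  ∃ E : SpectralMeasure D.V, E.IsSpectralMeasureOf (D.theta D.N) ∧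
    ∃ (s : MvPolynomial (Fin 2) ℂ) (g g₁ g₂ : ℂ → ℂ), D.IsDecomposition φ s g g₁ g₂ ∧
      ∃ L, D.IsJetIntegral E g g₁ g₂ L ∧ S = biPolyEval s D.A D.B + D.xi L

/-- The bicommutant `{N, N*}''` in the algebra of bounded operators on `K`. -/
def bicommutant : Subalgebra ℂ (K →L[ℂ] K) :=
  Subalgebra.centralizer ℂ (Set.centralizer {D.N, J.adj D.N})

end DefinitizableNormal

end

/-!
The operator `C ↦ Θ(C) = T⁻¹ C T` carries operators commuting with `p(A) + q(B) = T T*` to the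
Hilbert space `V`. It exists because such an operator is bounded for the seminorm of `[(p(A) +
q(B)) x, x]` (`DefinitizableNormal.norm_toGram_apply_le`), and it turns the Krein space adjoint
into the Hilbert space adjoint. Hence `M = Θ(N)` is normal with real and imaginary part `Θ(A)` and
`Θ(B)`, and it has a spectral measure `E` (`exists_isSpectralMeasureOf`), which is built here from
the continuous functional calculus and the Riesz representation theorem.

The positive operators `R₁ R₁*` and `R₂ R₂*` add up to `1`, commute with `M`, and satisfy `R₁ R₁*
ρ(M) = p(Re M)` and `R₂ R₂* ρ(M) = q(Im M)` with `ρ(z) = p(Re z) + q(Im z)`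
(`DefinitizableNormal.isNormalSplitting`). Since they are contractions, `|p(Re z)| ≤ |ρ(z)|` and
`|q(Im z)| ≤ |ρ(z)|` on the spectrum of `M`. So `ρ` vanishes on the spectrum only at points of
`Z_p + i Z_q`, and near such a point it dominates the gauge of the growth condition. This makes
the quotient `(φ - s_N) / ρ` bounded as soon as `s` interpolates the jets of `φ`, which is
possible by Hermite interpolation (`Symbols.exists_isResidual_sub_ofPoly`), and gives the
existence of decompositions.

All identities between the operators `L = ∫ g dE + ∑ (g₁(w) R₁ R₁* + g₂(w) R₂ R₂*) E{w}` are
checked after multiplication by the spectral projection of the complement of `Z_p + i Z_q` and by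
those of its finitely many points (`IsNormalSplitting.ext_of_mul_proj`). On the complement `R₁
R₁*` and `R₂ R₂*` are the integrals of `p(Re z) / ρ(z)` and `q(Im z) / ρ(z)`, and at a point `w`
the operator `ρ(M)` vanishes. If `s_N` and `t_N` come from two decompositions of the same
function, then `s - t` lies in the ideal generated by `p(z)` and `q(w)`
(`Symbols.exists_eq_of_isResidual_ofPoly`), say `s - t = u p + v q`, and `(s - t)(A, B) = Ξ(u(M)
R₁ R₁* + v(M) R₂ R₂*)` is exactly compensated by the difference of the integrals
(`DefinitizableNormal.IsValueOf.unique`). Multiplicativity follows from `Ξ(X) Ξ(Y) = Ξ(X ρ(M) Y)`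
(`DefinitizableNormal.IsValueOf.mul`).
-/

noncomputable section

set_option linter.unusedSectionVars false

section WeakIntegrals

open MeasureTheory Filter

/-! ### Bounded Borel functions -/

/-- `h` is a bounded Borel function on `ℂ`. -/
structure IsBddBorel (h : ℂ → ℂ) : Prop where
  measurable : Measurable h
  bounded : ∃ C : ℝ, ∀ z, ‖h z‖ ≤ C

/-- The closure of a class `𝒞` of functions under linear combinations and bounded pointwise limits
of sequences. -/
inductive BoundedClosure (𝒞 : (ℂ → ℂ) → Prop) : (ℂ → ℂ) → Prop
  | base (f : ℂ → ℂ) : 𝒞 f → BoundedClosure 𝒞 f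
  | add (f g : ℂ → ℂ) : BoundedClosure 𝒞 f → BoundedClosure 𝒞 g →
      BoundedClosure 𝒞 (fun z => f z + g z)
  | smul (c : ℂ) (f : ℂ → ℂ) : BoundedClosure 𝒞 f → BoundedClosure 𝒞 (fun z => c * f z)
  | lim (F : ℕ → ℂ → ℂ) (f : ℂ → ℂ) (C : ℝ) : (∀ n, BoundedClosure 𝒞 (F n)) →
      (∀ n z, ‖F n z‖ ≤ C) → (∀ z, Tendsto (fun n => F n z) atTop (𝓝 (f z))) →
      BoundedClosure 𝒞 f

namespace IsBddBorel

theorem add {f g : ℂ → ℂ} (hf : IsBddBorel f) (hg : IsBddBorel g) :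
    IsBddBorel (fun z => f z + g z) := by
  obtain ⟨C, hC⟩ := hf.bounded
  obtain ⟨D, hD⟩ := hg.bounded
  exact ⟨hf.measurable.add hg.measurable, C + D, fun z => norm_add_le_of_le (hC z) (hD z)⟩

theorem mul {f g : ℂ → ℂ} (hf : IsBddBorel f) (hg : IsBddBorel g) :
    IsBddBorel (fun z => f z * g z) := by
  obtain ⟨C, hC⟩ := hf.bounded
  obtain ⟨D, hD⟩ := hg.bounded
  exact ⟨hf.measurable.mul hg.measurable, C * D, fun z => norm_mul_le_of_le (hC z) (hD z)⟩

theorem const (c : ℂ) : IsBddBorel (fun _ => c) := ⟨measurable_const, ‖c‖, fun _ => le_rfl⟩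

theorem smul {f : ℂ → ℂ} (c : ℂ) (hf : IsBddBorel f) : IsBddBorel (fun z => c * f z) :=
  (const c).mul hf

theorem star {f : ℂ → ℂ} (hf : IsBddBorel f) : IsBddBorel (fun z => conj (f z)) := by
  obtain ⟨C, hC⟩ := hf.bounded
  exact ⟨Complex.continuous_conj.measurable.comp hf.measurable, C, fun z => by
    rw [RCLike.norm_conj]; exact hC z⟩

theorem indicator {f : ℂ → ℂ} (hf : IsBddBorel f) {Δ : Set ℂ} (hΔ : MeasurableSet Δ) :
    IsBddBorel (Δ.indicator f) := by
  obtain ⟨C, hC⟩ := hf.bounded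
  exact ⟨hf.measurable.indicator hΔ, C, fun z => (norm_indicator_le_norm_self f z).trans (hC z)⟩

theorem lim {F : ℕ → ℂ → ℂ} {f : ℂ → ℂ} {C : ℝ} (hF : ∀ n, IsBddBorel (F n))
    (hC : ∀ n z, ‖F n z‖ ≤ C) (h : ∀ z, Tendsto (fun n => F n z) atTop (𝓝 (f z))) :
    IsBddBorel f :=
  ⟨measurable_of_tendsto_metrizable (fun n => (hF n).measurable) (tendsto_pi_nhds.2 h), C,
    fun z => le_of_tendsto (h z).norm (Eventually.of_forall fun n => hC n z)⟩

theorem integrable {f : ℂ → ℂ} (hf : IsBddBorel f) (μ : Measure ℂ) [IsFiniteMeasure μ] :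
    Integrable f μ := by
  obtain ⟨C, hC⟩ := hf.bounded
  exact Integrable.of_bound hf.measurable.aestronglyMeasurable C (Eventually.of_forall hC)

/-- A continuous function on a compact set, extended by zero, is a bounded Borel function. -/
theorem indicator_of_continuousOn {f : ℂ → ℂ} {s : Set ℂ} (hs : IsCompact s)
    (hf : ContinuousOn f s) : IsBddBorel (s.indicator f) := by
  obtain ⟨C, hC⟩ := hs.exists_bound_of_continuousOn hf
  refine ⟨?_, max C 0, fun z => ?_⟩
  · classical
    rw [← Set.piecewise_eq_indicator]
    exact hf.measurable_piecewise continuousOn_const hs.measurableSet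
  · by_cases h : z ∈ s
    · rw [Set.indicator_of_mem h]
      exact (hC z h).trans (le_max_left _ _)
    · rw [Set.indicator_of_notMem h, norm_zero]
      exact le_max_right _ _

end IsBddBorel

namespace BoundedClosure

variable {𝒞 : (ℂ → ℂ) → Prop}

theorem isBddBorel (h𝒞 : ∀ f, 𝒞 f → IsBddBorel f) {f : ℂ → ℂ} (hf : BoundedClosure 𝒞 f) :
    IsBddBorel f := by
  induction hf with
  | base f hf => exact h𝒞 f hf
  | add f g _ _ h1 h2 => exact h1.add h2
  | smul c f _ h => exact h.smul c
  | lim F f C _ hC hl h => exact IsBddBorel.lim h hC hl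

/-- A bounded Borel function is a bounded pointwise limit of simple functions. -/
theorem of_indicator
    (h : ∀ Δ : Set ℂ, MeasurableSet Δ → BoundedClosure 𝒞 (Δ.indicator fun _ => 1))
    {f : ℂ → ℂ} (hf : IsBddBorel f) : BoundedClosure 𝒞 f := by
  obtain ⟨C, hC⟩ := hf.bounded
  have hC0 : 0 ≤ C := (norm_nonneg _).trans (hC 0)
  have hsm : StronglyMeasurable f := hf.measurable.stronglyMeasurable
  refine lim (fun n => hsm.approxBounded C n) f C (fun n => ?_)
    (fun n z => hsm.norm_approxBounded_le hC0 n z)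
    (fun z => hsm.tendsto_approxBounded_of_norm_le (hC z))
  generalize hsm.approxBounded C n = F
  induction F using SimpleFunc.induction with
  | @const c s hs =>
    convert smul c _ (h _ hs) using 1
    ext z
    by_cases hz : z ∈ s <;> simp [Set.piecewise, Set.indicator, hz]
  | add _ h1 h2 => exact add _ _ h1 h2

/-- Indicators of closed sets are limits of thickened indicators, and the sets whose indicator
belongs to the closure form a Dynkin system. -/
theorem of_continuous
    (h : ∀ f : ℂ → ℂ, Continuous f → (∃ C : ℝ, ∀ z, ‖f z‖ ≤ C) → BoundedClosure 𝒞 f)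
    {f : ℂ → ℂ} (hf : IsBddBorel f) : BoundedClosure 𝒞 f := by
  refine of_indicator (fun Δ hΔ => ?_) hf
  refine MeasurableSpace.induction_on_inter
    (C := fun Δ _ => BoundedClosure 𝒞 (Δ.indicator fun _ => 1))
    (BorelSpace.measurable_eq.trans borel_eq_generateFrom_isClosed) isPiSystem_isClosed
    ?_ (fun F hF => ?_) (fun t _ ht => ?_) (fun s hd hs ih => ?_) Δ hΔ
  · simpa using h (fun _ => 0) continuous_const ⟨0, by simp⟩
  · have hF : IsClosed F := hF
    have hδ : ∀ n : ℕ, (0 : ℝ) < 1 / ((n : ℝ) + 1) := fun n => by positivity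
    have hb : ∀ n z, ‖((thickenedIndicator (hδ n) F z : NNReal) : ℂ)‖ ≤ 1 := by
      intro n z
      rw [show ((thickenedIndicator (hδ n) F z : NNReal) : ℂ)
        = (((thickenedIndicator (hδ n) F z : NNReal) : ℝ) : ℂ) from rfl, Complex.norm_real,
        NNReal.norm_eq]
      exact_mod_cast thickenedIndicator_le_one (hδ n) F z
    refine lim (fun n z => ((thickenedIndicator (hδ n) F z : NNReal) : ℂ)) _ 1
      (fun n => h _ ?_ ⟨1, hb n⟩) hb (fun z => ?_)
    · exact Complex.continuous_ofReal.comp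
        (NNReal.continuous_coe.comp (thickenedIndicator (hδ n) F).continuous)
    · have h1 := tendsto_pi_nhds.1 (thickenedIndicator_tendsto_indicator_closure hδ
        tendsto_one_div_add_atTop_nhds_zero_nat F) z
      have h2 := (Complex.continuous_ofReal.comp NNReal.continuous_coe).tendsto _ |>.comp h1
      rw [hF.closure_eq] at h2
      convert! h2 using 2
      by_cases hz : z ∈ F <;> simp [hz]
  · convert add _ _ (h (fun _ => 1) continuous_const ⟨1, by simp⟩) (smul (-1) _ ht) using 1
    ext z
    by_cases hz : z ∈ t <;> simp [hz]
  · have hsum : ∀ n, BoundedClosure 𝒞 (fun z => ∑ k ∈ Finset.range n,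
        (s k).indicator (fun _ => (1 : ℂ)) z) := by
      intro n
      induction n with
      | zero => simpa using h (fun _ => 0) continuous_const ⟨0, by simp⟩
      | succ n ihn =>
        simp only [Finset.sum_range_succ]
        exact add _ _ ihn (ih n)
    have heq : ∀ n z, ∑ k ∈ Finset.range n, (s k).indicator (fun _ => (1 : ℂ)) z =
        (⋃ k ∈ Finset.range n, s k).indicator (fun _ => (1 : ℂ)) z := by
      intro n z
      exact (Finset.indicator_biUnion_apply _ s (fun i _ j _ hij => hd hij) z).symm
    refine lim _ _ 1 hsum (fun n z => ?_) (fun z => ?_)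
    · rw [heq]
      exact (norm_indicator_le_norm_self _ _).trans (by simp)
    · by_cases hz : ∃ k, z ∈ s k
      · obtain ⟨k, hk⟩ := hz
        refine tendsto_const_nhds.congr' ?_
        filter_upwards [eventually_gt_atTop k] with n hn
        rw [heq, Set.indicator_of_mem (Set.mem_iUnion.2 ⟨k, hk⟩), Set.indicator_of_mem]
        exact Set.mem_biUnion (Finset.mem_range.2 hn) hk
      · rw [Set.indicator_of_notMem (by simpa using hz)]
        refine tendsto_const_nhds.congr fun n => (Finset.sum_eq_zero fun k _ => ?_).symm
        exact Set.indicator_of_notMem (fun hk => hz ⟨k, hk⟩) _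

end BoundedClosure

/-! ### Operators as weak integrals -/

section WeakIntegral

variable {H : Type*} [NormedAddCommGroup H] [InnerProductSpace ℂ H] [CompleteSpace H]

theorem inner_polarization (L : H →L[ℂ] H) (x y : H) :
    inner ℂ x (L y) = (inner ℂ (x + y) (L (x + y)) - inner ℂ (x - y) (L (x - y))
      - Complex.I * inner ℂ (x + Complex.I • y) (L (x + Complex.I • y))
      + Complex.I * inner ℂ (x - Complex.I • y) (L (x - Complex.I • y))) / 4 := by
  simp only [map_add, map_sub, inner_add_left, inner_add_right, map_smul, inner_smul_left,
    inner_smul_right, Complex.conj_I, inner_sub_left, inner_sub_right]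
  linear_combination ((1/2) * inner ℂ x (L y) - (1/2) * inner ℂ y (L x)) * Complex.I_sq

theorem ext_inner_self {I J : H →L[ℂ] H} (h : ∀ x, inner ℂ x (I x) = inner ℂ x (J x)) : I = J := by
  ext y
  refine ext_inner_left ℂ fun x => ?_
  rw [inner_polarization I, inner_polarization J]
  simp only [h]

theorem tendsto_inner_of_tendsto_inner_self {I : ℕ → H →L[ℂ] H} {L : H →L[ℂ] H}
    (h : ∀ x, Tendsto (fun n => inner ℂ x (I n x)) atTop (𝓝 (inner ℂ x (L x)))) (x y : H) :
    Tendsto (fun n => inner ℂ x (I n y)) atTop (𝓝 (inner ℂ x (L y))) := by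
  rw [inner_polarization L]
  refine Tendsto.congr (fun n => (inner_polarization (I n) x y).symm) ?_
  exact ((((h _).sub (h _)).sub ((h _).const_mul _)).add ((h _).const_mul _)).div_const _

/-- A bounded quadratic form which is the pointwise limit of quadratic forms of operators is the
quadratic form of an operator. -/
theorem exists_weak_limit {I : ℕ → H →L[ℂ] H} {q : H → ℂ} {C : ℝ}
    (hq : ∀ x, ‖q x‖ ≤ C * ‖x‖ ^ 2)
    (h : ∀ x, Tendsto (fun n => inner ℂ x (I n x)) atTop (𝓝 (q x))) :
    ∃ L : H →L[ℂ] H, ∀ x, inner ℂ x (L x) = q x := by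
  -- the polarization of `q` is the pointwise limit of the sesquilinear forms of the operators
  set b : H → H → ℂ := fun x y => (q (x + y) - q (x - y)
      - Complex.I * q (x + Complex.I • y) + Complex.I * q (x - Complex.I • y)) / 4 with hb
  have hlim : ∀ x y, Tendsto (fun n => inner ℂ x (I n y)) atTop (𝓝 (b x y)) := by
    intro x y
    refine Tendsto.congr (fun n => (inner_polarization (I n) x y).symm) ?_
    exact ((((h _).sub (h _)).sub ((h _).const_mul _)).add ((h _).const_mul _)).div_const _
  -- the constant can be negative only on the zero space
  have hC : 0 ≤ C ∨ ∀ x : H, x = 0 := by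
    by_cases hx : ∃ x : H, x ≠ 0
    · obtain ⟨x, hx⟩ := hx
      left
      have h1 := (norm_nonneg _).trans (hq x)
      have h2 : 0 < ‖x‖ ^ 2 := by positivity
      exact nonneg_of_mul_nonneg_left h1 h2
    · right; simpa using hx
  rcases hC with hC | hC
  swap
  · refine ⟨0, fun x => ?_⟩
    have := hq x
    rw [hC x] at this ⊢
    simpa [eq_comm] using this
  have hsmulL : ∀ (c : ℂ) x y, b (c • x) y = conj c * b x y := fun c x y =>
    tendsto_nhds_unique (hlim _ _) (by
      simp only [inner_smul_left]
      exact (hlim x y).const_mul _)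
  have hsmulR : ∀ (c : ℂ) x y, b x (c • y) = c * b x y := fun c x y =>
    tendsto_nhds_unique (hlim _ _) (by
      simp only [map_smul, inner_smul_right]
      exact (hlim x y).const_mul _)
  have hunit : ∀ x y, ‖x‖ = 1 → ‖y‖ = 1 → ‖b x y‖ ≤ 4 * C := by
    intro x y hx hy
    have hq4 : ∀ v : H, ‖v‖ ≤ 2 → ‖q v‖ ≤ 4 * C := by
      intro v hv
      refine (hq v).trans ?_
      have : ‖v‖ ^ 2 ≤ 2 ^ 2 := by gcongr
      nlinarith
    have hIy : ‖Complex.I • y‖ = 1 := by rw [norm_smul, Complex.norm_I, hy, one_mul]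
    have e1 := hq4 (x + y) ((norm_add_le _ _).trans (by linarith))
    have e2 := hq4 (x - y) ((norm_sub_le _ _).trans (by linarith))
    have e3 := hq4 (x + Complex.I • y) ((norm_add_le _ _).trans (by linarith))
    have e4 := hq4 (x - Complex.I • y) ((norm_sub_le _ _).trans (by linarith))
    have e5 : ‖q (x + y) - q (x - y) - Complex.I * q (x + Complex.I • y)
        + Complex.I * q (x - Complex.I • y)‖ ≤ 4 * C + 4 * C + 4 * C + 4 * C := by
      refine norm_add_le_of_le (norm_sub_le_of_le (norm_sub_le_of_le e1 e2) ?_) ?_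
      · rwa [norm_mul, Complex.norm_I, one_mul]
      · rwa [norm_mul, Complex.norm_I, one_mul]
    simp only [hb]
    rw [norm_div]
    have h4 : ‖(4 : ℂ)‖ = 4 := by norm_num
    rw [h4]
    linarith
  -- the bound on the unit sphere extends by homogeneity
  have hbound : ∀ x y, ‖b x y‖ ≤ 4 * C * ‖x‖ * ‖y‖ := by
    intro x y
    by_cases hx : x = 0
    · have h0 := hsmulL 0 x y
      rw [zero_smul, map_zero, zero_mul] at h0
      rw [hx, h0]
      simp
    by_cases hy : y = 0
    · have h0 := hsmulR 0 x y
      rw [zero_smul, zero_mul] at h0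
      rw [hy, h0]
      simp
    have hx' : ‖x‖ ≠ 0 := norm_ne_zero_iff.2 hx
    have hy' : ‖y‖ ≠ 0 := norm_ne_zero_iff.2 hy
    have h1 := hunit (((‖x‖ : ℂ)⁻¹) • x) (((‖y‖ : ℂ)⁻¹) • y)
      (by simp [norm_smul, hx']) (by simp [norm_smul, hy'])
    rw [hsmulL, hsmulR, norm_mul, norm_mul, RCLike.norm_conj, norm_inv, norm_inv,
      Complex.norm_real, Complex.norm_real, norm_norm, norm_norm] at h1
    calc ‖b x y‖ = (‖x‖⁻¹ * (‖y‖⁻¹ * ‖b x y‖)) * (‖x‖ * ‖y‖) := by field_simp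
      _ ≤ 4 * C * (‖x‖ * ‖y‖) := by gcongr
      _ = _ := by ring
  let B : H →ₗ⋆[ℂ] H →ₗ[ℂ] ℂ := LinearMap.mk₂'ₛₗ (starRingEnd ℂ) (RingHom.id ℂ) b
    (fun x x' y => tendsto_nhds_unique (hlim _ _) (by
      simp only [inner_add_left]; exact (hlim x y).add (hlim x' y)))
    (fun c x y => hsmulL c x y)
    (fun x y y' => tendsto_nhds_unique (hlim _ _) (by
      simp only [map_add, inner_add_right]; exact (hlim x y).add (hlim x y')))
    (fun c x y => hsmulR c x y)
  refine ⟨ContinuousLinearMap.adjoint (InnerProductSpace.continuousLinearMapOfBilin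
    (B.mkContinuous₂ (4 * C) hbound)), fun x => ?_⟩
  rw [ContinuousLinearMap.adjoint_inner_right,
    InnerProductSpace.continuousLinearMapOfBilin_apply]
  exact tendsto_nhds_unique (hlim x x) (h x)

/-- `I` is the weak integral of `h` with respect to the family `μ` of measures:
`⟨I x, x⟩ = ∫ h dμ x`. -/
def IsWeakIntegral (μ : H → Measure ℂ) (h : ℂ → ℂ) (I : H →L[ℂ] H) : Prop :=
  ∀ x, inner ℂ x (I x) = ∫ z, h z ∂(μ x)

namespace IsWeakIntegral

variable {μ : H → Measure ℂ} {f g : ℂ → ℂ} {I J : H →L[ℂ] H}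

theorem unique (h1 : IsWeakIntegral μ f I) (h2 : IsWeakIntegral μ f J) : I = J :=
  ext_inner_self fun x => (h1 x).trans (h2 x).symm

theorem smul (c : ℂ) (h : IsWeakIntegral μ f I) : IsWeakIntegral μ (fun z => c * f z) (c • I) := by
  intro x
  rw [smul_apply, inner_smul_right, h x, integral_const_mul]

theorem star (h : IsWeakIntegral μ f I) :
    IsWeakIntegral μ (fun z => conj (f z)) (ContinuousLinearMap.adjoint I) := by
  intro x
  rw [ContinuousLinearMap.adjoint_inner_right, integral_conj, ← h x, inner_conj_symm]

variable [∀ x, IsFiniteMeasure (μ x)]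

theorem add (hf : IsBddBorel f) (hg : IsBddBorel g) (h1 : IsWeakIntegral μ f I)
    (h2 : IsWeakIntegral μ g J) : IsWeakIntegral μ (fun z => f z + g z) (I + J) := by
  intro x
  rw [add_apply, inner_add_right, h1 x, h2 x,
    integral_add (hf.integrable _) (hg.integrable _)]

theorem tendsto_integral {F : ℕ → ℂ → ℂ} {C : ℝ} (hF : ∀ n, IsBddBorel (F n))
    (hC : ∀ n z, ‖F n z‖ ≤ C) (hl : ∀ z, Tendsto (fun n => F n z) atTop (𝓝 (f z))) (x : H) :
    Tendsto (fun n => ∫ z, F n z ∂(μ x)) atTop (𝓝 (∫ z, f z ∂(μ x))) :=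
  tendsto_integral_of_dominated_convergence (fun _ => C)
    (fun n => (hF n).measurable.aestronglyMeasurable) (integrable_const C)
    (fun n => Eventually.of_forall (hC n)) (Eventually.of_forall hl)

theorem tendsto_inner {F : ℕ → ℂ → ℂ} {C : ℝ} {K : ℕ → H →L[ℂ] H} (hF : ∀ n, IsBddBorel (F n))
    (hC : ∀ n z, ‖F n z‖ ≤ C) (hl : ∀ z, Tendsto (fun n => F n z) atTop (𝓝 (f z)))
    (hK : ∀ n, IsWeakIntegral μ (F n) (K n)) (hI : IsWeakIntegral μ f I) (x y : H) :
    Tendsto (fun n => inner ℂ x (K n y)) atTop (𝓝 (inner ℂ x (I y))) := by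
  refine tendsto_inner_of_tendsto_inner_self (fun x => ?_) x y
  simp only [fun n => hK n x, hI x]
  exact tendsto_integral hF hC hl x

end IsWeakIntegral

variable {μ : H → Measure ℂ} [∀ x, IsFiniteMeasure (μ x)] {𝒞 : (ℂ → ℂ) → Prop}

/-- If the functions of `𝒞` have weak integrals, then so have the functions in the closure of `𝒞`:
by dominated convergence the quadratic forms of the integrals converge. -/
theorem BoundedClosure.exists_isWeakIntegral (hμ : ∀ x, (μ x).real Set.univ ≤ ‖x‖ ^ 2)
    (h𝒞 : ∀ f, 𝒞 f → IsBddBorel f) (hI : ∀ f, 𝒞 f → ∃ I, IsWeakIntegral μ f I)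
    {f : ℂ → ℂ} (hf : BoundedClosure 𝒞 f) : ∃ I, IsWeakIntegral μ f I := by
  induction hf with
  | base f hf => exact hI f hf
  | add f g hf hg h1 h2 =>
    obtain ⟨I, hI⟩ := h1
    obtain ⟨J, hJ⟩ := h2
    exact ⟨I + J, hI.add (hf.isBddBorel h𝒞) (hg.isBddBorel h𝒞) hJ⟩
  | smul c f hf h =>
    obtain ⟨I, hI⟩ := h
    exact ⟨c • I, hI.smul c⟩
  | lim F f C hF hC hl h =>
    choose I hI using h
    have hC0 : 0 ≤ C := (norm_nonneg _).trans (hC 0 0)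
    have hfC : ∀ z, ‖f z‖ ≤ C := fun z =>
      le_of_tendsto (hl z).norm (Eventually.of_forall fun n => hC n z)
    refine exists_weak_limit (C := C) (I := I) (fun x => ?_) (fun x => ?_)
    · refine (norm_integral_le_of_norm_le_const (Eventually.of_forall hfC)).trans ?_
      gcongr
      exact hμ x
    · simp only [fun n => hI n x]
      exact IsWeakIntegral.tendsto_integral (fun n => (hF n).isBddBorel h𝒞) hC hl x

/-- Operators that commute with the integrals of all functions in `𝒞` commute with the integrals of
all functions in the closure of `𝒞`. -/
theorem BoundedClosure.commute (hμ : ∀ x, (μ x).real Set.univ ≤ ‖x‖ ^ 2)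
    (h𝒞 : ∀ f, 𝒞 f → IsBddBorel f) (hI : ∀ f, 𝒞 f → ∃ I, IsWeakIntegral μ f I) {C : H →L[ℂ] H}
    (hC : ∀ f I, 𝒞 f → IsWeakIntegral μ f I → Commute C I)
    {f : ℂ → ℂ} (hf : BoundedClosure 𝒞 f) {I : H →L[ℂ] H} (hfI : IsWeakIntegral μ f I) :
    Commute C I := by
  induction hf generalizing I with
  | base f hf => exact hC f I hf hfI
  | add f g hf hg h1 h2 =>
    obtain ⟨J, hJ⟩ := hf.exists_isWeakIntegral hμ h𝒞 hI
    obtain ⟨J', hJ'⟩ := hg.exists_isWeakIntegral hμ h𝒞 hI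
    rw [hfI.unique (hJ.add (hf.isBddBorel h𝒞) (hg.isBddBorel h𝒞) hJ')]
    exact (h1 hJ).add_right (h2 hJ')
  | smul c f hf h =>
    obtain ⟨J, hJ⟩ := hf.exists_isWeakIntegral hμ h𝒞 hI
    rw [hfI.unique (hJ.smul c)]
    exact (h hJ).smul_right c
  | lim F f B hF hB hl h =>
    choose J hJ using fun n => (hF n).exists_isWeakIntegral hμ h𝒞 hI
    have ht := IsWeakIntegral.tendsto_inner (fun n => (hF n).isBddBorel h𝒞) hB hl hJ hfI
    refine ContinuousLinearMap.ext fun y => ext_inner_left ℂ fun x => ?_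
    -- both `⟨J n C y, x⟩` and `⟨C J n y, x⟩ = ⟨J n y, C* x⟩` converge
    refine tendsto_nhds_unique (f := fun n => inner ℂ x (J n (C y))) ?_ (ht x (C y))
    have h2 := ht (ContinuousLinearMap.adjoint C x) y
    simp only [ContinuousLinearMap.adjoint_inner_left] at h2
    refine h2.congr fun n => ?_
    exact congrArg (inner ℂ x) (congrArg (fun L : H →L[ℂ] H => L y) (h n (hJ n)).eq)

/-- If the weak integral is multiplicative on `𝒞`, then it is multiplicative on the closure: the
factors are extended one after the other. -/
theorem BoundedClosure.mul (hμ : ∀ x, (μ x).real Set.univ ≤ ‖x‖ ^ 2)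
    (h𝒞 : ∀ f, 𝒞 f → IsBddBorel f) (hI : ∀ f, 𝒞 f → ∃ I, IsWeakIntegral μ f I)
    (hmul : ∀ f g I J, 𝒞 f → 𝒞 g → IsWeakIntegral μ f I → IsWeakIntegral μ g J →
      IsWeakIntegral μ (fun z => f z * g z) (I * J))
    {f g : ℂ → ℂ} (hf : BoundedClosure 𝒞 f) (hg : BoundedClosure 𝒞 g) {I J : H →L[ℂ] H}
    (hfI : IsWeakIntegral μ f I) (hgJ : IsWeakIntegral μ g J) :
    IsWeakIntegral μ (fun z => f z * g z) (I * J) := by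
  have key : ∀ (g : ℂ → ℂ) (J : H →L[ℂ] H), 𝒞 g → IsWeakIntegral μ g J →
      IsWeakIntegral μ (fun z => f z * g z) (I * J) := by
    intro g J hg hgJ
    have hgb := h𝒞 g hg
    induction hf generalizing I with
    | base f hf => exact hmul f g I J hf hg hfI hgJ
    | add f f' hf hf' h1 h2 =>
      obtain ⟨L, hL⟩ := hf.exists_isWeakIntegral hμ h𝒞 hI
      obtain ⟨L', hL'⟩ := hf'.exists_isWeakIntegral hμ h𝒞 hI
      rw [hfI.unique (hL.add (hf.isBddBorel h𝒞) (hf'.isBddBorel h𝒞) hL'), add_mul]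
      simp only [add_mul]
      exact (h1 hL).add ((hf.isBddBorel h𝒞).mul hgb) ((hf'.isBddBorel h𝒞).mul hgb) (h2 hL')
    | smul c f hf h =>
      obtain ⟨L, hL⟩ := hf.exists_isWeakIntegral hμ h𝒞 hI
      rw [hfI.unique (hL.smul c), smul_mul_assoc]
      simp only [mul_assoc]
      exact (h hL).smul c
    | lim F f B hF hB hl h =>
      choose L hL using fun n => (hF n).exists_isWeakIntegral hμ h𝒞 hI
      have hFb := fun n => (hF n).isBddBorel h𝒞
      have ht := IsWeakIntegral.tendsto_inner hFb hB hl hL hfI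
      obtain ⟨D, hD⟩ := hgb.bounded
      intro x
      refine tendsto_nhds_unique (ht x (J x)) ?_
      refine Tendsto.congr (fun n => (h n (hL n) x).symm) ?_
      exact IsWeakIntegral.tendsto_integral (C := B * D) (fun n => (hFb n).mul hgb)
        (fun n z => norm_mul_le_of_le (hB n z) (hD z)) (fun z => (hl z).mul_const _) x
  have hfb := hf.isBddBorel h𝒞
  induction hg generalizing J with
  | base g hg => exact key g J hg hgJ
  | add g g' hg hg' h1 h2 =>
    obtain ⟨L, hL⟩ := hg.exists_isWeakIntegral hμ h𝒞 hI
    obtain ⟨L', hL'⟩ := hg'.exists_isWeakIntegral hμ h𝒞 hI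
    rw [hgJ.unique (hL.add (hg.isBddBorel h𝒞) (hg'.isBddBorel h𝒞) hL'), mul_add]
    simp only [mul_add]
    exact (h1 hL).add (hfb.mul (hg.isBddBorel h𝒞)) (hfb.mul (hg'.isBddBorel h𝒞)) (h2 hL')
  | smul c g hg h =>
    obtain ⟨L, hL⟩ := hg.exists_isWeakIntegral hμ h𝒞 hI
    rw [hgJ.unique (hL.smul c), mul_smul_comm]
    simp only [mul_left_comm _ c]
    exact (h hL).smul c
  | lim F g B hF hB hl h =>
    choose L hL using fun n => (hF n).exists_isWeakIntegral hμ h𝒞 hI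
    have hFb := fun n => (hF n).isBddBorel h𝒞
    have ht := IsWeakIntegral.tendsto_inner hFb hB hl hL hgJ
    obtain ⟨D, hD⟩ := hfb.bounded
    intro x
    have h2 := ht (ContinuousLinearMap.adjoint I x) x
    simp only [ContinuousLinearMap.adjoint_inner_left] at h2
    refine tendsto_nhds_unique h2 ?_
    refine Tendsto.congr (fun n => (h n (hL n) x).symm) ?_
    exact IsWeakIntegral.tendsto_integral (C := D * B) (fun n => hfb.mul (hFb n))
      (fun n z => norm_mul_le_of_le (hD z) (hB n z)) (fun z => (hl z).const_mul _) x

end WeakIntegral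

end WeakIntegrals

section SpectralTheorem

open MeasureTheory Filter

/-! ### The integral with respect to a spectral measure -/

namespace SpectralMeasure

variable {H : Type*} [NormedAddCommGroup H] [InnerProductSpace ℂ H] [CompleteSpace H]
  (E : SpectralMeasure H)

theorem scalar_apply {Δ : Set ℂ} (hΔ : MeasurableSet Δ) (x : H) :
    E.scalar x Δ = ENNReal.ofReal (‖E.proj Δ x‖ ^ 2) :=
  Measure.ofMeasurable_apply Δ hΔ

theorem scalar_univ (x : H) : E.scalar x Set.univ = ENNReal.ofReal (‖x‖ ^ 2) := by
  rw [E.scalar_apply MeasurableSet.univ, E.proj_univ]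
  rfl

instance (x : H) : IsFiniteMeasure (E.scalar x) :=
  ⟨by rw [E.scalar_univ]; exact ENNReal.ofReal_lt_top⟩

theorem scalar_real_univ_le (x : H) : (E.scalar x).real Set.univ ≤ ‖x‖ ^ 2 := by
  rw [Measure.real, E.scalar_univ, ENNReal.toReal_ofReal (by positivity)]

theorem isWeakIntegral_indicator {Δ : Set ℂ} (hΔ : MeasurableSet Δ) :
    IsWeakIntegral E.scalar (Δ.indicator fun _ => 1) (E.proj Δ) := by
  intro x
  rw [integral_indicator_const _ hΔ, E.inner_proj hΔ, Measure.real, E.scalar_apply hΔ,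
    ENNReal.toReal_ofReal (by positivity)]
  simp

/-- The class of indicator functions of Borel sets. -/
def IndicatorClass (f : ℂ → ℂ) : Prop :=
  ∃ Δ : Set ℂ, MeasurableSet Δ ∧ f = Δ.indicator fun _ => 1

theorem IndicatorClass.isBddBorel (f : ℂ → ℂ) (hf : IndicatorClass f) : IsBddBorel f := by
  obtain ⟨Δ, hΔ, rfl⟩ := hf
  exact (IsBddBorel.const 1).indicator hΔ

theorem IndicatorClass.exists_isWeakIntegral (f : ℂ → ℂ) (hf : IndicatorClass f) :
    ∃ I, IsWeakIntegral E.scalar f I := by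
  obtain ⟨Δ, hΔ, rfl⟩ := hf
  exact ⟨_, E.isWeakIntegral_indicator hΔ⟩

theorem boundedClosure_indicatorClass {f : ℂ → ℂ} (hf : IsBddBorel f) :
    BoundedClosure IndicatorClass f :=
  BoundedClosure.of_indicator (fun Δ hΔ => .base _ ⟨Δ, hΔ, rfl⟩) hf

/-- The integral `∫ h dE` of a bounded Borel function, and `0` if there is no such operator. -/
def integral (h : ℂ → ℂ) : H →L[ℂ] H :=
  open scoped Classical in if hI : ∃ I, IsWeakIntegral E.scalar h I then hI.choose else 0

variable {E} {f g : ℂ → ℂ}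

theorem isWeakIntegral_integral (hf : IsBddBorel f) :
    IsWeakIntegral E.scalar f (E.integral f) := by
  have hI : ∃ I, IsWeakIntegral E.scalar f I :=
    (boundedClosure_indicatorClass hf).exists_isWeakIntegral E.scalar_real_univ_le
      IndicatorClass.isBddBorel (IndicatorClass.exists_isWeakIntegral E)
  rw [integral, dif_pos hI]
  exact hI.choose_spec

theorem integral_eq {I : H →L[ℂ] H} (h : IsWeakIntegral E.scalar f I) : E.integral f = I := by
  have hI : ∃ I, IsWeakIntegral E.scalar f I := ⟨I, h⟩
  rw [integral, dif_pos hI]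
  exact hI.choose_spec.unique h

theorem integral_indicator_one {Δ : Set ℂ} (hΔ : MeasurableSet Δ) :
    E.integral (Δ.indicator fun _ => 1) = E.proj Δ :=
  integral_eq (E.isWeakIntegral_indicator hΔ)

theorem integral_const (c : ℂ) : E.integral (fun _ => c) = c • 1 := by
  refine integral_eq fun x => ?_
  rw [MeasureTheory.integral_const, smul_apply, inner_smul_right, Measure.real, E.scalar_univ,
    ENNReal.toReal_ofReal (by positivity), one_apply_eq_self, inner_self_eq_norm_sq_to_K]
  simp [mul_comm]

theorem integral_add (hf : IsBddBorel f) (hg : IsBddBorel g) :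
    E.integral (fun z => f z + g z) = E.integral f + E.integral g :=
  integral_eq ((isWeakIntegral_integral hf).add hf hg (isWeakIntegral_integral hg))

theorem integral_smul (c : ℂ) (hf : IsBddBorel f) :
    E.integral (fun z => c * f z) = c • E.integral f :=
  integral_eq ((isWeakIntegral_integral hf).smul c)

theorem integral_star (hf : IsBddBorel f) :
    E.integral (fun z => conj (f z)) = ContinuousLinearMap.adjoint (E.integral f) :=
  integral_eq (isWeakIntegral_integral hf).star

theorem integral_mul (hf : IsBddBorel f) (hg : IsBddBorel g) :
    E.integral (fun z => f z * g z) = E.integral f * E.integral g := by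
  refine integral_eq (BoundedClosure.mul E.scalar_real_univ_le IndicatorClass.isBddBorel
    (IndicatorClass.exists_isWeakIntegral E) ?_ (boundedClosure_indicatorClass hf)
    (boundedClosure_indicatorClass hg) (isWeakIntegral_integral hf) (isWeakIntegral_integral hg))
  rintro _ _ I J ⟨Δ, hΔ, rfl⟩ ⟨Δ', hΔ', rfl⟩ hI hJ
  rw [hI.unique (E.isWeakIntegral_indicator hΔ), hJ.unique (E.isWeakIntegral_indicator hΔ'),
    ← E.proj_inter Δ Δ' hΔ hΔ']
  convert E.isWeakIntegral_indicator (hΔ.inter hΔ') using 1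
  ext z
  by_cases h1 : z ∈ Δ <;> by_cases h2 : z ∈ Δ' <;> simp [h1, h2]

theorem commute_integral {C : H →L[ℂ] H} (hC : ∀ Δ, MeasurableSet Δ → Commute C (E.proj Δ))
    (hf : IsBddBorel f) : Commute C (E.integral f) := by
  refine BoundedClosure.commute E.scalar_real_univ_le IndicatorClass.isBddBorel
    (IndicatorClass.exists_isWeakIntegral E) ?_ (boundedClosure_indicatorClass hf)
    (isWeakIntegral_integral hf)
  rintro _ I ⟨Δ, hΔ, rfl⟩ hI
  rw [hI.unique (E.isWeakIntegral_indicator hΔ)]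
  exact hC Δ hΔ

theorem norm_integral_apply_sq (hf : IsBddBorel f) (x : H) :
    ((‖E.integral f x‖ ^ 2 : ℝ) : ℂ) = ∫ z, ((‖f z‖ ^ 2 : ℝ) : ℂ) ∂(E.scalar x) := by
  have h := isWeakIntegral_integral (E := E) (hf.star.mul hf) x
  rw [integral_mul hf.star hf, integral_star hf, mul_apply_eq_comp,
    ContinuousLinearMap.adjoint_inner_right, inner_self_eq_norm_sq_to_K] at h
  have h2 : ∀ z, conj (f z) * f z = ((‖f z‖ ^ 2 : ℝ) : ℂ) := fun z => by
    rw [Complex.conj_mul']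
    norm_cast
  simp only [h2] at h
  rw [← h]
  norm_cast

/-- An element of the kernel of `∫ f dE` is annihilated by the projection of the set where `f` does
not vanish. -/
theorem proj_support_apply_eq_zero (hf : IsBddBorel f) {x : H} (hx : E.integral f x = 0) :
    E.proj (Function.support f) x = 0 := by
  have hms : MeasurableSet (Function.support f) := measurableSet_support hf.measurable
  have h := norm_integral_apply_sq (E := E) hf x
  rw [hx, norm_zero, integral_complex_ofReal] at h
  have h1 : ∫ z, ‖f z‖ ^ 2 ∂(E.scalar x) = 0 := by
    have := Complex.ofReal_injective h
    simpa using this.symm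
  rw [integral_eq_zero_iff_of_nonneg (fun z => by positivity)] at h1
  · have h2 : E.scalar x (Function.support f) = 0 := by
      have h3 : ∀ᵐ z ∂(E.scalar x), ¬ z ∈ Function.support f := by
        filter_upwards [h1] with z hz
        simpa using hz
      exact measure_mono_null (fun z hz => by simpa using hz) (ae_iff.1 h3)
    rw [E.scalar_apply hms, ENNReal.ofReal_eq_zero] at h2
    have h3 : ‖E.proj (Function.support f) x‖ ^ 2 = 0 := le_antisymm h2 (by positivity)
    simpa using h3
  · obtain ⟨C, hC⟩ := hf.bounded
    refine Integrable.of_bound (hf.measurable.norm.pow_const 2).aestronglyMeasurable (C ^ 2)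
      (Eventually.of_forall fun z => ?_)
    rw [norm_pow, norm_norm]
    gcongr
    exact hC z

/-! ### Uniqueness of the spectral measure of a normal operator -/

section Uniqueness

variable {M : H →L[ℂ] H}

theorem measurableSet_spectrum : MeasurableSet (spectrum ℂ M) :=
  (spectrum.isCompact M).measurableSet

theorem IsSpectralMeasureOf.ae_mem_spectrum (hE : E.IsSpectralMeasureOf M) (x : H) :
    ∀ᵐ z ∂(E.scalar x), z ∈ spectrum ℂ M := by
  rw [ae_iff]
  change E.scalar x (spectrum ℂ M)ᶜ = 0
  rw [E.scalar_apply measurableSet_spectrum.compl, hE.1]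
  simp

theorem IsSpectralMeasureOf.integral_congr (hE : E.IsSpectralMeasureOf M)
    (h : ∀ z ∈ spectrum ℂ M, f z = g z) : E.integral f = E.integral g := by
  have hfg : ∀ I, IsWeakIntegral E.scalar f I ↔ IsWeakIntegral E.scalar g I := by
    intro I
    refine forall_congr' fun x => ?_
    rw [integral_congr_ae (g := g)]
    filter_upwards [hE.ae_mem_spectrum x] with z hz using h z hz
  have hfg' : (fun I => IsWeakIntegral E.scalar f I) = fun I => IsWeakIntegral E.scalar g I :=
    funext fun I => propext (hfg I)
  change (open scoped Classical in
    if hI : ∃ I, (fun I => IsWeakIntegral E.scalar f I) I then hI.choose else 0) = _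
  rw [hfg']
  rfl

variable (E M) in
/-- The integral of continuous functions on the spectrum as a `*`-homomorphism. -/
def integralHom (hE : E.IsSpectralMeasureOf M) : C(spectrum ℂ M, ℂ) →⋆ₐ[ℂ] (H →L[ℂ] H) :=
  have hb : ∀ F : C(spectrum ℂ M, ℂ), IsBddBorel (Function.extend Subtype.val F 0) := fun F => by
    refine ⟨(MeasurableEmbedding.subtype_coe measurableSet_spectrum).measurable_extend
      F.continuous.measurable measurable_const, ‖F‖, fun z => ?_⟩
    by_cases hz : z ∈ spectrum ℂ M
    · have := Subtype.val_injective.extend_apply F 0 (⟨z, hz⟩ : spectrum ℂ M)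
      rw [this]
      exact F.norm_coe_le_norm _
    · rw [Function.extend_apply' _ _ _ (by simpa using hz)]
      simp
  have he : ∀ (F : C(spectrum ℂ M, ℂ)) (z : ℂ) (hz : z ∈ spectrum ℂ M),
      Function.extend Subtype.val F 0 z = F ⟨z, hz⟩ := fun F z hz =>
    Subtype.val_injective.extend_apply F 0 (⟨z, hz⟩ : spectrum ℂ M)
  { toFun := fun F => E.integral (Function.extend Subtype.val F 0)
    map_one' := by
      rw [hE.integral_congr (g := fun _ => 1) (fun z hz => by rw [he _ z hz]; rfl),
        integral_const, one_smul]
    map_mul' := fun F G => by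
      rw [← integral_mul (hb F) (hb G)]
      exact hE.integral_congr fun z hz => by simp only [he _ z hz, ContinuousMap.mul_apply]
    map_zero' := by
      rw [hE.integral_congr (g := fun _ => 0) (fun z hz => by rw [he _ z hz]; rfl),
        integral_const, zero_smul]
    map_add' := fun F G => by
      rw [← integral_add (hb F) (hb G)]
      exact hE.integral_congr fun z hz => by simp only [he _ z hz, ContinuousMap.add_apply]
    commutes' := fun r => by
      rw [hE.integral_congr (g := fun _ => r) (fun z hz => by rw [he _ z hz]; rfl),
        integral_const, Algebra.algebraMap_eq_smul_one]
    map_star' := fun F => by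
      rw [ContinuousLinearMap.star_eq_adjoint, ← integral_star (hb F)]
      exact hE.integral_congr fun z hz => by simp only [he _ z hz]; rfl }

theorem integralHom_apply (hE : E.IsSpectralMeasureOf M) (F : C(spectrum ℂ M, ℂ)) :
    integralHom E M hE F = E.integral (Function.extend Subtype.val F 0) := rfl

/-- The integral of continuous functions with respect to the spectral measure is the continuous
functional calculus. -/
theorem IsSpectralMeasureOf.integral_eq_cfc (hE : E.IsSpectralMeasureOf M) (hM : IsStarNormal M)
    (hf : ContinuousOn f (spectrum ℂ M)) : E.integral f = cfc f M := by
  have hid : integralHom E M hE (.restrict (spectrum ℂ M) <| .id ℂ) = M := by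
    rw [integralHom_apply, hE.integral_congr (g := fun z => z)]
    · exact integral_eq hE.2
    · intro z hz
      exact Subtype.val_injective.extend_apply (fun w : spectrum ℂ M => (w : ℂ)) 0 ⟨z, hz⟩
  have h := cfcHom_eq_of_continuous_of_map_id hM (integralHom E M hE)
    (by open scoped CStarAlgebra in exact map_continuous (integralHom E M hE)) hid
  rw [cfc_apply f M hM hf, h, integralHom_apply]
  refine hE.integral_congr fun z hz => ?_
  exact (Subtype.val_injective.extend_apply ((spectrum ℂ M).domRestrict f) 0 ⟨z, hz⟩).symm

/-- The scalar measures are determined by the integrals of bounded continuous functions, which are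
given by the continuous functional calculus. -/
theorem IsSpectralMeasureOf.scalar_eq {E' : SpectralMeasure H} (hM : IsStarNormal M)
    (hE : E.IsSpectralMeasureOf M) (hE' : E'.IsSpectralMeasureOf M) (x : H) :
    E.scalar x = E'.scalar x := by
  refine ext_of_forall_integral_eq_of_IsFiniteMeasure fun f => ?_
  have hf : Continuous fun z => (f z : ℂ) := Complex.continuous_ofReal.comp f.continuous
  have hb : IsBddBorel fun z => (f z : ℂ) :=
    ⟨hf.measurable, ‖f‖, fun z => by rw [Complex.norm_real]; exact f.norm_coe_le_norm z⟩
  have h1 := isWeakIntegral_integral (E := E) hb x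
  have h2 := isWeakIntegral_integral (E := E') hb x
  rw [hE.integral_eq_cfc hM hf.continuousOn, integral_complex_ofReal] at h1
  rw [hE'.integral_eq_cfc hM hf.continuousOn, integral_complex_ofReal] at h2
  exact Complex.ofReal_injective (h1.symm.trans h2)

theorem IsSpectralMeasureOf.proj_eq {E' : SpectralMeasure H} (hM : IsStarNormal M)
    (hE : E.IsSpectralMeasureOf M) (hE' : E'.IsSpectralMeasureOf M) {Δ : Set ℂ}
    (hΔ : MeasurableSet Δ) : E.proj Δ = E'.proj Δ := by
  refine (E.isWeakIntegral_indicator hΔ).unique ?_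
  have h := E'.isWeakIntegral_indicator hΔ
  rwa [show E'.scalar = E.scalar from funext fun x => hE'.scalar_eq hM hE x] at h

end Uniqueness

end SpectralMeasure

/-! ### Existence of the spectral measure of a normal operator -/

section Existence

variable {H : Type*} [NormedAddCommGroup H] [InnerProductSpace ℂ H] [CompleteSpace H]
  {M : H →L[ℂ] H}

open CompactlySupported

/-- A real function on the spectrum as a complex function. -/
def toComplexMap (f : C_c(spectrum ℂ M, ℝ)) : C(spectrum ℂ M, ℂ) :=
  ⟨fun z => (f z : ℂ), Complex.continuous_ofReal.comp f.continuous⟩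

/-- The positive functional `f ↦ ⟨f(M) x, x⟩`. -/
def spectralFunctional (hM : IsStarNormal M) (x : H) : C_c(spectrum ℂ M, ℝ) →ₚ[ℝ] ℝ :=
  PositiveLinearMap.mk₀
    { toFun := fun f => (inner ℂ x (cfcHom hM (toComplexMap f) x)).re
      map_add' := fun f g => by
        have : toComplexMap (f + g) = toComplexMap f + toComplexMap g := by
          ext z; simp [toComplexMap]
        rw [this, map_add, add_apply, inner_add_right, Complex.add_re]
      map_smul' := fun r f => by
        have : toComplexMap (r • f) = (r : ℂ) • toComplexMap f := by
          ext z; simp [toComplexMap]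
        rw [this, map_smul, smul_apply, inner_smul_right, Complex.re_ofReal_mul]
        rfl }
    (fun f hf => by
      let g : C(spectrum ℂ M, ℂ) := ⟨fun z => (√(f z) : ℂ),
        Complex.continuous_ofReal.comp (Real.continuous_sqrt.comp f.continuous)⟩
      have hg : toComplexMap f = star g * g := by
        ext z
        have hz : 0 ≤ f z := hf z
        simp only [toComplexMap, g, ContinuousMap.coe_mk, ContinuousMap.mul_apply,
          ContinuousMap.star_apply, RCLike.star_def, Complex.conj_ofReal]
        rw [← Complex.ofReal_mul, Real.mul_self_sqrt hz]
      change 0 ≤ (inner ℂ x (cfcHom hM (toComplexMap f) x)).re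
      rw [hg, map_mul, map_star, mul_apply_eq_comp, ContinuousLinearMap.star_eq_adjoint,
        ContinuousLinearMap.adjoint_inner_right]
      exact inner_self_nonneg (𝕜 := ℂ))

/-- The measure on `ℂ` that represents the functional `f ↦ ⟨f(M) x, x⟩`. -/
def spectralScalar (hM : IsStarNormal M) (x : H) : Measure ℂ :=
  (RealRMK.rieszMeasure (spectralFunctional hM x)).map Subtype.val

instance (hM : IsStarNormal M) (x : H) : IsFiniteMeasure (spectralScalar hM x) := by
  unfold spectralScalar
  infer_instance

/-- The continuous functional calculus is the weak integral with respect to the representing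
measures: for real functions this is the Riesz representation theorem. -/
theorem integral_spectralScalar (hM : IsStarNormal M) (f : ℂ → ℂ)
    (hf : ContinuousOn f (spectrum ℂ M)) : IsWeakIntegral (spectralScalar hM) f (cfc f M) := by
  intro x
  have hme := MeasurableEmbedding.subtype_coe (SpectralMeasure.measurableSet_spectrum (M := M))
  rw [spectralScalar, hme.integral_map, cfc_apply f M hM hf]
  have hreal : ∀ u : C(spectrum ℂ M, ℝ),
      ∫ z, (u z : ℂ) ∂(RealRMK.rieszMeasure (spectralFunctional hM x)) =
        inner ℂ x (cfcHom hM ⟨fun z => (u z : ℂ),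
          Complex.continuous_ofReal.comp u.continuous⟩ x) := by
    intro u
    set U : C(spectrum ℂ M, ℂ) := ⟨fun z => (u z : ℂ),
          Complex.continuous_ofReal.comp u.continuous⟩ with hU
    have h1 := RealRMK.integral_rieszMeasure (spectralFunctional hM x)
      (⟨u, HasCompactSupport.of_compactSpace u⟩ : C_c(spectrum ℂ M, ℝ))
    rw [integral_complex_ofReal]
    refine (congrArg _ h1).trans ?_
    change (((inner ℂ x (cfcHom hM U x)).re : ℝ) : ℂ) = _
    refine Complex.conj_eq_iff_re.1 ?_
    rw [inner_conj_symm]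
    have h2 : star U = U := by ext z; simp [hU]
    have h3 : ContinuousLinearMap.adjoint (cfcHom hM U) = cfcHom hM U := by
      rw [← ContinuousLinearMap.star_eq_adjoint, ← map_star, h2]
    conv_rhs => rw [← h3, ContinuousLinearMap.adjoint_inner_right]
  set F : C(spectrum ℂ M, ℂ) := ⟨_, hf.domRestrict⟩ with hF
  let u : C(spectrum ℂ M, ℝ) := ⟨fun z => (F z).re, Complex.continuous_re.comp F.continuous⟩
  let v : C(spectrum ℂ M, ℝ) := ⟨fun z => (F z).im, Complex.continuous_im.comp F.continuous⟩
  have hFuv : F = ⟨fun z => (u z : ℂ), Complex.continuous_ofReal.comp u.continuous⟩ +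
      Complex.I • ⟨fun z => (v z : ℂ), Complex.continuous_ofReal.comp v.continuous⟩ := by
    ext z
    simp [u, v, mul_comm Complex.I, Complex.re_add_im]
  have hint : ∀ w : C(spectrum ℂ M, ℂ),
      Integrable w (RealRMK.rieszMeasure (spectralFunctional hM x)) := fun w =>
    Integrable.of_bound w.continuous.measurable.aestronglyMeasurable ‖w‖
      (Eventually.of_forall w.norm_coe_le_norm)
  have h1 : ∀ z : spectrum ℂ M, f z = (u z : ℂ) + Complex.I * (v z : ℂ) := fun z =>
    congrArg (fun G : C(spectrum ℂ M, ℂ) => G z) hFuv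
  simp only [h1]
  have h2 := integral_add (hint ⟨fun z => (u z : ℂ), Complex.continuous_ofReal.comp u.continuous⟩)
    ((hint ⟨fun z => (v z : ℂ), Complex.continuous_ofReal.comp v.continuous⟩).const_mul Complex.I)
  simp only [ContinuousMap.coe_mk] at h2
  refine Eq.trans ?_ h2.symm
  rw [integral_const_mul, hreal, hreal, hFuv, map_add, map_smul, add_apply,
    smul_apply, inner_add_right, inner_smul_right]

theorem spectralScalar_real_univ (hM : IsStarNormal M) (x : H) :
    (spectralScalar hM x).real Set.univ = ‖x‖ ^ 2 := by
  have h := integral_spectralScalar hM (fun _ => 1) continuousOn_const x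
  rw [cfc_const_one ℂ M, one_apply_eq_self, inner_self_eq_norm_sq_to_K, integral_const] at h
  refine Complex.ofReal_injective ?_
  simp only [Complex.real_smul, mul_one] at h
  rw [← h]
  norm_cast

/-- The class of bounded continuous functions. -/
def BddContinuousClass (f : ℂ → ℂ) : Prop := Continuous f ∧ ∃ C : ℝ, ∀ z, ‖f z‖ ≤ C

theorem BddContinuousClass.isBddBorel (f : ℂ → ℂ) (hf : BddContinuousClass f) : IsBddBorel f :=
  ⟨hf.1.measurable, hf.2⟩

theorem exists_isWeakIntegral_spectralScalar (hM : IsStarNormal M) (f : ℂ → ℂ)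
    (hf : BddContinuousClass f) : ∃ I, IsWeakIntegral (spectralScalar hM) f I :=
  ⟨_, integral_spectralScalar hM f hf.1.continuousOn⟩

theorem boundedClosure_bddContinuousClass {f : ℂ → ℂ} (hf : IsBddBorel f) :
    BoundedClosure BddContinuousClass f :=
  BoundedClosure.of_continuous (fun f h1 h2 => .base f ⟨h1, h2⟩) hf

/-- The spectral theorem for a bounded normal operator. The projections are the weak integrals of
the indicator functions with respect to the measures which represent the continuous functional
calculus; these integrals exist and are multiplicative since both properties pass from the bounded
continuous functions to the bounded Borel functions. -/
theorem exists_isSpectralMeasureOf (hM : IsStarNormal M) :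
    ∃ E : SpectralMeasure H, E.IsSpectralMeasureOf M ∧
      ∀ C : H →L[ℂ] H, Commute M C → Commute (star M) C →
        ∀ Δ, MeasurableSet Δ → Commute C (E.proj Δ) := by
  have hμ : ∀ x, (spectralScalar hM x).real Set.univ ≤ ‖x‖ ^ 2 := fun x =>
    (spectralScalar_real_univ hM x).le
  have hex : ∀ Δ : Set ℂ, ∃ P, MeasurableSet Δ →
      IsWeakIntegral (spectralScalar hM) (Δ.indicator fun _ => 1) P := by
    intro Δ
    by_cases hΔ : MeasurableSet Δ
    · obtain ⟨P, hP⟩ := (boundedClosure_bddContinuousClass ((IsBddBorel.const 1).indicator hΔ)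
        ).exists_isWeakIntegral hμ BddContinuousClass.isBddBorel
        (exists_isWeakIntegral_spectralScalar hM)
      exact ⟨P, fun _ => hP⟩
    · exact ⟨0, fun h => absurd h hΔ⟩
  choose P hP using hex
  have hb : ∀ {Δ : Set ℂ}, MeasurableSet Δ → IsBddBorel (Δ.indicator fun _ => (1 : ℂ)) :=
    fun hΔ => (IsBddBorel.const 1).indicator hΔ
  have hadj : ∀ Δ, MeasurableSet Δ → ContinuousLinearMap.adjoint (P Δ) = P Δ := by
    intro Δ hΔ
    refine (hP Δ hΔ).star.unique ?_
    convert hP Δ hΔ using 1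
    ext z
    by_cases hz : z ∈ Δ <;> simp [hz]
  have hinter : ∀ Δ Δ', MeasurableSet Δ → MeasurableSet Δ' → P (Δ ∩ Δ') = P Δ * P Δ' := by
    intro Δ Δ' hΔ hΔ'
    refine (hP _ (hΔ.inter hΔ')).unique ?_
    convert BoundedClosure.mul hμ BddContinuousClass.isBddBorel
      (exists_isWeakIntegral_spectralScalar hM) ?_ (boundedClosure_bddContinuousClass (hb hΔ))
      (boundedClosure_bddContinuousClass (hb hΔ')) (hP Δ hΔ) (hP Δ' hΔ') using 1
    · ext z
      by_cases h1 : z ∈ Δ <;> by_cases h2 : z ∈ Δ' <;> simp [h1, h2]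
    · intro f g I J hf hg hI hJ
      rw [hI.unique (integral_spectralScalar hM f hf.1.continuousOn),
        hJ.unique (integral_spectralScalar hM g hg.1.continuousOn),
        ← cfc_mul f g M hf.1.continuousOn hg.1.continuousOn]
      exact integral_spectralScalar hM _ (hf.1.mul hg.1).continuousOn
  have hnorm : ∀ Δ x, MeasurableSet Δ → ‖P Δ x‖ ^ 2 = (spectralScalar hM x).real Δ := by
    intro Δ x hΔ
    have h1 : inner ℂ x (P Δ x) = ((‖P Δ x‖ ^ 2 : ℝ) : ℂ) := by
      have h2 : P Δ x = P Δ (P Δ x) := by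
        have := hinter Δ Δ hΔ hΔ
        rw [Set.inter_self] at this
        exact congrArg (fun L : H →L[ℂ] H => L x) this
      rw [h2, ← ContinuousLinearMap.adjoint_inner_left, hadj Δ hΔ, inner_self_eq_norm_sq_to_K,
        ← h2]
      norm_cast
    have h3 := hP Δ hΔ x
    rw [h1, integral_indicator_const _ hΔ] at h3
    simpa [← Complex.ofReal_pow] using h3
  have huniv : P Set.univ = 1 := by
    refine (hP _ MeasurableSet.univ).unique ?_
    have h := integral_spectralScalar hM (fun _ => 1) continuousOn_const
    rw [cfc_const_one ℂ M] at h
    simpa using h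
  have hunion : ∀ Δ Δ', MeasurableSet Δ → MeasurableSet Δ' → Disjoint Δ Δ' →
      P (Δ ∪ Δ') = P Δ + P Δ' := by
    intro Δ Δ' hΔ hΔ' hd
    refine (hP _ (hΔ.union hΔ')).unique ?_
    convert (hP Δ hΔ).add (hb hΔ) (hb hΔ') (hP Δ' hΔ') using 1
    rw [Set.indicator_union_of_disjoint hd]
  have hempty : P ∅ = 0 := by
    have := hunion ∅ ∅ MeasurableSet.empty MeasurableSet.empty disjoint_bot_left
    simpa using this
  let E : SpectralMeasure H :=
    { proj := P
      isStarProjection := fun Δ hΔ =>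
        ⟨by rw [IsIdempotentElem, ← hinter Δ Δ hΔ hΔ, Set.inter_self], hadj Δ hΔ⟩
      proj_univ := huniv
      proj_inter := hinter
      hasSum_proj := by
        intro Δ hΔ hd x
        have hfin : ∀ s : Finset ℕ, P (⋃ n ∈ s, Δ n) = ∑ n ∈ s, P (Δ n) := by
          intro s
          induction s using Finset.induction_on with
          | empty => simpa using hempty
          | insert a s ha ih =>
            rw [Finset.set_biUnion_insert, hunion _ _ (hΔ a)
              (s.measurableSet_biUnion fun n _ => hΔ n), ih, Finset.sum_insert ha]
            refine Set.disjoint_iUnion₂_right.2 fun n hn => hd ?_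
            rintro rfl
            exact ha hn
        have hU : MeasurableSet (⋃ n, Δ n) := MeasurableSet.iUnion hΔ
        -- the squared distance of a partial sum to the limit is the measure of the remaining sets
        have hdiff : ∀ s : Finset ℕ, ‖(∑ n ∈ s, P (Δ n) x) - P (⋃ n, Δ n) x‖ ^ 2 =
            (spectralScalar hM x).real (⋃ n, Δ n) -
              ∑ n ∈ s, (spectralScalar hM x).real (Δ n) := by
          intro s
          have hs : MeasurableSet (⋃ n ∈ s, Δ n) := s.measurableSet_biUnion fun n _ => hΔ n
          have hsub : (⋃ n ∈ s, Δ n) ⊆ ⋃ n, Δ n := Set.iUnion₂_subset_iUnion _ _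
          have h1 := hunion _ _ hs (hU.diff hs) Set.disjoint_sdiff_right
          rw [Set.union_sdiff_cancel hsub, hfin] at h1
          rw [h1, add_apply, sum_apply, sub_add_cancel_left, norm_neg,
            hnorm _ _ (hU.diff hs), measureReal_sdiff hsub hs,
            measureReal_biUnion_finset (fun i _ j _ hij => hd hij) (fun n _ => hΔ n)]
        have hsum : HasSum (fun n => (spectralScalar hM x).real (Δ n))
            ((spectralScalar hM x).real (⋃ n, Δ n)) := by
          have h1 := measure_iUnion (μ := spectralScalar hM x) hd hΔ
          have h2 : ∑' n, spectralScalar hM x (Δ n) ≠ ⊤ := by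
            rw [← h1]; exact measure_ne_top _ _
          rw [Measure.real, h1, ENNReal.tsum_toReal_eq (fun n => measure_ne_top _ _)]
          exact (ENNReal.summable_toReal h2).hasSum
        refine tendsto_iff_norm_sub_tendsto_zero.2 ?_
        have h3 : Tendsto (fun s : Finset ℕ => ‖(∑ n ∈ s, P (Δ n) x) - P (⋃ n, Δ n) x‖ ^ 2) atTop
            (𝓝 0) := by
          simp only [hdiff]
          have h4 := (tendsto_const_nhds (x := (spectralScalar hM x).real (⋃ n, Δ n))).sub hsum
          rwa [sub_self] at h4
        have h5 := (Real.continuous_sqrt.tendsto 0).comp h3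
        rw [Real.sqrt_zero] at h5
        refine h5.congr fun s => ?_
        rw [Function.comp_apply, Real.sqrt_sq (norm_nonneg _)] }
  have hscalar : ∀ x, E.scalar x = spectralScalar hM x := by
    intro x
    ext Δ hΔ
    rw [E.scalar_apply hΔ]
    change ENNReal.ofReal (‖P Δ x‖ ^ 2) = _
    rw [hnorm Δ x hΔ, Measure.real, ENNReal.ofReal_toReal (measure_ne_top _ _)]
  refine ⟨E, ⟨?_, ?_⟩, ?_⟩
  · change P (spectrum ℂ M)ᶜ = 0
    ext x
    have hm := (SpectralMeasure.measurableSet_spectrum (M := M)).compl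
    have h1 := hnorm _ x hm
    have h2 : spectralScalar hM x (spectrum ℂ M)ᶜ = 0 := by
      rw [spectralScalar, Measure.map_apply measurable_subtype_coe hm]
      have : (Subtype.val : spectrum ℂ M → ℂ) ⁻¹' (spectrum ℂ M)ᶜ = ∅ := by
        ext z; simp
      rw [this, measure_empty]
    rw [Measure.real, h2] at h1
    simpa using h1
  · intro x
    rw [hscalar]
    have h := integral_spectralScalar hM (fun z => z) continuousOn_id x
    rwa [cfc_id' ℂ M] at h
  · intro C h1 h2 Δ hΔ
    refine BoundedClosure.commute hμ BddContinuousClass.isBddBorel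
      (exists_isWeakIntegral_spectralScalar hM) ?_ (boundedClosure_bddContinuousClass (hb hΔ))
      (hP Δ hΔ)
    intro f I hf hI
    rw [hI.unique (integral_spectralScalar hM f hf.1.continuousOn)]
    exact (h1.cfc h2 f).symm

/-- Operators that commute with a normal operator and its adjoint commute with its spectral
measure. -/
theorem SpectralMeasure.IsSpectralMeasureOf.commute_proj {E : SpectralMeasure H}
    (hM : IsStarNormal M) (hE : E.IsSpectralMeasureOf M) {C : H →L[ℂ] H} (h1 : Commute M C)
    (h2 : Commute (star M) C) {Δ : Set ℂ} (hΔ : MeasurableSet Δ) : Commute C (E.proj Δ) := by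
  obtain ⟨E', hE', hC⟩ := exists_isSpectralMeasureOf hM
  rw [hE.proj_eq hM hE' hΔ]
  exact hC C h1 h2 Δ hΔ

end Existence

end SpectralTheorem

/-! ### Taylor coefficients of polynomials in two variables -/

section Taylor

open Polynomial

/-- The expansion of `s(a + z, b + w)` in powers of `z`, whose coefficients are polynomials
in `w`. -/
def shiftHom (a b : ℂ) : MvPolynomial (Fin 2) ℂ →ₐ[ℂ] ℂ[X][X] :=
  MvPolynomial.aeval ![X + C (C a), C (X + C b)]

theorem shiftHom_X_zero (a b : ℂ) : shiftHom a b (MvPolynomial.X 0) = X + C (C a) := by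
  simp [shiftHom]

theorem shiftHom_X_one (a b : ℂ) : shiftHom a b (MvPolynomial.X 1) = C (X + C b) := by
  simp [shiftHom]

theorem shiftHom_C (a b c : ℂ) : shiftHom a b (MvPolynomial.C c) = C (C c) := by
  simp [shiftHom]

theorem shiftHom_pderiv_zero (a b : ℂ) (s : MvPolynomial (Fin 2) ℂ) :
    shiftHom a b (MvPolynomial.pderiv 0 s) = derivative (shiftHom a b s) := by
  induction s using MvPolynomial.induction_on with
  | C c => rw [MvPolynomial.pderiv_C, shiftHom_C]; simp
  | add s t hs ht => simp only [map_add, hs, ht]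
  | mul_X s i hs =>
    rw [Derivation.leibniz, map_add, smul_eq_mul, smul_eq_mul, map_mul, map_mul, map_mul, hs,
      derivative_mul]
    fin_cases i
    · simp [shiftHom_X_zero]
      ring
    · simp [shiftHom_X_one]
      ring

theorem coeff_shiftHom_pderiv_one (a b : ℂ) (s : MvPolynomial (Fin 2) ℂ) (k : ℕ) :
    (shiftHom a b (MvPolynomial.pderiv 1 s)).coeff k = derivative ((shiftHom a b s).coeff k) := by
  induction s using MvPolynomial.induction_on generalizing k with
  | C c => rw [MvPolynomial.pderiv_C, shiftHom_C, coeff_C]; split_ifs <;> simp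
  | add s t hs ht => simp only [map_add, coeff_add, hs, ht]
  | mul_X s i hs =>
    rw [Derivation.leibniz, map_add, smul_eq_mul, smul_eq_mul, map_mul, map_mul, map_mul]
    fin_cases i
    · cases k with
      | zero => simp [shiftHom_X_zero, hs, mul_comm]
      | succ k =>
        simp [shiftHom_X_zero, hs, mul_add, add_mul, coeff_X_mul, coeff_mul_X]
        ring
    · have h1 : shiftHom a b (MvPolynomial.X 1) = C (X + C b) := shiftHom_X_one a b
      simp only [Fin.mk_one, MvPolynomial.pderiv_X_self, map_one, mul_one, h1, coeff_add,
        coeff_mul_C, derivative_mul, mul_comm (C (X + C b)), hs, derivative_add, derivative_X,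
        derivative_C, add_zero]
      ring

theorem eval_eval_shiftHom (a b x y : ℂ) (s : MvPolynomial (Fin 2) ℂ) :
    ((shiftHom a b s).eval (C x)).eval y = MvPolynomial.eval ![a + x, b + y] s := by
  induction s using MvPolynomial.induction_on with
  | C c => simp
  | add s t hs ht => simp only [map_add, eval_add, hs, ht]
  | mul_X s i hs =>
    rw [map_mul, eval_mul, eval_mul, hs, map_mul, MvPolynomial.eval_X]
    fin_cases i
    · simp [shiftHom_X_zero, add_comm]
    · simp [shiftHom_X_one, add_comm]

/-- The normalized partial derivatives at `(a, b)` are the coefficients of `s(a + z, b + w)`. -/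
theorem taylorCoeff_eq_coeff (s : MvPolynomial (Fin 2) ℂ) (a b : ℂ) (k l : ℕ) :
    Symbols.taylorCoeff s a b k l = ((shiftHom a b s).coeff k).coeff l := by
  have h0 : ∀ t, MvPolynomial.eval ![a, b] t = ((shiftHom a b t).coeff 0).coeff 0 := by
    intro t
    have := eval_eval_shiftHom a b 0 0 t
    rw [add_zero, add_zero] at this
    rw [← this, coeff_zero_eq_eval_zero, coeff_zero_eq_eval_zero, C_0]
  have h1 : ∀ t (k : ℕ), shiftHom a b ((MvPolynomial.pderiv 0)^[k] t) =
      derivative^[k] (shiftHom a b t) := by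
    intro t k
    induction k with
    | zero => rfl
    | succ k ih => rw [Function.iterate_succ_apply', Function.iterate_succ_apply',
        shiftHom_pderiv_zero, ih]
  have h2 : ∀ t (l k : ℕ), (shiftHom a b ((MvPolynomial.pderiv 1)^[l] t)).coeff k =
      derivative^[l] ((shiftHom a b t).coeff k) := by
    intro t l k
    induction l with
    | zero => rfl
    | succ l ih => rw [Function.iterate_succ_apply', Function.iterate_succ_apply',
        coeff_shiftHom_pderiv_one, ih]
  have hk : (k.factorial : ℂ) ≠ 0 := Nat.cast_ne_zero.2 k.factorial_ne_zero
  have hl : (l.factorial : ℂ) ≠ 0 := Nat.cast_ne_zero.2 l.factorial_ne_zero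
  rw [Symbols.taylorCoeff, h0, h1, coeff_iterate_derivative, zero_add, coeff_smul, h2,
    coeff_iterate_derivative, zero_add, Nat.descFactorial_self, Nat.descFactorial_self,
    nsmul_eq_mul, nsmul_eq_mul]
  field_simp

theorem taylorCoeff_add (s t : MvPolynomial (Fin 2) ℂ) (a b : ℂ) (k l : ℕ) :
    Symbols.taylorCoeff (s + t) a b k l =
      Symbols.taylorCoeff s a b k l + Symbols.taylorCoeff t a b k l := by
  simp only [taylorCoeff_eq_coeff, map_add, coeff_add]

theorem taylorCoeff_smul (c : ℂ) (s : MvPolynomial (Fin 2) ℂ) (a b : ℂ) (k l : ℕ) :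
    Symbols.taylorCoeff (c • s) a b k l = c * Symbols.taylorCoeff s a b k l := by
  simp only [taylorCoeff_eq_coeff, map_smul, coeff_smul, smul_eq_mul]

theorem taylorCoeff_sum {ι : Type*} (u : Finset ι) (s : ι → MvPolynomial (Fin 2) ℂ) (a b : ℂ)
    (k l : ℕ) : Symbols.taylorCoeff (∑ i ∈ u, s i) a b k l =
      ∑ i ∈ u, Symbols.taylorCoeff (s i) a b k l := by
  simp only [taylorCoeff_eq_coeff, map_sum, finsetSum_coeff]

theorem taylorCoeff_C (c a b : ℂ) (k l : ℕ) :
    Symbols.taylorCoeff (MvPolynomial.C c) a b k l = if k = 0 ∧ l = 0 then c else 0 := by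
  rw [taylorCoeff_eq_coeff, shiftHom_C, coeff_C]
  by_cases hk : k = 0 <;> by_cases hl : l = 0 <;> simp [hk, hl, coeff_C]

theorem taylorCoeff_mul (s t : MvPolynomial (Fin 2) ℂ) (a b : ℂ) (k l : ℕ) :
    Symbols.taylorCoeff (s * t) a b k l = ∑ c ∈ Finset.range (k + 1), ∑ d ∈ Finset.range (l + 1),
      Symbols.taylorCoeff s a b c d * Symbols.taylorCoeff t a b (k - c) (l - d) := by
  simp only [taylorCoeff_eq_coeff, map_mul]
  rw [coeff_mul, Finset.Nat.sum_antidiagonal_eq_sum_range_succ_mk, finsetSum_coeff]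
  refine Finset.sum_congr rfl fun c _ => ?_
  rw [coeff_mul, Finset.Nat.sum_antidiagonal_eq_sum_range_succ_mk]

theorem taylorCoeff_zero_zero (s : MvPolynomial (Fin 2) ℂ) (a b : ℂ) :
    Symbols.taylorCoeff s a b 0 0 = MvPolynomial.eval ![a, b] s := by
  simp [Symbols.taylorCoeff]

theorem taylorCoeff_conj (s : MvPolynomial (Fin 2) ℂ) (a b : ℂ) (k l : ℕ) :
    Symbols.taylorCoeff (MvPolynomial.map (starRingEnd ℂ) s) (conj a) (conj b) k l =
      conj (Symbols.taylorCoeff s a b k l) := by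
  have h : ∀ (i : Fin 2) (n : ℕ) (t : MvPolynomial (Fin 2) ℂ),
      (MvPolynomial.pderiv i)^[n] (MvPolynomial.map (starRingEnd ℂ) t) =
        MvPolynomial.map (starRingEnd ℂ) ((MvPolynomial.pderiv i)^[n] t) := by
    intro i n t
    induction n with
    | zero => rfl
    | succ n ih => rw [Function.iterate_succ_apply', Function.iterate_succ_apply', ih,
        MvPolynomial.pderiv_map]
  have hv : (![conj a, conj b] : Fin 2 → ℂ) = fun i => conj ((![a, b] : Fin 2 → ℂ) i) := by
    funext i
    fin_cases i <;> rfl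
  have he : ∀ t : MvPolynomial (Fin 2) ℂ, MvPolynomial.eval ![conj a, conj b]
      (MvPolynomial.map (starRingEnd ℂ) t) = conj (MvPolynomial.eval ![a, b] t) := by
    intro t
    rw [MvPolynomial.eval_map, hv, ← MvPolynomial.eval₂_id,
      MvPolynomial.eval₂_comp_left (starRingEnd ℂ) (RingHom.id ℂ) ![a, b] t]
    rfl
  rw [Symbols.taylorCoeff, h, h, he, Symbols.taylorCoeff, map_mul]
  simp

/-- The polynomial `f(z) g(w)`. -/
def sepProd (f g : ℂ[X]) : MvPolynomial (Fin 2) ℂ :=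
  aeval (MvPolynomial.X 0) f * aeval (MvPolynomial.X 1) g

theorem taylorCoeff_sepProd (f g : ℂ[X]) (a b : ℂ) (k l : ℕ) :
    Symbols.taylorCoeff (sepProd f g) a b k l = (taylor a f).coeff k * (taylor b g).coeff l := by
  have h1 : shiftHom a b (aeval (MvPolynomial.X 0) f) = (taylor a f).map C := by
    induction f using Polynomial.induction_on' with
    | add f f' hf hf' => simp only [map_add, hf, hf', Polynomial.map_add]
    | monomial n c =>
      rw [← C_mul_X_pow_eq_monomial]
      simp [shiftHom_X_zero, taylor_mul, taylor_pow, MvPolynomial.algebraMap_eq]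
  have h2 : shiftHom a b (aeval (MvPolynomial.X 1) g) = C (taylor b g) := by
    induction g using Polynomial.induction_on' with
    | add f f' hf hf' => simp only [map_add, hf, hf']
    | monomial n c =>
      rw [← C_mul_X_pow_eq_monomial]
      simp [shiftHom_X_one, taylor_mul, taylor_pow, MvPolynomial.algebraMap_eq]
  rw [taylorCoeff_eq_coeff, sepProd, map_mul, h1, h2, coeff_mul_C, coeff_map, coeff_C_mul]

/-! ### Hermite interpolation -/

theorem pow_dvd_iff_taylor_coeff (f : ℂ[X]) (a : ℂ) (m : ℕ) :
    (X - C a) ^ m ∣ f ↔ ∀ k < m, (taylor a f).coeff k = 0 := by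
  rw [← X_pow_dvd_iff]
  have h : taylor a ((X - C a) ^ m) = X ^ m := by
    rw [taylor_pow]; simp
  constructor
  · rintro ⟨g, rfl⟩
    rw [taylor_mul, h]
    exact dvd_mul_right _ _
  · rintro ⟨g, hg⟩
    refine ⟨taylor (-a) g, taylor_injective a ?_⟩
    rw [hg, taylor_mul, h, taylor_taylor]
    simp

theorem dvd_of_taylor_coeff {P f : ℂ[X]} (hP : P ≠ 0)
    (h : ∀ ξ, P.eval ξ = 0 → ∀ k < P.rootMultiplicity ξ, (taylor ξ f).coeff k = 0) : P ∣ f := by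
  by_cases hf : f = 0
  · rw [hf]; exact dvd_zero _
  refine (Splits.dvd_iff_roots_le_roots (IsAlgClosed.splits P) hP hf).2 ?_
  refine Multiset.le_iff_count.2 fun ξ => ?_
  rw [count_roots, count_roots]
  by_cases hξ : P.eval ξ = 0
  · exact (le_rootMultiplicity_iff hf).2 ((pow_dvd_iff_taylor_coeff f ξ _).2 (h ξ hξ))
  · rw [rootMultiplicity_eq_zero hξ]
    exact Nat.zero_le _

/-- Hermite interpolation in one variable, from the Chinese remainder theorem. -/
theorem exists_taylor_coeff_eq {P : ℂ[X]} (hP : P ≠ 0) (c : ℂ → ℕ → ℂ) :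
    ∃ f : ℂ[X], ∀ ξ, P.eval ξ = 0 → ∀ k < P.rootMultiplicity ξ, (taylor ξ f).coeff k = c ξ k := by
  obtain ⟨f, hf⟩ := Ideal.exists_forall_sub_mem_ideal
    (I := fun ξ : P.roots.toFinset => Ideal.span {(X - C ξ.1) ^ P.rootMultiplicity ξ.1})
    (fun ξ η hξη => by
      refine (Ideal.isCoprime_span_singleton_iff _ _).2 (IsCoprime.pow ?_)
      exact isCoprime_X_sub_C_of_isUnit_sub
        (sub_ne_zero.2 fun h => hξη (Subtype.ext h)).isUnit)
    (fun ξ => taylor (-ξ.1) (∑ k ∈ Finset.range (P.rootMultiplicity ξ.1), C (c ξ k) * X ^ k))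
  refine ⟨f, fun ξ hξ k hk => ?_⟩
  have h := hf ⟨ξ, by simpa [hP] using hξ⟩
  rw [Ideal.mem_span_singleton, pow_dvd_iff_taylor_coeff] at h
  have h1 := h k hk
  rw [map_sub, taylor_taylor, add_neg_cancel, taylor_zero, coeff_sub, sub_eq_zero] at h1
  rw [h1]
  simp [finsetSum_coeff, coeff_C_mul, coeff_X_pow, hk]

/-- The Taylor coefficients of the interpolating polynomial `e ξ k` vanish at all zeros of `P` up to
the multiplicity, except for the one with index `k` at `ξ`, which is `1`. -/
def IsHermiteBasis (P : ℂ[X]) (e : ℂ → ℕ → ℂ[X]) : Prop :=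
  ∀ ξ k ξ', P.eval ξ' = 0 → ∀ k' < P.rootMultiplicity ξ',
    (taylor ξ' (e ξ k)).coeff k' = if ξ' = ξ ∧ k' = k then 1 else 0

theorem exists_isHermiteBasis {P : ℂ[X]} (hP : P ≠ 0) : ∃ e, IsHermiteBasis P e := by
  choose e he using fun (ξ : ℂ) (k : ℕ) =>
    exists_taylor_coeff_eq hP fun ξ' k' => if ξ' = ξ ∧ k' = k then 1 else 0
  exact ⟨e, he⟩

/-- The interpolation of the data `c` at the pairs of zeros of `P` and `Q`, where `e` and `f` are
Hermite bases for `P` and `Q`. -/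
def hermiteInterp (P Q : ℂ[X]) (e f : ℂ → ℕ → ℂ[X]) (c : ℂ → ℂ → ℕ → ℕ → ℂ) :
    MvPolynomial (Fin 2) ℂ :=
  ∑ ξ ∈ P.roots.toFinset, ∑ k ∈ Finset.range (P.rootMultiplicity ξ),
    ∑ η ∈ Q.roots.toFinset, ∑ l ∈ Finset.range (Q.rootMultiplicity η),
      c ξ η k l • sepProd (e ξ k) (f η l)

theorem taylorCoeff_hermiteInterp {P Q : ℂ[X]} (hP : P ≠ 0) (hQ : Q ≠ 0) {e f : ℂ → ℕ → ℂ[X]}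
    (he : IsHermiteBasis P e) (hf : IsHermiteBasis Q f) (c : ℂ → ℂ → ℕ → ℕ → ℂ) {ξ η : ℂ}
    (hξ : P.eval ξ = 0) (hη : Q.eval η = 0) {k l : ℕ} (hk : k < P.rootMultiplicity ξ)
    (hl : l < Q.rootMultiplicity η) :
    Symbols.taylorCoeff (hermiteInterp P Q e f c) ξ η k l = c ξ η k l := by
  simp only [hermiteInterp, taylorCoeff_sum, taylorCoeff_smul, taylorCoeff_sepProd]
  rw [Finset.sum_eq_single_of_mem ξ (by simpa [hP] using hξ),
    Finset.sum_eq_single_of_mem k (by simpa using hk),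
    Finset.sum_eq_single_of_mem η (by simpa [hQ] using hη),
    Finset.sum_eq_single_of_mem l (by simpa using hl)]
  · rw [he _ _ _ hξ _ hk, hf _ _ _ hη _ hl]
    simp
  · intro l' _ hne
    rw [hf _ _ _ hη _ hl]
    simp [hne.symm]
  · intro η' _ hne
    refine Finset.sum_eq_zero fun l' _ => ?_
    rw [hf _ _ _ hη _ hl]
    simp [hne.symm]
  · intro k' _ hne
    refine Finset.sum_eq_zero fun η' _ => Finset.sum_eq_zero fun l' _ => ?_
    rw [he _ _ _ hξ _ hk]
    simp [hne.symm]
  · intro ξ' _ hne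
    refine Finset.sum_eq_zero fun k' _ => Finset.sum_eq_zero fun η' _ =>
      Finset.sum_eq_zero fun l' _ => ?_
    rw [he _ _ _ hξ _ hk]
    simp [hne.symm]

theorem dvd_sub_hermiteInterp {P : ℂ[X]} (hP : P ≠ 0) {e : ℂ → ℕ → ℂ[X]} (he : IsHermiteBasis P e)
    (f : ℂ[X]) : P ∣ f - ∑ ξ ∈ P.roots.toFinset, ∑ k ∈ Finset.range (P.rootMultiplicity ξ),
      (taylor ξ f).coeff k • e ξ k := by
  refine dvd_of_taylor_coeff hP fun ξ hξ k hk => ?_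
  simp only [map_sub, map_sum, map_smul, coeff_sub, finsetSum_coeff, coeff_smul, smul_eq_mul]
  rw [Finset.sum_eq_single_of_mem ξ (by simpa [hP] using hξ),
    Finset.sum_eq_single_of_mem k (by simpa using hk)]
  · rw [he _ _ _ hξ _ hk]
    simp
  · intro k' _ hne
    rw [he _ _ _ hξ _ hk]
    simp [hne.symm]
  · intro ξ' _ hne
    refine Finset.sum_eq_zero fun k' _ => ?_
    rw [he _ _ _ hξ _ hk]
    simp [hne.symm]

/-- Modulo the ideal generated by `P(z)` and `Q(w)`, every polynomial is the Hermite interpolation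
of its own jets. -/
theorem sub_hermiteInterp_mem {P Q : ℂ[X]} (hP : P ≠ 0) (hQ : Q ≠ 0) {e f : ℂ → ℕ → ℂ[X]}
    (he : IsHermiteBasis P e) (hf : IsHermiteBasis Q f) (s : MvPolynomial (Fin 2) ℂ) :
    s - hermiteInterp P Q e f (Symbols.taylorCoeff s) ∈ Ideal.span
      {(aeval (MvPolynomial.X 0) P : MvPolynomial (Fin 2) ℂ), aeval (MvPolynomial.X 1) Q} := by
  set I : Ideal (MvPolynomial (Fin 2) ℂ) := Ideal.span
      {(aeval (MvPolynomial.X 0) P : MvPolynomial (Fin 2) ℂ), aeval (MvPolynomial.X 1) Q} with hI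
  -- by linearity the claim reduces to products `g(z) h(w)`, whose interpolation is the product of
  -- the interpolations of `g` and `h`
  have hadd : ∀ s t, hermiteInterp P Q e f (Symbols.taylorCoeff (s + t)) =
      hermiteInterp P Q e f (Symbols.taylorCoeff s) +
        hermiteInterp P Q e f (Symbols.taylorCoeff t) := by
    intro s t
    simp only [hermiteInterp, taylorCoeff_add, add_smul, Finset.sum_add_distrib]
  have hsmul : ∀ (c : ℂ) s, hermiteInterp P Q e f (Symbols.taylorCoeff (c • s)) =
      c • hermiteInterp P Q e f (Symbols.taylorCoeff s) := by
    intro c s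
    simp only [hermiteInterp, taylorCoeff_smul, mul_smul, Finset.smul_sum]
  have hsep : ∀ g h : ℂ[X],
      sepProd g h - hermiteInterp P Q e f (Symbols.taylorCoeff (sepProd g h)) ∈ I := by
    intro g h
    set g' : ℂ[X] := ∑ ξ ∈ P.roots.toFinset, ∑ k ∈ Finset.range (P.rootMultiplicity ξ),
      (taylor ξ g).coeff k • e ξ k with hg'
    set h' : ℂ[X] := ∑ η ∈ Q.roots.toFinset, ∑ l ∈ Finset.range (Q.rootMultiplicity η),
      (taylor η h).coeff l • f η l with hh'
    have h1 : hermiteInterp P Q e f (Symbols.taylorCoeff (sepProd g h)) = sepProd g' h' := by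
      simp only [hermiteInterp, taylorCoeff_sepProd]
      simp only [sepProd, hg', hh', map_sum, map_smul, Finset.sum_mul]
      simp only [Finset.mul_sum, smul_mul_smul_comm]
    obtain ⟨u, hu⟩ := dvd_sub_hermiteInterp hP he g
    obtain ⟨v, hv⟩ := dvd_sub_hermiteInterp hQ hf h
    rw [← hg', sub_eq_iff_eq_add] at hu
    rw [← hh', sub_eq_iff_eq_add] at hv
    have h2 : sepProd g h - sepProd g' h' =
        aeval (MvPolynomial.X 0) P * (aeval (MvPolynomial.X 0) u * aeval (MvPolynomial.X 1) h) +
        aeval (MvPolynomial.X 1) Q *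
          (aeval (MvPolynomial.X 0) g' * aeval (MvPolynomial.X 1) v) := by
      simp only [sepProd]
      conv_lhs => rw [hu, hv]
      conv_rhs => rw [hv]
      simp only [map_add, map_mul]
      ring
    rw [h1, h2]
    exact I.add_mem (I.mul_mem_right _ (Ideal.subset_span (by simp)))
      (I.mul_mem_right _ (Ideal.subset_span (by simp)))
  induction s using MvPolynomial.induction_on' with
  | monomial m c =>
    have h1 : MvPolynomial.monomial m c = c • sepProd (X ^ m 0) (X ^ m 1) := by
      rw [MvPolynomial.monomial_eq, MvPolynomial.smul_eq_C_mul, sepProd]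
      congr 1
      rw [Finsupp.prod_fintype _ _ (fun i => pow_zero _), Fin.prod_univ_two]
      simp
    rw [h1, hsmul, ← smul_sub]
    exact I.smul_of_tower_mem c (hsep _ _)
  | add s t hs ht =>
    rw [hadd, add_sub_add_comm]
    exact I.add_mem hs ht

end Taylor

/-! ### Polynomials as jet-valued functions -/

section Taylor

open Polynomial

theorem taylor_coeff_eq_zero_of_lt {P : ℂ[X]} {ξ : ℂ} {k : ℕ} (hk : k < P.rootMultiplicity ξ) :
    (taylor ξ P).coeff k = 0 :=
  (pow_dvd_iff_taylor_coeff P ξ _).1 (pow_rootMultiplicity_dvd P ξ) k hk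

theorem taylor_coeff_rootMultiplicity_ne_zero {P : ℂ[X]} (hP : P ≠ 0) (ξ : ℂ) :
    (taylor ξ P).coeff (P.rootMultiplicity ξ) ≠ 0 := by
  intro h
  have h1 : (X - C ξ) ^ (P.rootMultiplicity ξ + 1) ∣ P := by
    refine (pow_dvd_iff_taylor_coeff P ξ _).2 fun k hk => ?_
    rcases Nat.lt_succ_iff_lt_or_eq.1 hk with hk | rfl
    · exact taylor_coeff_eq_zero_of_lt hk
    · exact h
  have h2 := (le_rootMultiplicity_iff hP).2 h1
  omega

theorem taylorCoeff_aeval_X_zero (P : ℂ[X]) (a b : ℂ) (k l : ℕ) :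
    Symbols.taylorCoeff (aeval (MvPolynomial.X 0) P) a b k l =
      if l = 0 then (taylor a P).coeff k else 0 := by
  have h := taylorCoeff_sepProd P 1 a b k l
  rw [sepProd, map_one, mul_one] at h
  rw [h]
  by_cases hl : l = 0 <;> simp [hl, coeff_one]

theorem taylorCoeff_aeval_X_one (Q : ℂ[X]) (a b : ℂ) (k l : ℕ) :
    Symbols.taylorCoeff (aeval (MvPolynomial.X 1) Q) a b k l =
      if k = 0 then (taylor b Q).coeff l else 0 := by
  have h := taylorCoeff_sepProd 1 Q a b k l
  rw [sepProd, map_one, one_mul] at h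
  rw [h]
  by_cases hk : k = 0 <;> simp [hk, coeff_one]

/-- A truncated Taylor expansion and its remainder, in a form in which all monomials of the
remainder have degree at least `m` in `z` or at least `n` in `w`. -/
theorem eval_sub_sum_taylorCoeff (s : MvPolynomial (Fin 2) ℂ) (a b : ℂ) (m n : ℕ) :
    ∃ N, ∀ x y : ℂ, MvPolynomial.eval ![a + x, b + y] s -
      ∑ k ∈ Finset.range m, ∑ l ∈ Finset.range n, Symbols.taylorCoeff s a b k l * x ^ k * y ^ l =
      ∑ k ∈ Finset.range N, ∑ l ∈ Finset.range N,
        if k < m ∧ l < n then 0 else Symbols.taylorCoeff s a b k l * x ^ k * y ^ l := by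
  set f := shiftHom a b s with hf
  set N := max (max m n) (f.natDegree + 1 + (f.support.sup fun k => (f.coeff k).natDegree + 1))
    with hN
  have hdeg : ∀ k, (f.coeff k).natDegree < N := by
    intro k
    by_cases hk : k ∈ f.support
    · have h1 := Finset.le_sup (f := fun k => (f.coeff k).natDegree + 1) hk
      change (f.coeff k).natDegree + 1 ≤ _ at h1
      omega
    · rw [notMem_support_iff.1 hk, natDegree_zero]
      omega
  refine ⟨N, fun x y => ?_⟩
  have hm : m ≤ N := by omega
  have hn : n ≤ N := by omega
  have h1 : MvPolynomial.eval ![a + x, b + y] s = ∑ k ∈ Finset.range N, ∑ l ∈ Finset.range N,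
      Symbols.taylorCoeff s a b k l * x ^ k * y ^ l := by
    rw [← eval_eval_shiftHom, ← hf, eval_eq_sum_range' (p := f) (n := N) (by omega) (C x),
      eval_finsetSum]
    refine Finset.sum_congr rfl fun k _ => ?_
    rw [eval_mul, ← C_pow, eval_C, eval_eq_sum_range' (hdeg k), Finset.sum_mul]
    refine Finset.sum_congr rfl fun l _ => ?_
    rw [taylorCoeff_eq_coeff]
    ring
  have h2 : ∑ k ∈ Finset.range m, ∑ l ∈ Finset.range n,
      Symbols.taylorCoeff s a b k l * x ^ k * y ^ l =
      ∑ k ∈ Finset.range N, ∑ l ∈ Finset.range N,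
        if k < m ∧ l < n then Symbols.taylorCoeff s a b k l * x ^ k * y ^ l else 0 := by
    rw [← Finset.sum_subset (Finset.range_mono hm)]
    · refine Finset.sum_congr rfl fun k hk => ?_
      rw [← Finset.sum_subset (Finset.range_mono hn)]
      · refine Finset.sum_congr rfl fun l hl => ?_
        rw [if_pos ⟨Finset.mem_range.1 hk, Finset.mem_range.1 hl⟩]
      · intro l _ hl
        rw [if_neg]
        rintro ⟨_, h⟩
        exact hl (Finset.mem_range.2 h)
    · intro k _ hk
      refine Finset.sum_eq_zero fun l _ => if_neg ?_
      rintro ⟨h, _⟩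
      exact hk (Finset.mem_range.2 h)
  rw [h1, h2, ← Finset.sum_sub_distrib]
  refine Finset.sum_congr rfl fun k _ => ?_
  rw [← Finset.sum_sub_distrib]
  refine Finset.sum_congr rfl fun l _ => ?_
  split_ifs <;> simp

end Taylor

namespace Symbols

variable {p q : ℝ[X]} {σ : Set ℂ}

theorem entry_sub (φ ψ : Symbols p q σ) (z : ℂ) (k l : ℕ) :
    (φ - ψ).entry z k l = φ.entry z k l - ψ.entry z k l := by
  rw [eq_sub_iff_add_eq, ← entry_add, sub_add_cancel]

theorem entry_ofPoly (s : MvPolynomial (Fin 2) ℂ) {z : ℂ} (hz : z ∈ σ ∪ realZeros p q) {k l : ℕ}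
    (h : (k, l) ∈ realIndex p q z) :
    (ofPoly s : Symbols p q σ).entry z k l = taylorCoeff s z.re z.im k l := by
  rw [entry_of_mem _ hz]
  exact Jet.coeff_ofFun (taylorCoeff s z.re z.im) h

theorem entry_ofPoly_zero (s : MvPolynomial (Fin 2) ℂ) {z : ℂ} (hz : z ∈ σ ∪ realZeros p q) :
    (ofPoly s : Symbols p q σ).entry z 0 0 = MvPolynomial.eval ![(z.re : ℂ), (z.im : ℂ)] s := by
  rw [entry_ofPoly s hz (zero_mem_realIndex p q z), taylorCoeff_zero_zero]

theorem coeff_snd_ofPoly (s : MvPolynomial (Fin 2) ℂ) (ζ : ↥(nonrealZeros p q)) {k l : ℕ}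
    (h : (k, l) ∈ nonrealIndex p q ζ) :
    ((ofPoly s : Symbols p q σ).2 ζ).coeff k l = taylorCoeff s ζ.1.1 ζ.1.2 k l :=
  Jet.coeff_ofFun (taylorCoeff s ζ.1.1 ζ.1.2) h

theorem mem_realIndex_of_lt {z : ℂ} (hz : z ∈ realZeros p q) {k l : ℕ}
    (hk : k < p.rootMultiplicity z.re) (hl : l < q.rootMultiplicity z.im) :
    (k, l) ∈ realIndex p q z := by
  rw [realIndex, if_pos hz]
  exact Or.inl ⟨hk, hl⟩

theorem mem_realIndex_fst {z : ℂ} (hz : z ∈ realZeros p q) {k : ℕ}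
    (hk : k ≤ p.rootMultiplicity z.re) : (k, 0) ∈ realIndex p q z := by
  rw [realIndex, if_pos hz]
  exact Or.inr (Or.inl ⟨hk, rfl⟩)

theorem mem_realIndex_snd {z : ℂ} (hz : z ∈ realZeros p q) {l : ℕ}
    (hl : l ≤ q.rootMultiplicity z.im) : (0, l) ∈ realIndex p q z := by
  rw [realIndex, if_pos hz]
  exact Or.inr (Or.inr ⟨rfl, hl⟩)

theorem ofFun_taylorCoeff_add {I : LowerSet (ℕ × ℕ)} (s t : MvPolynomial (Fin 2) ℂ) (a b : ℂ) :
    Jet.ofFun I (taylorCoeff (s + t) a b) =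
      Jet.ofFun I (taylorCoeff s a b) + Jet.ofFun I (taylorCoeff t a b) := by
  refine Jet.ext_coeff fun k l h => ?_
  rw [Jet.coeff_add, Jet.coeff_ofFun _ h, Jet.coeff_ofFun _ h, Jet.coeff_ofFun _ h,
    taylorCoeff_add]

theorem ofFun_taylorCoeff_C {I : LowerSet (ℕ × ℕ)} (c a b : ℂ) :
    Jet.ofFun I (taylorCoeff (MvPolynomial.C c) a b) = c • 1 := by
  refine Jet.ext_coeff fun k l h => ?_
  rw [Jet.coeff_smul, Jet.coeff_ofFun _ h, Jet.coeff_one h, taylorCoeff_C]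
  simp

theorem ofFun_taylorCoeff_conj {I I' : LowerSet (ℕ × ℕ)} (hI : I = I')
    (s : MvPolynomial (Fin 2) ℂ) (a b : ℂ) :
    Jet.ofFun I' (taylorCoeff (MvPolynomial.map (starRingEnd ℂ) s) (conj a) (conj b)) =
      Jet.conjugate (Jet.ofFun I (taylorCoeff s a b)) := by
  refine Jet.ext_coeff fun k l h => ?_
  rw [Jet.coeff_conjugate _ hI, Jet.coeff_ofFun _ h, Jet.coeff_ofFun _ (hI ▸ h), taylorCoeff_conj]

theorem ofFun_taylorCoeff_mul {I : LowerSet (ℕ × ℕ)} (s t : MvPolynomial (Fin 2) ℂ) (a b : ℂ) :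
    Jet.ofFun I (taylorCoeff (s * t) a b) =
      Jet.ofFun I (taylorCoeff s a b) * Jet.ofFun I (taylorCoeff t a b) := by
  refine Jet.ext_coeff fun k l h => ?_
  rw [Jet.coeff_ofFun _ h, Jet.coeff_mul _ _ h, taylorCoeff_mul]
  refine Finset.sum_congr rfl fun c hc => Finset.sum_congr rfl fun d hd => ?_
  simp only [Finset.mem_range, Nat.lt_succ_iff] at hc hd
  rw [Jet.coeff_ofFun _ (I.lower (show (c, d) ≤ (k, l) from ⟨hc, hd⟩) h),
    Jet.coeff_ofFun _
      (I.lower (show (k - c, l - d) ≤ (k, l) from ⟨Nat.sub_le _ _, Nat.sub_le _ _⟩) h)]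

theorem ofPoly_mul (s t : MvPolynomial (Fin 2) ℂ) :
    (ofPoly (s * t) : Symbols p q σ) = ofPoly s * ofPoly t :=
  ext' (fun _ => ofFun_taylorCoeff_mul s t _ _) (fun _ => ofFun_taylorCoeff_mul s t _ _)

theorem ofPoly_add (s t : MvPolynomial (Fin 2) ℂ) :
    (ofPoly (s + t) : Symbols p q σ) = ofPoly s + ofPoly t :=
  ext' (fun _ => ofFun_taylorCoeff_add s t _ _) (fun _ => ofFun_taylorCoeff_add s t _ _)

theorem ofPoly_C (c : ℂ) : (ofPoly (MvPolynomial.C c) : Symbols p q σ) = algebraMap ℂ _ c := by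
  rw [Algebra.algebraMap_eq_smul_one]
  exact ext' (fun _ => ofFun_taylorCoeff_C c _ _) (fun _ => ofFun_taylorCoeff_C c _ _)

theorem ofPoly_conj (s : MvPolynomial (Fin 2) ℂ) :
    (ofPoly (MvPolynomial.map (starRingEnd ℂ) s) : Symbols p q σ) = star (ofPoly s) := by
  refine ext' (fun z => ?_) (fun ζ => ?_)
  · have h := ofFun_taylorCoeff_conj (I := realIndex p q z) rfl s (z.1.re : ℂ) (z.1.im : ℂ)
    rwa [Complex.conj_ofReal, Complex.conj_ofReal] at h
  · have h := ofFun_taylorCoeff_conj (nonrealIndex_conj p q ζ.1) s (conj ζ.1.1) (conj ζ.1.2)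
    rwa [Complex.conj_conj, Complex.conj_conj] at h

theorem continuous_eval_re_im (s : MvPolynomial (Fin 2) ℂ) :
    Continuous fun z : ℂ => MvPolynomial.eval ![(z.re : ℂ), (z.im : ℂ)] s := by
  have h : Continuous fun z : ℂ => (![(z.re : ℂ), (z.im : ℂ)] : Fin 2 → ℂ) := by
    refine continuous_pi fun i => ?_
    fin_cases i
    · exact Complex.continuous_ofReal.comp Complex.continuous_re
    · exact Complex.continuous_ofReal.comp Complex.continuous_im
  exact (MvPolynomial.continuous_eval s).comp h

/-- Polynomials are admissible: all monomials in the remainder of the Taylor expansion are dominated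
by the gauge. -/
theorem isAdmissible_ofPoly (hσ : IsCompact σ) (s : MvPolynomial (Fin 2) ℂ) :
    (ofPoly s : Symbols p q σ).IsAdmissible where
  measurable := by
    have h : (fun z : ↥(σ \ realZeros p q) => (ofPoly s : Symbols p q σ).entry z 0 0) =
        fun z => MvPolynomial.eval ![(z.1.re : ℂ), (z.1.im : ℂ)] s :=
      funext fun z => entry_ofPoly_zero s (Or.inl z.2.1)
    rw [h]
    exact (continuous_eval_re_im s).measurable.comp measurable_subtype_coe
  bounded := by
    obtain ⟨C, hC⟩ := hσ.exists_bound_of_continuousOn (continuous_eval_re_im s).continuousOn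
    refine ⟨C, fun z hz => ?_⟩
    rw [entry_ofPoly_zero s (Or.inl hz.1)]
    exact hC z hz.1
  growth w hw := by
    set m := p.rootMultiplicity w.re with hm
    set n := q.rootMultiplicity w.im with hn
    obtain ⟨N, hN⟩ := eval_sub_sum_taylorCoeff s w.re w.im m n
    have h1 : ∀ z ∈ σ \ realZeros p q, (ofPoly s : Symbols p q σ).entry z 0 0 -
        (ofPoly s : Symbols p q σ).taylorSum w z =
        ∑ k ∈ Finset.range N, ∑ l ∈ Finset.range N,
          if k < m ∧ l < n then 0 else
            taylorCoeff s w.re w.im k l * ((z - w).re : ℂ) ^ k * ((z - w).im : ℂ) ^ l := by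
      intro z hz
      rw [← hN, entry_ofPoly_zero s (Or.inl hz.1), taylorSum]
      congr 1
      · simp
      · refine Finset.sum_congr rfl fun k hk => Finset.sum_congr rfl fun l hl => ?_
        rw [entry_ofPoly s (Or.inr hw.2)
          (mem_realIndex_of_lt hw.2 (Finset.mem_range.1 hk) (Finset.mem_range.1 hl))]
    have h2 : (fun z => ∑ k ∈ Finset.range N, ∑ l ∈ Finset.range N,
          if k < m ∧ l < n then 0 else
            taylorCoeff s w.re w.im k l * ((z - w).re : ℂ) ^ k * ((z - w).im : ℂ) ^ l)
        =O[𝓝[σ \ realZeros p q] w] gauge p q w := by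
      refine Asymptotics.IsBigO.fun_sum fun k _ => ?_
      refine Asymptotics.IsBigO.fun_sum fun l _ => ?_
      by_cases h : k < m ∧ l < n
      · simp only [h, and_self, if_true]
        exact Asymptotics.isBigO_zero _ _
      · simp only [h, if_false]
        exact monomial_isBigO_gauge _ w _ (by omega)
    refine h2.congr' ?_ Filter.EventuallyEq.rfl
    filter_upwards [self_mem_nhdsWithin] with z hz
    exact (h1 z hz).symm

/-! ### Residual functions -/

/-- Functions whose entries vanish at the real and nonreal zeros, except possibly for those with
index `(m, 0)` or `(0, n)` at the real zeros. -/
def IsResidual (φ : Symbols p q σ) : Prop :=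
  (∀ z ∈ realZeros p q, ∀ k < p.rootMultiplicity z.re, ∀ l < q.rootMultiplicity z.im,
    φ.entry z k l = 0) ∧ ∀ ζ, φ.2 ζ = 0

theorem IsResidual.add {φ ψ : Symbols p q σ} (hφ : φ.IsResidual) (hψ : ψ.IsResidual) :
    (φ + ψ).IsResidual := by
  refine ⟨fun z hz k hk l hl => ?_, fun ζ => ?_⟩
  · rw [entry_add, hφ.1 z hz k hk l hl, hψ.1 z hz k hk l hl, add_zero]
  · change φ.2 ζ + ψ.2 ζ = 0
    rw [hφ.2, hψ.2, add_zero]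

theorem IsResidual.mul {φ : Symbols p q σ} (hφ : φ.IsResidual) (ψ : Symbols p q σ) :
    (φ * ψ).IsResidual := by
  refine ⟨fun z hz k hk l hl => ?_, fun ζ => ?_⟩
  · rw [entry_mul _ _ (mem_realIndex_of_lt hz hk hl)]
    refine Finset.sum_eq_zero fun c hc => Finset.sum_eq_zero fun d hd => ?_
    simp only [Finset.mem_range, Nat.lt_succ_iff] at hc hd
    rw [hφ.1 z hz c (by omega) d (by omega), zero_mul]
  · change φ.2 ζ * ψ.2 ζ = 0
    rw [hφ.2, zero_mul]

theorem IsResidual.star {φ : Symbols p q σ} (hφ : φ.IsResidual) : (star φ).IsResidual := by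
  refine ⟨fun z hz k hk l hl => ?_, fun ζ => ?_⟩
  · rw [entry_star, hφ.1 z hz k hk l hl, map_zero]
  · refine Jet.ext_coeff fun k l h => ?_
    refine (Jet.coeff_conjugate _ (nonrealIndex_conj p q ζ.1) k l).trans ?_
    rw [hφ.2, Jet.coeff_zero, Jet.coeff_zero, map_zero]

/-- Multiplication of a residual function by `ψ` only involves the values of `ψ` at the zeros. -/
theorem IsResidual.entry_mul_fst (hq : q ≠ 0) {φ : Symbols p q σ} (hφ : φ.IsResidual)
    (ψ : Symbols p q σ) {z : ℂ} (hz : z ∈ realZeros p q) :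
    (φ * ψ).entry z (p.rootMultiplicity z.re) 0 =
      φ.entry z (p.rootMultiplicity z.re) 0 * ψ.entry z 0 0 := by
  have hn : 0 < q.rootMultiplicity z.im := (Polynomial.rootMultiplicity_pos hq).2 hz.2
  rw [entry_mul _ _ (mem_realIndex_fst hz le_rfl), Finset.sum_range_succ, Finset.sum_eq_zero]
  · simp
  · intro c hc
    refine Finset.sum_eq_zero fun d hd => ?_
    have hd0 : d = 0 := by simpa using hd
    rw [hφ.1 z hz c (Finset.mem_range.1 hc) d (by omega), zero_mul]

theorem IsResidual.entry_mul_snd (hp : p ≠ 0) {φ : Symbols p q σ} (hφ : φ.IsResidual)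
    (ψ : Symbols p q σ) {z : ℂ} (hz : z ∈ realZeros p q) :
    (φ * ψ).entry z 0 (q.rootMultiplicity z.im) =
      φ.entry z 0 (q.rootMultiplicity z.im) * ψ.entry z 0 0 := by
  have hm : 0 < p.rootMultiplicity z.re := (Polynomial.rootMultiplicity_pos hp).2 hz.1
  rw [entry_mul _ _ (mem_realIndex_snd hz le_rfl), Finset.sum_range_one, Finset.sum_range_succ,
    Finset.sum_eq_zero]
  · simp
  · intro d hd
    rw [hφ.1 z hz 0 hm d (Finset.mem_range.1 hd), zero_mul]

theorem map_ne_zero_of_ne_zero (hp : p ≠ 0) : p.map (algebraMap ℝ ℂ) ≠ 0 :=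
  (Polynomial.map_ne_zero_iff (algebraMap ℝ ℂ).injective).2 hp

theorem rootMultiplicity_map_ofReal (p : ℝ[X]) (x : ℝ) :
    (p.map (algebraMap ℝ ℂ)).rootMultiplicity (x : ℂ) = p.rootMultiplicity x :=
  (Polynomial.eq_rootMultiplicity_map (algebraMap ℝ ℂ).injective x).symm

theorem eval_map_ofReal (p : ℝ[X]) (x : ℝ) :
    (p.map (algebraMap ℝ ℂ)).eval (x : ℂ) = ((p.eval x : ℝ) : ℂ) := by
  rw [Polynomial.eval_map]
  exact Polynomial.eval₂_at_apply (algebraMap ℝ ℂ) x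

/-- Every jet-valued function agrees with a polynomial up to a residual function. -/
theorem exists_isResidual_sub_ofPoly (hp : p ≠ 0) (hq : q ≠ 0) (φ : Symbols p q σ) :
    ∃ s, (φ - ofPoly s).IsResidual := by
  classical
  obtain ⟨e, he⟩ := exists_isHermiteBasis (map_ne_zero_of_ne_zero hp)
  obtain ⟨f, hf⟩ := exists_isHermiteBasis (map_ne_zero_of_ne_zero hq)
  -- the prescribed jets: those of `φ` at the nonreal pairs of zeros and at the points `ξ + i η`
  let c : ℂ → ℂ → ℕ → ℕ → ℂ := fun ξ η k l =>
    if h : (ξ, η) ∈ nonrealZeros p q then (φ.2 ⟨(ξ, η), h⟩).coeff k l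
    else φ.entry ⟨ξ.re, η.re⟩ k l
  set s := hermiteInterp (p.map (algebraMap ℝ ℂ)) (q.map (algebraMap ℝ ℂ)) e f c with hs
  refine ⟨s, fun z hz k hk l hl => ?_, fun ζ => ?_⟩
  · have h1 := taylorCoeff_hermiteInterp (map_ne_zero_of_ne_zero hp) (map_ne_zero_of_ne_zero hq)
      he hf c (ξ := z.re) (η := z.im) (by rw [eval_map_ofReal, hz.1]; rfl)
      (by rw [eval_map_ofReal, hz.2]; rfl) (k := k) (l := l)
      (by rwa [rootMultiplicity_map_ofReal]) (by rwa [rootMultiplicity_map_ofReal])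
    rw [entry_sub, entry_ofPoly _ (Or.inr hz) (mem_realIndex_of_lt hz hk hl), hs, h1]
    have h2 : ((z.re : ℂ), (z.im : ℂ)) ∉ nonrealZeros p q := fun h => h.2.2 (by simp)
    simp [c, h2]
  · refine Jet.ext_coeff fun k l h => ?_
    have h1 := taylorCoeff_hermiteInterp (map_ne_zero_of_ne_zero hp) (map_ne_zero_of_ne_zero hq)
      he hf c ζ.2.1 ζ.2.2.1 h.1 h.2
    have h2 : φ.2 ζ = (ofPoly s : Symbols p q σ).2 ζ + (φ - ofPoly s).2 ζ := by
      change _ = _ + (φ.2 ζ - _)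
      rw [add_sub_cancel]
    have h3 := congrArg (fun j => Jet.coeff j k l) h2
    simp only [Jet.coeff_add] at h3
    rw [coeff_snd_ofPoly _ _ h, hs, h1] at h3
    have h4 : c ζ.1.1 ζ.1.2 k l = (φ.2 ζ).coeff k l := by
      have h5 : ((ζ.1.1, ζ.1.2) : ℂ × ℂ) ∈ nonrealZeros p q := ζ.2
      simp only [c, dif_pos h5]
    rw [h4, left_eq_add] at h3
    rw [h3, Jet.coeff_zero]

/-- A polynomial which is a residual function belongs to the ideal generated by `p(z)` and `q(w)`,
since its Hermite interpolation vanishes. -/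
theorem exists_eq_of_isResidual_ofPoly (hp : p ≠ 0) (hq : q ≠ 0) {s : MvPolynomial (Fin 2) ℂ}
    (h : (ofPoly s : Symbols p q σ).IsResidual) : ∃ u v : MvPolynomial (Fin 2) ℂ,
      s = u * Polynomial.aeval (MvPolynomial.X 0) (p.map (algebraMap ℝ ℂ)) +
        v * Polynomial.aeval (MvPolynomial.X 1) (q.map (algebraMap ℝ ℂ)) := by
  have hp' := map_ne_zero_of_ne_zero hp
  have hq' := map_ne_zero_of_ne_zero hq
  obtain ⟨e, he⟩ := exists_isHermiteBasis hp'
  obtain ⟨f, hf⟩ := exists_isHermiteBasis hq'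
  have h1 := sub_hermiteInterp_mem hp' hq' he hf s
  have h2 : hermiteInterp (p.map (algebraMap ℝ ℂ)) (q.map (algebraMap ℝ ℂ)) e f
      (taylorCoeff s) = 0 := by
    refine Finset.sum_eq_zero fun ξ hξ => Finset.sum_eq_zero fun k hk =>
      Finset.sum_eq_zero fun η hη => Finset.sum_eq_zero fun l hl => ?_
    rw [Finset.mem_range] at hk hl
    have hξ' : (p.map (algebraMap ℝ ℂ)).eval ξ = 0 := by
      have := (Polynomial.mem_roots hp').1 (Multiset.mem_toFinset.1 hξ)
      exact this
    have hη' : (q.map (algebraMap ℝ ℂ)).eval η = 0 := by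
      have := (Polynomial.mem_roots hq').1 (Multiset.mem_toFinset.1 hη)
      exact this
    suffices hs : taylorCoeff s ξ η k l = 0 by rw [hs, zero_smul]
    by_cases hreal : ξ.im = 0 ∧ η.im = 0
    · have hξr : ξ = (ξ.re : ℂ) := Complex.ext rfl (by simpa using hreal.1)
      have hηr : η = (η.re : ℂ) := Complex.ext rfl (by simpa using hreal.2)
      rw [hξr, rootMultiplicity_map_ofReal] at hk
      rw [hηr, rootMultiplicity_map_ofReal] at hl
      rw [hξr, eval_map_ofReal] at hξ'
      rw [hηr, eval_map_ofReal] at hη'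
      have hz : (⟨ξ.re, η.re⟩ : ℂ) ∈ realZeros p q :=
        ⟨Complex.ofReal_injective hξ', Complex.ofReal_injective hη'⟩
      have h3 := h.1 _ hz k hk l hl
      rw [entry_ofPoly _ (Or.inr hz) (mem_realIndex_of_lt hz hk hl)] at h3
      rw [hξr, hηr]
      exact h3
    · have hζ : (ξ, η) ∈ nonrealZeros p q := ⟨hξ', hη', hreal⟩
      have h3 := congrArg (fun j => Jet.coeff j k l) (h.2 ⟨(ξ, η), hζ⟩)
      simp only [Jet.coeff_zero] at h3
      have hidx : (k, l) ∈ nonrealIndex p q (ξ, η) := ⟨hk, hl⟩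
      exact (coeff_snd_ofPoly s ⟨(ξ, η), hζ⟩ hidx).symm.trans h3
  rw [h2, sub_zero, Ideal.mem_span_pair] at h1
  obtain ⟨u, v, huv⟩ := h1
  exact ⟨u, v, huv.symm⟩

end Symbols

/-! ### Polynomials in two commuting operators -/

section BiPoly

variable {K : Type*} [NormedAddCommGroup K] [InnerProductSpace ℂ K]

theorem biPolyEval_eq_sum {s : MvPolynomial (Fin 2) ℂ} {t : Finset (Fin 2 →₀ ℕ)}
    (h : s.support ⊆ t) (A B : K →L[ℂ] K) :
    biPolyEval s A B = ∑ m ∈ t, s.coeff m • (A ^ m 0 * B ^ m 1) := by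
  refine Finset.sum_subset h fun m _ hm => ?_
  rw [MvPolynomial.notMem_support_iff.1 hm, zero_smul]

theorem biPolyEval_add (s t : MvPolynomial (Fin 2) ℂ) (A B : K →L[ℂ] K) :
    biPolyEval (s + t) A B = biPolyEval s A B + biPolyEval t A B := by
  classical
  rw [biPolyEval_eq_sum (MvPolynomial.support_add (p := s) (q := t)),
    biPolyEval_eq_sum (s := s) Finset.subset_union_left,
    biPolyEval_eq_sum (s := t) Finset.subset_union_right, ← Finset.sum_add_distrib]
  simp only [MvPolynomial.coeff_add, add_smul]

theorem biPolyEval_monomial (m : Fin 2 →₀ ℕ) (c : ℂ) (A B : K →L[ℂ] K) :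
    biPolyEval (MvPolynomial.monomial m c) A B = c • (A ^ m 0 * B ^ m 1) := by
  rw [biPolyEval_eq_sum (MvPolynomial.support_monomial_subset), Finset.sum_singleton,
    MvPolynomial.coeff_monomial, if_pos rfl]

theorem biPolyEval_C (c : ℂ) (A B : K →L[ℂ] K) :
    biPolyEval (MvPolynomial.C c) A B = c • 1 := by
  rw [MvPolynomial.C_apply, biPolyEval_monomial]
  simp

theorem biPolyEval_X_zero (A B : K →L[ℂ] K) : biPolyEval (MvPolynomial.X 0) A B = A := by
  rw [MvPolynomial.X, biPolyEval_monomial]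
  simp

theorem biPolyEval_X_one (A B : K →L[ℂ] K) : biPolyEval (MvPolynomial.X 1) A B = B := by
  rw [MvPolynomial.X, biPolyEval_monomial]
  simp

theorem biPolyEval_mul (s t : MvPolynomial (Fin 2) ℂ) {A B : K →L[ℂ] K} (h : Commute A B) :
    biPolyEval (s * t) A B = biPolyEval s A B * biPolyEval t A B := by
  induction s using MvPolynomial.induction_on' with
  | add s s' hs hs' => rw [add_mul, biPolyEval_add, biPolyEval_add, hs, hs', add_mul]
  | monomial m c =>
    induction t using MvPolynomial.induction_on' with
    | add t t' ht ht' => rw [mul_add, biPolyEval_add, biPolyEval_add, ht, ht', mul_add]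
    | monomial n d =>
      rw [MvPolynomial.monomial_mul, biPolyEval_monomial, biPolyEval_monomial, biPolyEval_monomial,
        smul_mul_smul_comm]
      congr 1
      have h1 : B ^ m 1 * A ^ n 0 = A ^ n 0 * B ^ m 1 := (h.symm.pow_pow _ _).eq
      rw [Finsupp.add_apply, Finsupp.add_apply, pow_add, pow_add, mul_assoc, mul_assoc,
        ← mul_assoc (A ^ n 0), ← h1, mul_assoc]

theorem commute_biPolyEval {A B C : K →L[ℂ] K} (hA : Commute C A) (hB : Commute C B)
    (s : MvPolynomial (Fin 2) ℂ) : Commute C (biPolyEval s A B) :=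
  Commute.sum_right _ _ _ fun _ _ =>
    ((hA.pow_right _).mul_right (hB.pow_right _)).smul_right _

theorem biPolyEval_aeval_X_zero (r : ℂ[X]) {A B : K →L[ℂ] K} (h : Commute A B) :
    biPolyEval (Polynomial.aeval (MvPolynomial.X 0) r) A B = Polynomial.aeval A r := by
  induction r using Polynomial.induction_on with
  | C c => simp [MvPolynomial.algebraMap_eq, biPolyEval_C, Algebra.algebraMap_eq_smul_one]
  | add f g hf hg => rw [map_add, map_add, biPolyEval_add, hf, hg]
  | monomial n c hf =>
    rw [pow_succ, ← mul_assoc]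
    generalize Polynomial.C c * Polynomial.X ^ n = g at hf
    rw [map_mul, map_mul, biPolyEval_mul _ _ h, hf, Polynomial.aeval_X, Polynomial.aeval_X,
      biPolyEval_X_zero]

theorem biPolyEval_aeval_X_one (r : ℂ[X]) {A B : K →L[ℂ] K} (h : Commute A B) :
    biPolyEval (Polynomial.aeval (MvPolynomial.X 1) r) A B = Polynomial.aeval B r := by
  induction r using Polynomial.induction_on with
  | C c => simp [MvPolynomial.algebraMap_eq, biPolyEval_C, Algebra.algebraMap_eq_smul_one]
  | add f g hf hg => rw [map_add, map_add, biPolyEval_add, hf, hg]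
  | monomial n c hf =>
    rw [pow_succ, ← mul_assoc]
    generalize Polynomial.C c * Polynomial.X ^ n = g at hf
    rw [map_mul, map_mul, biPolyEval_mul _ _ h, hf, Polynomial.aeval_X, Polynomial.aeval_X,
      biPolyEval_X_one]

/-- Polynomials in operators are preserved by intertwining maps. -/
theorem comp_biPolyEval {H : Type*} [NormedAddCommGroup H] [InnerProductSpace ℂ H]
    {A B : K →L[ℂ] K} {a b : H →L[ℂ] H} {T : H →L[ℂ] K} (hA : T ∘L a = A ∘L T)
    (hB : T ∘L b = B ∘L T) (s : MvPolynomial (Fin 2) ℂ) :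
    T ∘L biPolyEval s a b = biPolyEval s A B ∘L T := by
  have hpow : ∀ {C : K →L[ℂ] K} {c : H →L[ℂ] H}, T ∘L c = C ∘L T → ∀ (n : ℕ) (x : H),
      T ((c ^ n) x) = (C ^ n) (T x) := by
    intro C c h n
    induction n with
    | zero => intro x; rfl
    | succ n ih =>
      intro x
      rw [pow_succ, pow_succ, mul_apply_eq_comp, mul_apply_eq_comp, ih]
      exact congrArg _ (congrArg (fun L : H →L[ℂ] K => L x) h)
  ext x
  simp only [biPolyEval, ContinuousLinearMap.comp_apply, sum_apply, smul_apply, map_sum, map_smul,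
    mul_apply_eq_comp, hpow hA, hpow hB]

/-- For the real and imaginary parts of a normal operator `M`, the polynomial calculus is the
continuous functional calculus of `M`. -/
theorem biPolyEval_eq_cfc {H : Type*} [NormedAddCommGroup H] [InnerProductSpace ℂ H]
    [CompleteSpace H] {M a b : H →L[ℂ] H} (hM : IsStarNormal M)
    (ha : a = cfc (fun z => (z.re : ℂ)) M) (hb : b = cfc (fun z => (z.im : ℂ)) M)
    (s : MvPolynomial (Fin 2) ℂ) :
    biPolyEval s a b = cfc (fun z : ℂ => MvPolynomial.eval ![(z.re : ℂ), (z.im : ℂ)] s) M := by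
  have hab : Commute a b := by rw [ha, hb]; exact cfc_commute_cfc _ _ M
  have hc : ∀ t : MvPolynomial (Fin 2) ℂ, ContinuousOn
      (fun z : ℂ => MvPolynomial.eval ![(z.re : ℂ), (z.im : ℂ)] t) (spectrum ℂ M) :=
    fun t => (Symbols.continuous_eval_re_im t).continuousOn
  induction s using MvPolynomial.induction_on with
  | C c =>
    simp only [MvPolynomial.eval_C]
    rw [biPolyEval_C, cfc_const c M hM, Algebra.algebraMap_eq_smul_one]
  | add s t hs ht =>
    simp only [map_add]
    rw [biPolyEval_add, hs, ht, cfc_add M _ _ (hc s) (hc t)]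
  | mul_X s i hs =>
    simp only [map_mul]
    rw [biPolyEval_mul _ _ hab, hs, cfc_mul _ _ M (hc s) (hc (MvPolynomial.X i))]
    congr 1
    fin_cases i
    · simpa [biPolyEval_X_zero] using ha
    · simpa [biPolyEval_X_one] using hb

end BiPoly

/-! ### Lifting operators to the Hilbert space completion -/

/-- A nonnegative log-convex sequence that grows at most like `r ^ n` satisfies `u 1 ≤ r * u 0`. -/
theorem le_mul_of_log_convex {u : ℕ → ℝ} (h0 : ∀ n, 0 ≤ u n)
    (hc : ∀ n, u (n + 1) ^ 2 ≤ u n * u (n + 2)) {C r : ℝ} (hr : 0 ≤ r)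
    (hb : ∀ n, u n ≤ C * r ^ n) : u 1 ≤ r * u 0 := by
  by_contra! h
  have hu1 : 0 < u 1 := (mul_nonneg hr (h0 0)).trans_lt h
  have hu0 : 0 < u 0 := by
    refine (h0 0).lt_of_ne fun h00 => ?_
    have := hc 0
    rw [← h00, zero_mul] at this
    nlinarith
  have hr0 : 0 < r := by
    refine hr.lt_of_ne fun h00 => ?_
    have := hb 1
    rw [← h00] at this
    simp at this
    linarith
  set t := u 1 / u 0 with ht
  have htr : r < t := (lt_div_iff₀ hu0).2 h
  have ht0 : 0 < t := hr0.trans htr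
  have hstep : ∀ n, 0 < u n ∧ t * u n ≤ u (n + 1) := by
    intro n
    induction n with
    | zero => exact ⟨hu0, by rw [ht, div_mul_cancel₀ _ hu0.ne']⟩
    | succ n ih =>
      have h1 : 0 < u (n + 1) := (mul_pos ht0 ih.1).trans_le ih.2
      refine ⟨h1, ?_⟩
      have h2 := hc n
      have h3 : u n * (t * u (n + 1)) ≤ u n * u (n + 2) := by nlinarith [ih.2]
      exact le_of_mul_le_mul_left h3 ih.1
  have hpow : ∀ n, t ^ n * u 0 ≤ u n := by
    intro n
    induction n with
    | zero => simp
    | succ n ih =>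
      calc t ^ (n + 1) * u 0 = t * (t ^ n * u 0) := by ring
        _ ≤ t * u n := by gcongr
        _ ≤ _ := (hstep n).2
  obtain ⟨n, hn⟩ := pow_unbounded_of_one_lt (C / u 0) ((one_lt_div hr0).2 htr)
  rw [div_pow, div_lt_div_iff₀ hu0 (by positivity)] at hn
  linarith [hpow n, hb n]

theorem denseRange_gramEmbed {K : Type*} [NormedAddCommGroup K] [InnerProductSpace ℂ K]
    (S : K →L[ℂ] K) (hS : S.IsPositive) : DenseRange (gramEmbed S hS) := by
  have h : Function.Surjective (toGram S hS) := fun x => ⟨x, rfl⟩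
  exact UniformSpace.Completion.denseRange_coe.comp h.denseRange
    (UniformSpace.Completion.continuous_coe _)

namespace DefinitizableNormal

variable {K : Type*} [NormedAddCommGroup K] [InnerProductSpace ℂ K] [CompleteSpace K]
  {J : KreinStructure K} (D : DefinitizableNormal J)

/-- The operator `p(A) + q(B) = T T*`. -/
def G : K →L[ℂ] K := realPolyEval D.p D.A + realPolyEval D.q D.B

theorem adj_A : J.adj D.A = D.A := J.adj_rePart D.N

theorem adj_B : J.adj D.B = D.B := J.adj_imPart D.N

theorem adj_G : J.adj D.G = D.G := by
  rw [G, J.adj_add, J.adj_realPolyEval D.adj_A, J.adj_realPolyEval D.adj_B]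

theorem gramSum_apply (x : K) : (D.gramA + D.gramB) x = J.symm (D.G x) := by
  simp [gramA, gramB, G]

theorem commute_adj_G {C : K →L[ℂ] K} (hC : Commute C D.G) : Commute (J.adj C) D.G := by
  have h := congrArg J.adj hC.eq
  rw [J.adj_mul, J.adj_mul, adj_G] at h
  exact h.symm

/-- The Krein space adjoint is an adjoint for the form `[(p(A) + q(B)) x, y]`, if the operator
commutes with `p(A) + q(B)`. -/
theorem inner_gramSum_adj {C : K →L[ℂ] K} (hC : Commute C D.G) (x y : K) :
    inner ℂ (C x) ((D.gramA + D.gramB) y) = inner ℂ x ((D.gramA + D.gramB) (J.adj C y)) := by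
  rw [gramSum_apply, gramSum_apply]
  have h : D.G (J.adj C y) = J.adj C (D.G y) :=
    congrArg (fun L : K →L[ℂ] K => L y) (D.commute_adj_G hC).eq.symm
  rw [h, KreinStructure.adj, mul_apply_eq_comp, mul_apply_eq_comp, J.symm_symm,
    ContinuousLinearMap.adjoint_inner_right]

/-- An operator which commutes with `p(A) + q(B)` is bounded for the seminorm given by
`[(p(A) + q(B)) x, x]`. For the symmetric operator `F = C* C` the sequence of the seminorms of
`F ^ n x` is log-convex by the Cauchy-Schwarz inequality, and it grows at most like `‖F‖ ^ n`. -/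
theorem norm_toGram_apply_le {C : K →L[ℂ] K} (hC : Commute C D.G) (x : K) :
    ‖toGram (D.gramA + D.gramB) D.gramSum_pos (C x)‖ ≤
      √‖J.adj C * C‖ * ‖toGram (D.gramA + D.gramB) D.gramSum_pos x‖ := by
  set S := D.gramA + D.gramB with hS
  set F := J.adj C * C with hF
  have hFG : Commute F D.G := (D.commute_adj_G hC).mul_left hC
  have hFadj : J.adj F = F := by rw [hF, J.adj_mul, J.adj_adj]
  have hin : ∀ x y : K, inner ℂ (toGram S D.gramSum_pos x) (toGram S D.gramSum_pos y) =
      inner ℂ x (S y) := fun x y => rfl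
  have key : ‖toGram S D.gramSum_pos (F x)‖ ≤ ‖F‖ * ‖toGram S D.gramSum_pos x‖ := by
    have h := le_mul_of_log_convex (u := fun n => ‖toGram S D.gramSum_pos ((F ^ n) x)‖)
      (C := √‖S‖ * ‖x‖) (r := ‖F‖) (fun n => norm_nonneg _) (fun n => ?_) (norm_nonneg _)
      (fun n => ?_)
    · simpa using h
    · have h1 : inner ℂ (toGram S D.gramSum_pos ((F ^ (n + 1)) x))
          (toGram S D.gramSum_pos ((F ^ (n + 1)) x)) =
          inner ℂ (toGram S D.gramSum_pos ((F ^ n) x))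
            (toGram S D.gramSum_pos ((F ^ (n + 2)) x)) := by
        have e1 : ∀ k, (F ^ (k + 1)) x = F ((F ^ k) x) := fun k => by rw [pow_succ']; rfl
        rw [hin, hin, e1 (n + 1)]
        conv_lhs => rw [e1 n]
        rw [D.inner_gramSum_adj hFG, hFadj, e1 n]
      have h2 := norm_inner_le_norm (𝕜 := ℂ) (toGram S D.gramSum_pos ((F ^ n) x))
        (toGram S D.gramSum_pos ((F ^ (n + 2)) x))
      rw [← h1, inner_self_eq_norm_sq_to_K] at h2
      simpa using h2
    · refine (norm_toGram_le S D.gramSum_pos _).trans ?_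
      have h3 : ‖(F ^ n) x‖ ≤ ‖F‖ ^ n * ‖x‖ := by
        refine ((F ^ n).le_opNorm x).trans ?_
        gcongr
        induction n with
        | zero => rw [pow_zero, pow_zero]; exact ContinuousLinearMap.norm_id_le
        | succ n ih =>
          rw [pow_succ, pow_succ]
          exact (norm_mul_le _ _).trans (by gcongr)
      calc √‖S‖ * ‖(F ^ n) x‖ ≤ √‖S‖ * (‖F‖ ^ n * ‖x‖) := by gcongr
        _ = _ := by ring
  refine le_of_sq_le_sq ?_ (by positivity)
  rw [mul_pow, Real.sq_sqrt (norm_nonneg _)]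
  have h1 : inner ℂ (toGram S D.gramSum_pos (C x)) (toGram S D.gramSum_pos (C x)) =
      inner ℂ (toGram S D.gramSum_pos x) (toGram S D.gramSum_pos (F x)) := by
    rw [hin, hin, D.inner_gramSum_adj hC]
    rfl
  have h2 := norm_inner_le_norm (𝕜 := ℂ) (toGram S D.gramSum_pos x) (toGram S D.gramSum_pos (F x))
  rw [← h1, inner_self_eq_norm_sq_to_K] at h2
  have h3 : ‖toGram S D.gramSum_pos (C x)‖ ^ 2 ≤
      ‖toGram S D.gramSum_pos x‖ * ‖toGram S D.gramSum_pos (F x)‖ := by simpa using h2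
  refine h3.trans ?_
  calc _ ≤ ‖toGram S D.gramSum_pos x‖ * (‖F‖ * ‖toGram S D.gramSum_pos x‖) := by gcongr
    _ = _ := by ring

theorem denseRange_Tstar : DenseRange D.Tstar := denseRange_gramEmbed _ _

theorem T_Tstar_apply (x : K) : D.T (D.Tstar x) = D.G x :=
  congrArg (fun L : K →L[ℂ] K => L x) D.T_Tstar

theorem T_injective : Function.Injective D.T := by
  refine (injective_iff_map_eq_zero _).2 fun v hv => ?_
  refine D.denseRange_Tstar.eq_zero_of_inner_right ℂ fun x => ?_
  rw [← D.form_T, hv]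
  simp [KreinStructure.form]

/-- The operator `Θ(C)` is the extension of `T* x ↦ T* (C x)` to the completion. -/
theorem exists_comp_eq {C : K →L[ℂ] K} (hC : Commute C D.G) :
    ∃ M : D.V →L[ℂ] D.V, D.T ∘L M = C ∘L D.T := by
  let M : D.V →L[ℂ] D.V := ((toGram _ D.gramSum_pos ∘ₗ (C : K →ₗ[ℂ] K) ∘ₗ
    ofGram _ D.gramSum_pos).mkContinuous (√‖J.adj C * C‖)
      (fun x => D.norm_toGram_apply_le hC (ofGram _ D.gramSum_pos x))).completion
  have hM : ∀ x, M (D.Tstar x) = D.Tstar (C x) := fun x =>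
    ContinuousLinearMap.completion_apply_coe _ _
  refine ⟨M, ContinuousLinearMap.coeFn_injective ?_⟩
  refine D.denseRange_Tstar.equalizer (ContinuousLinearMap.continuous _)
    (ContinuousLinearMap.continuous _) (funext fun x => ?_)
  simp only [Function.comp_apply, ContinuousLinearMap.comp_apply, hM, T_Tstar_apply]
  exact congrArg (fun L : K →L[ℂ] K => L x) hC.eq.symm

theorem T_theta {C : K →L[ℂ] K} (hC : Commute C D.G) : D.T ∘L D.theta C = C ∘L D.T := by
  have h := D.exists_comp_eq hC
  rw [theta, dif_pos h]
  exact h.choose_spec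

theorem T_theta_apply {C : K →L[ℂ] K} (hC : Commute C D.G) (v : D.V) :
    D.T (D.theta C v) = C (D.T v) :=
  congrArg (fun L : D.V →L[ℂ] K => L v) (D.T_theta hC)

theorem theta_eq {C : K →L[ℂ] K} (hC : Commute C D.G) {M : D.V →L[ℂ] D.V}
    (h : ∀ v, D.T (M v) = C (D.T v)) : D.theta C = M := by
  ext v
  exact D.T_injective ((D.T_theta_apply hC v).trans (h v).symm)

theorem theta_Tstar {C : K →L[ℂ] K} (hC : Commute C D.G) (x : K) :
    D.theta C (D.Tstar x) = D.Tstar (C x) := by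
  refine D.T_injective ?_
  rw [D.T_theta_apply hC, T_Tstar_apply, T_Tstar_apply]
  exact congrArg (fun L : K →L[ℂ] K => L x) hC.eq

theorem ext_Tstar {X Y : D.V →L[ℂ] D.V} (h : ∀ x, X (D.Tstar x) = Y (D.Tstar x)) : X = Y :=
  ContinuousLinearMap.coeFn_injective
    (D.denseRange_Tstar.equalizer X.continuous Y.continuous (funext h))

theorem xi_apply (X : D.V →L[ℂ] D.V) (x : K) : D.xi X x = D.T (X (D.Tstar x)) := rfl

theorem xi_injective : Function.Injective D.xi := fun _ _ h =>
  D.ext_Tstar fun x => D.T_injective (congrArg (fun L : K →L[ℂ] K => L x) h)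

/-- `Θ` turns the Krein space adjoint into the Hilbert space adjoint. -/
theorem adjoint_theta {C : K →L[ℂ] K} (hC : Commute C D.G) :
    ContinuousLinearMap.adjoint (D.theta C) = D.theta (J.adj C) := by
  refine D.ext_Tstar fun y => ?_
  rw [D.theta_Tstar (D.commute_adj_G hC)]
  refine D.denseRange_Tstar.eq_of_inner_right ℂ fun x => ?_
  rw [ContinuousLinearMap.adjoint_inner_right, D.theta_Tstar hC]
  exact (inner_gramEmbed _ D.gramSum_pos (C x) y).trans
    ((D.inner_gramSum_adj hC x y).trans (inner_gramEmbed _ D.gramSum_pos x _).symm)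

end DefinitizableNormal

/-! ### The normal operator on the completion -/

namespace DefinitizableNormal

variable {K : Type*} [NormedAddCommGroup K] [InnerProductSpace ℂ K] [CompleteSpace K]
  {J : KreinStructure K} (D : DefinitizableNormal J)

theorem N_eq : D.N = D.A + Complex.I • D.B := by
  have h : Complex.I * (1 / (2 * Complex.I)) = 1 / 2 := by
    field_simp
  rw [A, B, KreinStructure.rePart, KreinStructure.imPart, smul_smul, h, ← smul_add]
  have h2 : D.N + J.adj D.N + (D.N - J.adj D.N) = (2 : ℂ) • D.N := by
    rw [two_smul]; abel
  rw [h2, smul_smul]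
  norm_num

theorem adj_N_eq : J.adj D.N = D.A - Complex.I • D.B := by
  conv_lhs => rw [N_eq, J.adj_add, J.adj_smul, adj_A, adj_B, Complex.conj_I, neg_smul]
  rw [sub_eq_add_neg]

theorem commute_A {C : K →L[ℂ] K} (h1 : Commute C D.N) (h2 : Commute C (J.adj D.N)) :
    Commute C D.A := (h1.add_right h2).smul_right _

theorem commute_B {C : K →L[ℂ] K} (h1 : Commute C D.N) (h2 : Commute C (J.adj D.N)) :
    Commute C D.B := (h1.sub_right h2).smul_right _

theorem commute_A_B : Commute D.A D.B := by
  have h : Commute D.N (J.adj D.N) := D.normal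
  have hA : Commute D.A D.N := (D.commute_A (Commute.refl _) h).symm
  have hA' : Commute D.A (J.adj D.N) := (D.commute_A h.symm (Commute.refl _)).symm
  exact D.commute_B hA hA'

theorem realPolyEval_A (r : ℝ[X]) : realPolyEval r D.A =
    biPolyEval (Polynomial.aeval (MvPolynomial.X 0) (r.map (algebraMap ℝ ℂ))) D.A D.B :=
  (biPolyEval_aeval_X_zero _ D.commute_A_B).symm

theorem realPolyEval_B (r : ℝ[X]) : realPolyEval r D.B =
    biPolyEval (Polynomial.aeval (MvPolynomial.X 1) (r.map (algebraMap ℝ ℂ))) D.A D.B :=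
  (biPolyEval_aeval_X_one _ D.commute_A_B).symm

theorem G_eq : D.G = biPolyEval D.pq D.A D.B := by
  rw [G, realPolyEval_A, realPolyEval_B, pq, biPolyEval_add]

theorem commute_G {C : K →L[ℂ] K} (hA : Commute C D.A) (hB : Commute C D.B) : Commute C D.G := by
  rw [G_eq]
  exact commute_biPolyEval hA hB _

theorem commute_A_G : Commute D.A D.G := D.commute_G (Commute.refl _) D.commute_A_B

theorem commute_B_G : Commute D.B D.G := D.commute_G D.commute_A_B.symm (Commute.refl _)

theorem commute_N_G : Commute D.N D.G := by
  rw [N_eq]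
  exact D.commute_A_G.add_left (D.commute_B_G.smul_left _)

theorem theta_biPolyEval (s : MvPolynomial (Fin 2) ℂ) :
    D.theta (biPolyEval s D.A D.B) = biPolyEval s (D.theta D.A) (D.theta D.B) := by
  refine D.theta_eq (commute_biPolyEval D.commute_A_G.symm D.commute_B_G.symm s).symm fun v => ?_
  exact congrArg (fun L : D.V →L[ℂ] K => L v)
    (comp_biPolyEval (D.T_theta D.commute_A_G) (D.T_theta D.commute_B_G) s)

theorem theta_mul {C C' : K →L[ℂ] K} (hC : Commute C D.G) (hC' : Commute C' D.G) :
    D.theta (C * C') = D.theta C * D.theta C' := by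
  refine D.theta_eq (hC.mul_left hC') fun v => ?_
  rw [mul_apply_eq_comp, mul_apply_eq_comp, D.T_theta_apply hC, D.T_theta_apply hC']

theorem commute_theta {C C' : K →L[ℂ] K} (hC : Commute C D.G) (hC' : Commute C' D.G)
    (h : Commute C C') : Commute (D.theta C) (D.theta C') := by
  rw [commute_iff_eq, ← D.theta_mul hC hC', h.eq, D.theta_mul hC' hC]

theorem theta_N : D.theta D.N = D.theta D.A + Complex.I • D.theta D.B := by
  refine D.theta_eq D.commute_N_G fun v => ?_
  rw [add_apply, smul_apply, map_add, map_smul, D.T_theta_apply D.commute_A_G,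
    D.T_theta_apply D.commute_B_G]
  conv_rhs => rw [N_eq]
  rfl

theorem isSelfAdjoint_theta_A : IsSelfAdjoint (D.theta D.A) := by
  rw [ContinuousLinearMap.isSelfAdjoint_iff', D.adjoint_theta D.commute_A_G, adj_A]

theorem isSelfAdjoint_theta_B : IsSelfAdjoint (D.theta D.B) := by
  rw [ContinuousLinearMap.isSelfAdjoint_iff', D.adjoint_theta D.commute_B_G, adj_B]

theorem commute_theta_A_B : Commute (D.theta D.A) (D.theta D.B) :=
  D.commute_theta D.commute_A_G D.commute_B_G D.commute_A_B

end DefinitizableNormal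

section NormalParts

variable {R : Type*} [CStarAlgebra R] {M a b : R}

theorem isStarNormal_of_eq_add_I_smul (ha : IsSelfAdjoint a) (hb : IsSelfAdjoint b)
    (hab : Commute a b) (hM : M = a + Complex.I • b) : IsStarNormal M := by
  have h : star M = a - Complex.I • b := by
    rw [hM, star_add, star_smul, ha.star_eq, hb.star_eq, Complex.star_def, Complex.conj_I, neg_smul,
      sub_eq_add_neg]
  refine ⟨?_⟩
  rw [h, hM]
  have h1 : Commute a (a + Complex.I • b) := (Commute.refl a).add_right (hab.smul_right _)
  have h2 : Commute b (a + Complex.I • b) := hab.symm.add_right ((Commute.refl b).smul_right _)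
  exact h1.sub_left (h2.smul_left _)

theorem eq_cfc_re_of_eq_add_I_smul (ha : IsSelfAdjoint a) (hb : IsSelfAdjoint b)
    (hab : Commute a b) (hM : M = a + Complex.I • b) : a = cfc (fun z => (z.re : ℂ)) M := by
  have hn : IsStarNormal M := isStarNormal_of_eq_add_I_smul ha hb hab hM
  have h : star M = a - Complex.I • b := by
    rw [hM, star_add, star_smul, ha.star_eq, hb.star_eq, Complex.star_def, Complex.conj_I, neg_smul,
      sub_eq_add_neg]
  have h1 : (fun z : ℂ => (z.re : ℂ)) = fun z => (1 / 2 : ℂ) • (z + star z) := by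
    funext z
    rw [Complex.star_def, Complex.add_conj]
    simp
  rw [h1, cfc_smul .., cfc_add .., cfc_star_id M, cfc_id' ℂ M, h, hM]
  have : a + Complex.I • b + (a - Complex.I • b) = (2 : ℂ) • a := by
    rw [two_smul]; abel
  rw [this, smul_smul]
  norm_num

theorem eq_cfc_im_of_eq_add_I_smul (ha : IsSelfAdjoint a) (hb : IsSelfAdjoint b)
    (hab : Commute a b) (hM : M = a + Complex.I • b) : b = cfc (fun z => (z.im : ℂ)) M := by
  have hn : IsStarNormal M := isStarNormal_of_eq_add_I_smul ha hb hab hM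
  have h : star M = a - Complex.I • b := by
    rw [hM, star_add, star_smul, ha.star_eq, hb.star_eq, Complex.star_def, Complex.conj_I, neg_smul,
      sub_eq_add_neg]
  have h1 : (fun z : ℂ => (z.im : ℂ)) = fun z => (1 / (2 * Complex.I) : ℂ) • (z - star z) := by
    funext z
    rw [Complex.star_def, Complex.sub_conj]
    simp only [smul_eq_mul, Complex.ofReal_mul, Complex.ofReal_ofNat]
    field_simp
  rw [h1, cfc_smul .., cfc_sub .., cfc_star_id M, cfc_id' ℂ M, h, hM]
  have : a + Complex.I • b - (a - Complex.I • b) = (2 * Complex.I) • b := by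
    rw [two_mul, add_smul]; abel
  rw [this, smul_smul]
  have : (1 / (2 * Complex.I)) * (2 * Complex.I) = 1 := by field_simp
  rw [this, one_smul]

end NormalParts

/-! ### The operators `R₁ R₁*` and `R₂ R₂*` -/

theorem inner_adjoint_comp_self {H H' : Type*} [NormedAddCommGroup H] [InnerProductSpace ℂ H]
    [CompleteSpace H] [NormedAddCommGroup H'] [InnerProductSpace ℂ H'] [CompleteSpace H']
    (U : H →L[ℂ] H') (v w : H) :
    inner ℂ v ((ContinuousLinearMap.adjoint U ∘L U) w) = inner ℂ (U v) (U w) := by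
  rw [ContinuousLinearMap.comp_apply, ContinuousLinearMap.adjoint_inner_right]

theorem isSelfAdjoint_of_inner_eq {H H' : Type*} [NormedAddCommGroup H] [InnerProductSpace ℂ H]
    [CompleteSpace H] [NormedAddCommGroup H'] [InnerProductSpace ℂ H']
    {X : H →L[ℂ] H} {U : H → H'} (h : ∀ v w, inner ℂ v (X w) = inner ℂ (U v) (U w)) :
    IsSelfAdjoint X := by
  rw [ContinuousLinearMap.isSelfAdjoint_iff']
  ext w
  refine ext_inner_left ℂ fun v => ?_
  rw [ContinuousLinearMap.adjoint_inner_right, h, ← inner_conj_symm, h, inner_conj_symm]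

namespace DefinitizableNormal

variable {K : Type*} [NormedAddCommGroup K] [InnerProductSpace ℂ K] [CompleteSpace K]
  {J : KreinStructure K} (D : DefinitizableNormal J)

theorem isStarNormal_theta_N : IsStarNormal (D.theta D.N) :=
  isStarNormal_of_eq_add_I_smul D.isSelfAdjoint_theta_A D.isSelfAdjoint_theta_B D.commute_theta_A_B
    D.theta_N

theorem biPolyEval_theta (s : MvPolynomial (Fin 2) ℂ) :
    biPolyEval s (D.theta D.A) (D.theta D.B) =
      cfc (fun z : ℂ => MvPolynomial.eval ![(z.re : ℂ), (z.im : ℂ)] s) (D.theta D.N) :=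
  biPolyEval_eq_cfc D.isStarNormal_theta_N
    (eq_cfc_re_of_eq_add_I_smul D.isSelfAdjoint_theta_A D.isSelfAdjoint_theta_B
      D.commute_theta_A_B D.theta_N)
    (eq_cfc_im_of_eq_add_I_smul D.isSelfAdjoint_theta_A D.isSelfAdjoint_theta_B
      D.commute_theta_A_B D.theta_N) s

theorem star_theta_N : star (D.theta D.N) = D.theta (J.adj D.N) := D.adjoint_theta D.commute_N_G

theorem inner_RR₁ (v w : D.V) : inner ℂ v (D.RR₁ w) = inner ℂ (D.R₁star v) (D.R₁star w) :=
  inner_adjoint_comp_self D.R₁star v w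

theorem inner_RR₂ (v w : D.V) : inner ℂ v (D.RR₂ w) = inner ℂ (D.R₂star v) (D.R₂star w) :=
  inner_adjoint_comp_self D.R₂star v w

theorem eq_of_forall_form_eq {x y : K} (h : ∀ z, J.form x z = J.form y z) : x = y := by
  have h1 : J.symm x = J.symm y := ext_inner_left ℂ h
  rw [← J.symm_symm x, h1, J.symm_symm]

/-- The operators `R₁ R₁*` and `R₂ R₂*` split `p(A) + q(B) = Ξ(1)` into its summands. -/
theorem xi_RR₁ : D.xi D.RR₁ = realPolyEval D.p D.A := by
  ext x
  refine eq_of_forall_form_eq (J := J) fun z => ?_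
  rw [xi_apply, form_T, inner_RR₁]
  refine (congrArg₂ (inner ℂ) (gramRestrict_gramEmbed _ _ _ _ _ z)
    (gramRestrict_gramEmbed _ _ _ _ _ x)).trans ?_
  exact inner_gramEmbed _ D.gramA_pos z x

theorem xi_RR₂ : D.xi D.RR₂ = realPolyEval D.q D.B := by
  ext x
  refine eq_of_forall_form_eq (J := J) fun z => ?_
  rw [xi_apply, form_T, inner_RR₂]
  refine (congrArg₂ (inner ℂ) (gramRestrict_gramEmbed _ _ _ _ _ z)
    (gramRestrict_gramEmbed _ _ _ _ _ x)).trans ?_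
  exact inner_gramEmbed _ D.gramB_pos z x

theorem xi_add (X Y : D.V →L[ℂ] D.V) : D.xi (X + Y) = D.xi X + D.xi Y := by
  ext x
  simp [xi_apply]

theorem xi_one : D.xi 1 = D.G := by
  ext x
  exact D.T_Tstar_apply x

theorem RR₁_add_RR₂ : D.RR₁ + D.RR₂ = 1 :=
  D.xi_injective (by rw [xi_add, xi_RR₁, xi_RR₂, xi_one, G])

theorem isSelfAdjoint_RR₁ : IsSelfAdjoint D.RR₁ := isSelfAdjoint_of_inner_eq D.inner_RR₁

theorem isSelfAdjoint_RR₂ : IsSelfAdjoint D.RR₂ := isSelfAdjoint_of_inner_eq D.inner_RR₂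

theorem RR₁_nonneg (v : D.V) : 0 ≤ (inner ℂ v (D.RR₁ v)).re := by
  rw [inner_RR₁]
  exact inner_self_nonneg (𝕜 := ℂ)

theorem RR₂_nonneg (v : D.V) : 0 ≤ (inner ℂ v (D.RR₂ v)).re := by
  rw [inner_RR₂]
  exact inner_self_nonneg (𝕜 := ℂ)

theorem commute_theta_RR₁ {C : K →L[ℂ] K} (hA : Commute C D.A) (hB : Commute C D.B) :
    Commute (D.theta C) D.RR₁ := by
  have hG := D.commute_G hA hB
  refine D.xi_injective ?_
  have h : Commute C (D.xi D.RR₁) := by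
    rw [xi_RR₁, realPolyEval_A]
    exact commute_biPolyEval hA hB _
  ext x
  rw [xi_apply, xi_apply, mul_apply_eq_comp, mul_apply_eq_comp, D.T_theta_apply hG,
    D.theta_Tstar hG]
  exact congrArg (fun L : K →L[ℂ] K => L x) h.eq

theorem commute_theta_RR₂ {C : K →L[ℂ] K} (hA : Commute C D.A) (hB : Commute C D.B) :
    Commute (D.theta C) D.RR₂ := by
  have h : D.RR₂ = 1 - D.RR₁ := by rw [← RR₁_add_RR₂, add_sub_cancel_left]
  rw [h]
  exact (Commute.one_right _).sub_right (D.commute_theta_RR₁ hA hB)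

/-- `T* T = Θ(p(A) + q(B))`. -/
theorem Tstar_T_apply (v : D.V) : D.Tstar (D.T v) = D.theta D.G v :=
  D.T_injective (by rw [T_Tstar_apply, D.T_theta_apply (Commute.refl _)])

theorem xi_mul_apply_T (X : D.V →L[ℂ] D.V) (v : D.V) :
    D.xi X (D.T v) = D.T (X (D.theta D.G v)) := by
  rw [xi_apply, Tstar_T_apply]

theorem RR₁_mul_theta_G : D.RR₁ * D.theta D.G = D.theta (realPolyEval D.p D.A) := by
  refine (D.theta_eq ?_ fun v => ?_).symm
  · rw [realPolyEval_A]
    exact (commute_biPolyEval D.commute_A_G.symm D.commute_B_G.symm _).symm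
  · rw [← xi_RR₁, xi_mul_apply_T]
    rfl

theorem RR₂_mul_theta_G : D.RR₂ * D.theta D.G = D.theta (realPolyEval D.q D.B) := by
  refine (D.theta_eq ?_ fun v => ?_).symm
  · rw [realPolyEval_B]
    exact (commute_biPolyEval D.commute_A_G.symm D.commute_B_G.symm _).symm
  · rw [← xi_RR₂, xi_mul_apply_T]
    rfl

theorem adj_xi (X : D.V →L[ℂ] D.V) : J.adj (D.xi X) = D.xi (ContinuousLinearMap.adjoint X) := by
  ext x
  refine eq_of_forall_form_eq (J := J) fun z => ?_
  have h : J.form (J.adj (D.xi X) x) z = J.form x (D.xi X z) := by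
    rw [J.form_adj, J.adj_adj]
  have h' : ∀ x y, J.form x y = conj (J.form y x) := fun x y => by
    rw [KreinStructure.form, KreinStructure.form, inner_conj_symm, J.inner_symm]
  rw [h, h', xi_apply, form_T, inner_conj_symm, xi_apply, form_T,
    ContinuousLinearMap.adjoint_inner_right]

theorem xi_mul_xi (X Y : D.V →L[ℂ] D.V) : D.xi X * D.xi Y = D.xi (X * D.theta D.G * Y) := by
  ext x
  rw [mul_apply_eq_comp, D.xi_apply Y, xi_mul_apply_T]
  rfl

theorem mul_xi {C : K →L[ℂ] K} (hC : Commute C D.G) (X : D.V →L[ℂ] D.V) :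
    C * D.xi X = D.xi (D.theta C * X) := by
  ext x
  rw [mul_apply_eq_comp, xi_apply, xi_apply, ← D.T_theta_apply hC]
  rfl

theorem xi_mul {C : K →L[ℂ] K} (hC : Commute C D.G) (X : D.V →L[ℂ] D.V) :
    D.xi X * C = D.xi (X * D.theta C) := by
  ext x
  rw [mul_apply_eq_comp, xi_apply, xi_apply, ← D.theta_Tstar hC]
  rfl

theorem adj_biPolyEval (s : MvPolynomial (Fin 2) ℂ) : J.adj (biPolyEval s D.A D.B) =
    biPolyEval (MvPolynomial.map (starRingEnd ℂ) s) D.A D.B := by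
  induction s using MvPolynomial.induction_on' with
  | add s t hs ht => rw [biPolyEval_add, J.adj_add, hs, ht, map_add, biPolyEval_add]
  | monomial m c =>
    rw [MvPolynomial.map_monomial, biPolyEval_monomial, biPolyEval_monomial, J.adj_smul, J.adj_mul,
      J.adj_pow D.adj_A, J.adj_pow D.adj_B, (D.commute_A_B.pow_pow _ _).eq]

end DefinitizableNormal

/-! ### Jet integrals -/

theorem isBddBorel_indicator {U : Set ℂ} (hU : MeasurableSet U) {g : ℂ → ℂ}
    (hg : Measurable fun z : ↥U => g z) (hb : ∃ C : ℝ, ∀ z ∈ U, ‖g z‖ ≤ C) :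
    IsBddBorel (U.indicator g) := by
  refine ⟨?_, ?_⟩
  · have h : U.indicator g = Function.extend Subtype.val (fun z : ↥U => g z) 0 := by
      funext z
      by_cases hz : z ∈ U
      · rw [Set.indicator_of_mem hz]
        exact (Subtype.val_injective.extend_apply (fun z : ↥U => g z) 0 ⟨z, hz⟩).symm
      · rw [Set.indicator_of_notMem hz, Function.extend_apply']
        · rfl
        · rintro ⟨a, rfl⟩
          exact hz a.2
    rw [h]
    exact (MeasurableEmbedding.subtype_coe hU).measurable_extend hg measurable_const
  · obtain ⟨C, hC⟩ := hb
    refine ⟨max C 0, fun z => ?_⟩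
    by_cases hz : z ∈ U
    · rw [Set.indicator_of_mem hz]
      exact (hC z hz).trans (le_max_left _ _)
    · rw [Set.indicator_of_notMem hz, norm_zero]
      exact le_max_right _ _

namespace SpectralMeasure

variable {H : Type*} [NormedAddCommGroup H] [InnerProductSpace ℂ H] [CompleteSpace H]
  {E : SpectralMeasure H} {f g : ℂ → ℂ}

theorem integral_mul_proj (hf : IsBddBorel f) {Δ : Set ℂ} (hΔ : MeasurableSet Δ) :
    E.integral f * E.proj Δ = E.integral (Δ.indicator f) := by
  rw [← integral_indicator_one hΔ, ← integral_mul hf ((IsBddBorel.const 1).indicator hΔ)]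
  congr 1
  funext z
  by_cases hz : z ∈ Δ <;> simp [hz]

theorem proj_mul_integral (hf : IsBddBorel f) {Δ : Set ℂ} (hΔ : MeasurableSet Δ) :
    E.proj Δ * E.integral f = E.integral (Δ.indicator f) := by
  rw [← integral_indicator_one hΔ, ← integral_mul ((IsBddBorel.const 1).indicator hΔ) hf]
  congr 1
  funext z
  by_cases hz : z ∈ Δ <;> simp [hz]

theorem commute_integral_proj (hf : IsBddBorel f) {Δ : Set ℂ} (hΔ : MeasurableSet Δ) :
    Commute (E.integral f) (E.proj Δ) :=
  (integral_mul_proj hf hΔ).trans (proj_mul_integral hf hΔ).symm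

theorem integral_mul_proj_singleton (hf : IsBddBorel f) (w : ℂ) :
    E.integral f * E.proj {w} = f w • E.proj {w} := by
  have hw : MeasurableSet ({w} : Set ℂ) := MeasurableSet.singleton w
  rw [integral_mul_proj hf hw, ← integral_indicator_one hw,
    ← integral_smul _ ((IsBddBorel.const 1).indicator hw)]
  congr 1
  funext z
  by_cases hz : z = w
  · subst hz
    simp
  · simp [hz]

theorem proj_mul_proj_eq_zero {Δ Δ' : Set ℂ} (hΔ : MeasurableSet Δ) (hΔ' : MeasurableSet Δ')
    (h : Disjoint Δ Δ') : E.proj Δ * E.proj Δ' = 0 := by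
  rw [← E.proj_inter _ _ hΔ hΔ', h.inter_eq, E.proj_empty]

theorem proj_mul_self {Δ : Set ℂ} (hΔ : MeasurableSet Δ) :
    E.proj Δ * E.proj Δ = E.proj Δ := by
  rw [← E.proj_inter _ _ hΔ hΔ, Set.inter_self]

theorem proj_union {Δ Δ' : Set ℂ} (hΔ : MeasurableSet Δ) (hΔ' : MeasurableSet Δ')
    (h : Disjoint Δ Δ') : E.proj (Δ ∪ Δ') = E.proj Δ + E.proj Δ' := by
  rw [← integral_indicator_one hΔ, ← integral_indicator_one hΔ',
    ← integral_indicator_one (hΔ.union hΔ'), ← integral_add ((IsBddBorel.const 1).indicator hΔ)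
      ((IsBddBorel.const 1).indicator hΔ')]
  congr 1
  exact Set.indicator_union_of_disjoint h _

/-- Two operators agree if they agree after multiplication by the projections of a set `U` and of
the points of a finite set `W`, where `U` and `W` carry the spectral measure. -/
theorem ext_of_mul_proj {U W : Set ℂ} (hU : MeasurableSet U) (hW : W.Finite) (hUW : Disjoint U W)
    (h0 : E.proj (U ∪ W)ᶜ = 0) {X Y : H →L[ℂ] H} (h1 : X * E.proj U = Y * E.proj U)
    (h2 : ∀ w ∈ W, X * E.proj {w} = Y * E.proj {w}) : X = Y := by
  have h3 : X * E.proj W = Y * E.proj W := by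
    clear h0 hUW
    induction W, hW using Set.Finite.induction_on with
    | empty => rw [proj_empty, mul_zero, mul_zero]
    | @insert a s ha hs ih =>
      rw [Set.insert_eq, proj_union (MeasurableSet.singleton a) hs.measurableSet
        (Set.disjoint_singleton_left.2 ha), mul_add, mul_add, h2 a (Set.mem_insert a s),
        ih fun w hw => h2 w (Set.mem_insert_of_mem a hw)]
  have h4 : E.proj U + E.proj W = 1 := by
    have h5 := proj_union (E := E) (hU.union hW.measurableSet) (hU.union hW.measurableSet).compl
      disjoint_compl_right
    rwa [Set.union_compl_self, E.proj_univ, h0, add_zero, proj_union hU hW.measurableSet hUW,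
      eq_comm] at h5
  rw [← mul_one X, ← mul_one Y, ← h4, mul_add, mul_add, h1, h3]

/-- The integral of `g` over `U` plus the sum of all `(g₁(w) R₁ + g₂(w) R₂) E{w}` over the points of
`W`. -/
def jetIntegral (E : SpectralMeasure H) (U W : Set ℂ) (R₁ R₂ : H →L[ℂ] H) (g g₁ g₂ : ℂ → ℂ) :
    H →L[ℂ] H :=
  E.integral (U.indicator g) + ∑ᶠ (w : ℂ) (_ : w ∈ W),
    (g₁ w • (R₁ * E.proj {w}) + g₂ w • (R₂ * E.proj {w}))

section JetIntegral

variable {U W : Set ℂ} {R₁ R₂ : H →L[ℂ] H} {g₁ g₂ : ℂ → ℂ}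

theorem jetIntegral_mul_proj (hU : MeasurableSet U) (hW : W.Finite) (hUW : Disjoint U W)
    (hg : IsBddBorel (U.indicator g)) :
    E.jetIntegral U W R₁ R₂ g g₁ g₂ * E.proj U = E.integral (U.indicator g) := by
  rw [jetIntegral, add_mul, integral_mul_proj hg hU, Set.indicator_indicator, Set.inter_self,
    finsum_mem_eq_finite_toFinset_sum _ hW, Finset.sum_mul, Finset.sum_eq_zero, add_zero]
  intro w hw
  have hw' : Disjoint {w} U :=
    Set.disjoint_singleton_left.2 fun h => Set.disjoint_left.1 hUW h (hW.mem_toFinset.1 hw)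
  rw [add_mul, smul_mul_assoc, smul_mul_assoc, mul_assoc, mul_assoc,
    proj_mul_proj_eq_zero (MeasurableSet.singleton w) hU hw']
  simp

theorem jetIntegral_mul_proj_singleton (hW : W.Finite) (hUW : Disjoint U W)
    (hg : IsBddBorel (U.indicator g)) {w : ℂ} (hw : w ∈ W) :
    E.jetIntegral U W R₁ R₂ g g₁ g₂ * E.proj {w} = (g₁ w • R₁ + g₂ w • R₂) * E.proj {w} := by
  have hwm : ∀ w : ℂ, MeasurableSet ({w} : Set ℂ) := MeasurableSet.singleton
  have hwU : w ∉ U := fun h => Set.disjoint_left.1 hUW h hw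
  rw [jetIntegral, add_mul, integral_mul_proj_singleton hg, Set.indicator_of_notMem hwU, zero_smul,
    zero_add, finsum_mem_eq_finite_toFinset_sum _ hW, Finset.sum_mul,
    Finset.sum_eq_single_of_mem w (hW.mem_toFinset.2 hw)]
  · rw [add_mul, smul_mul_assoc, smul_mul_assoc, mul_assoc, mul_assoc, proj_mul_self (hwm w),
      add_mul, smul_mul_assoc, smul_mul_assoc]
  · intro b _ hb
    rw [add_mul, smul_mul_assoc, smul_mul_assoc, mul_assoc, mul_assoc,
      proj_mul_proj_eq_zero (hwm b) (hwm w) (Set.disjoint_singleton.2 hb)]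
    simp

theorem commute_jetIntegral {C : H →L[ℂ] H} (hC : ∀ Δ, MeasurableSet Δ → Commute C (E.proj Δ))
    (h1 : Commute C R₁) (h2 : Commute C R₂) (hW : W.Finite) (hg : IsBddBorel (U.indicator g)) :
    Commute C (E.jetIntegral U W R₁ R₂ g g₁ g₂) := by
  rw [jetIntegral, finsum_mem_eq_finite_toFinset_sum _ hW]
  refine (commute_integral hC hg).add_right (Commute.sum_right _ _ _ fun w _ => ?_)
  have hw := hC _ (MeasurableSet.singleton w)
  exact ((h1.mul_right hw).smul_right _).add_right ((h2.mul_right hw).smul_right _)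

theorem adjoint_jetIntegral (hE₁ : ∀ Δ, MeasurableSet Δ → Commute R₁ (E.proj Δ))
    (hE₂ : ∀ Δ, MeasurableSet Δ → Commute R₂ (E.proj Δ)) (h1 : IsSelfAdjoint R₁)
    (h2 : IsSelfAdjoint R₂) (hW : W.Finite) (hg : IsBddBorel (U.indicator g)) :
    ContinuousLinearMap.adjoint (E.jetIntegral U W R₁ R₂ g g₁ g₂) =
      E.jetIntegral U W R₁ R₂ (fun z => conj (g z)) (fun z => conj (g₁ z))
        (fun z => conj (g₂ z)) := by
  rw [← ContinuousLinearMap.star_eq_adjoint, jetIntegral, jetIntegral, star_add,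
    finsum_mem_eq_finite_toFinset_sum _ hW, finsum_mem_eq_finite_toFinset_sum _ hW, star_sum]
  congr 1
  · rw [ContinuousLinearMap.star_eq_adjoint, ← integral_star hg]
    congr 1
    funext z
    by_cases hz : z ∈ U <;> simp [hz]
  · refine Finset.sum_congr rfl fun w _ => ?_
    have hw := MeasurableSet.singleton w
    have hs : star (E.proj {w}) = E.proj {w} := (E.isStarProjection _ hw).isSelfAdjoint.star_eq
    rw [star_add, star_smul, star_smul, star_mul, star_mul, h1.star_eq, h2.star_eq, hs,
      (hE₁ _ hw).eq, (hE₂ _ hw).eq]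
    rfl

end JetIntegral

end SpectralMeasure

/-! ### Splittings of a normal operator -/

/-- The values `p(Re z) + q(Im z)`. -/
def reImSum (p q : ℝ[X]) (z : ℂ) : ℝ := p.eval z.re + q.eval z.im

theorem continuous_eval_re (p : ℝ[X]) : Continuous fun z : ℂ => ((p.eval z.re : ℝ) : ℂ) :=
  Complex.continuous_ofReal.comp (p.continuous.comp Complex.continuous_re)

theorem continuous_eval_im (q : ℝ[X]) : Continuous fun z : ℂ => ((q.eval z.im : ℝ) : ℂ) :=
  Complex.continuous_ofReal.comp (q.continuous.comp Complex.continuous_im)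

theorem continuous_reImSum (p q : ℝ[X]) : Continuous fun z : ℂ => (reImSum p q z : ℂ) := by
  simp only [reImSum, Complex.ofReal_add]
  exact (continuous_eval_re p).add (continuous_eval_im q)

/-- Positive operators `R₁`, `R₂` with sum `1` which commute with the normal operator `M` and split
`p(Re M) + q(Im M)` into its summands `p(Re M)` and `q(Im M)`. The operators `R₁ R₁*`, `R₂ R₂*` and
`Θ(N)` are of this kind. -/
structure IsNormalSplitting {H : Type*} [NormedAddCommGroup H] [InnerProductSpace ℂ H]
    [CompleteSpace H] (p q : ℝ[X]) (M R₁ R₂ : H →L[ℂ] H) : Prop where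
  normal : IsStarNormal M
  isSelfAdjoint_fst : IsSelfAdjoint R₁
  isSelfAdjoint_snd : IsSelfAdjoint R₂
  nonneg_fst : ∀ v, 0 ≤ (inner ℂ v (R₁ v)).re
  nonneg_snd : ∀ v, 0 ≤ (inner ℂ v (R₂ v)).re
  add_eq_one : R₁ + R₂ = 1
  commute_fst : Commute M R₁
  mul_fst : R₁ * cfc (fun z => (reImSum p q z : ℂ)) M = cfc (fun z => ((p.eval z.re : ℝ) : ℂ)) M
  mul_snd : R₂ * cfc (fun z => (reImSum p q z : ℂ)) M = cfc (fun z => ((q.eval z.im : ℝ) : ℂ)) M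

section Contraction

variable {H : Type*} [NormedAddCommGroup H] [InnerProductSpace ℂ H] [CompleteSpace H]

theorem nonneg_of_isSelfAdjoint {X : H →L[ℂ] H} (h : IsSelfAdjoint X)
    (h0 : ∀ v, 0 ≤ (inner ℂ v (X v)).re) : 0 ≤ X := by
  rw [ContinuousLinearMap.nonneg_iff_isPositive]
  have hs : ∀ v w, inner ℂ (X v) w = inner ℂ v (X w) := fun v w => by
    conv_rhs => rw [← h.adjoint_eq]
    rw [ContinuousLinearMap.adjoint_inner_right]
  refine ⟨fun v w => hs v w, fun v => ?_⟩
  rw [ContinuousLinearMap.reApplyInnerSelf_apply, hs]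
  exact h0 v

theorem norm_apply_le_of_add_eq_one {X Y : H →L[ℂ] H} (hX : IsSelfAdjoint X)
    (hY : IsSelfAdjoint Y) (hX0 : ∀ v, 0 ≤ (inner ℂ v (X v)).re)
    (hY0 : ∀ v, 0 ≤ (inner ℂ v (Y v)).re) (h : X + Y = 1) (v : H) : ‖X v‖ ≤ ‖v‖ := by
  have h1 : X ≤ 1 := by
    rw [← h]
    exact le_add_of_nonneg_right (nonneg_of_isSelfAdjoint hY hY0)
  have h2 : ‖X‖ ≤ 1 :=
    (CStarAlgebra.norm_le_one_iff_of_nonneg X (nonneg_of_isSelfAdjoint hX hX0)).2 h1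
  simpa using X.le_of_opNorm_le h2 v

open scoped ComplexOrder in
/-- If `f(M) = X g(M)` with a contraction `X`, then `|f| ≤ |g|` on the spectrum. -/
theorem norm_le_of_cfc_eq_mul {M X : H →L[ℂ] H} (hM : IsStarNormal M) {f g : ℂ → ℂ}
    (hf : Continuous f) (hg : Continuous g) (hX : ∀ v, ‖X v‖ ≤ ‖v‖)
    (h : X * cfc g M = cfc f M) {z : ℂ} (hz : z ∈ spectrum ℂ M) : ‖f z‖ ≤ ‖g z‖ := by
  have hsq : cfc (fun z => star (g z) * g z - star (f z) * f z) M =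
      star (cfc g M) * cfc g M - star (cfc f M) * cfc f M := by
    rw [cfc_sub .., cfc_mul .., cfc_mul .., cfc_star, cfc_star]
  have h0 : 0 ≤ cfc (fun z => star (g z) * g z - star (f z) * f z) M := by
    rw [hsq]
    refine nonneg_of_isSelfAdjoint
      ((IsSelfAdjoint.star_mul_self _).sub (IsSelfAdjoint.star_mul_self _)) fun v => ?_
    rw [sub_apply, inner_sub_right, mul_apply_eq_comp, mul_apply_eq_comp,
      ContinuousLinearMap.star_eq_adjoint, ContinuousLinearMap.star_eq_adjoint,
      ContinuousLinearMap.adjoint_inner_right, ContinuousLinearMap.adjoint_inner_right,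
      inner_self_eq_norm_sq_to_K, inner_self_eq_norm_sq_to_K]
    -- positivity of `g(M)* g(M) - f(M)* f(M)`
    have h1 : ‖cfc f M v‖ ≤ ‖cfc g M v‖ := by
      rw [← h]
      exact hX _
    have h2 : ‖cfc f M v‖ ^ 2 ≤ ‖cfc g M v‖ ^ 2 := by gcongr
    have h3 : (((‖cfc g M v‖ : ℂ)) ^ 2 - ((‖cfc f M v‖ : ℂ)) ^ 2).re =
        ‖cfc g M v‖ ^ 2 - ‖cfc f M v‖ ^ 2 := by norm_cast
    exact h3 ▸ sub_nonneg.2 h2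
  have hc : Continuous fun z => star (g z) * g z - star (f z) * f z := by fun_prop
  have h4 := (cfc_nonneg_iff _ M hc.continuousOn).1 h0 z hz
  rw [Complex.star_def, Complex.conj_mul', Complex.conj_mul'] at h4
  have h5 : ‖f z‖ ^ 2 ≤ ‖g z‖ ^ 2 := by
    have h6 := sub_nonneg.1 h4
    exact_mod_cast h6
  exact le_of_sq_le_sq h5 (norm_nonneg _)

end Contraction

namespace IsNormalSplitting

variable {H : Type*} [NormedAddCommGroup H] [InnerProductSpace ℂ H] [CompleteSpace H]
  {p q : ℝ[X]} {M R₁ R₂ : H →L[ℂ] H} {E : SpectralMeasure H}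

theorem commute_snd (h : IsNormalSplitting p q M R₁ R₂) : Commute M R₂ := by
  have h1 : R₂ = 1 - R₁ := by rw [← h.add_eq_one, add_sub_cancel_left]
  rw [h1]
  exact (Commute.one_right _).sub_right h.commute_fst

theorem abs_eval_re_le (h : IsNormalSplitting p q M R₁ R₂) {z : ℂ} (hz : z ∈ spectrum ℂ M) :
    |p.eval z.re| ≤ |reImSum p q z| := by
  have h1 := norm_le_of_cfc_eq_mul h.normal (continuous_eval_re p) (continuous_reImSum p q)
    (norm_apply_le_of_add_eq_one h.isSelfAdjoint_fst h.isSelfAdjoint_snd h.nonneg_fst h.nonneg_snd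
      h.add_eq_one) h.mul_fst hz
  simpa only [Complex.norm_real, Real.norm_eq_abs] using h1

theorem abs_eval_im_le (h : IsNormalSplitting p q M R₁ R₂) {z : ℂ} (hz : z ∈ spectrum ℂ M) :
    |q.eval z.im| ≤ |reImSum p q z| := by
  have h1 := norm_le_of_cfc_eq_mul h.normal (continuous_eval_im q) (continuous_reImSum p q)
    (norm_apply_le_of_add_eq_one h.isSelfAdjoint_snd h.isSelfAdjoint_fst h.nonneg_snd h.nonneg_fst
      (by rw [add_comm, h.add_eq_one])) h.mul_snd hz
  simpa only [Complex.norm_real, Real.norm_eq_abs] using h1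

/-- On the spectrum, `p(Re z) + q(Im z)` vanishes only if both summands do. -/
theorem reImSum_ne_zero (h : IsNormalSplitting p q M R₁ R₂) {z : ℂ}
    (hz : z ∈ spectrum ℂ M \ realZeros p q) : reImSum p q z ≠ 0 := by
  intro h0
  have h1 := h.abs_eval_re_le hz.1
  have h2 := h.abs_eval_im_le hz.1
  rw [h0, abs_zero] at h1 h2
  exact hz.2 ⟨abs_nonpos_iff.1 h1, abs_nonpos_iff.1 h2⟩

theorem commute_star_fst (h : IsNormalSplitting p q M R₁ R₂) : Commute (star M) R₁ := by
  have h1 := h.commute_fst.star_star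
  rwa [h.isSelfAdjoint_fst.star_eq] at h1

theorem commute_star_snd (h : IsNormalSplitting p q M R₁ R₂) : Commute (star M) R₂ := by
  have h1 := h.commute_snd.star_star
  rwa [h.isSelfAdjoint_snd.star_eq] at h1

theorem commute_proj_fst (h : IsNormalSplitting p q M R₁ R₂) (hE : E.IsSpectralMeasureOf M)
    (Δ : Set ℂ) (hΔ : MeasurableSet Δ) : Commute R₁ (E.proj Δ) :=
  hE.commute_proj h.normal h.commute_fst h.commute_star_fst hΔ

theorem commute_proj_snd (h : IsNormalSplitting p q M R₁ R₂) (hE : E.IsSpectralMeasureOf M)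
    (Δ : Set ℂ) (hΔ : MeasurableSet Δ) : Commute R₂ (E.proj Δ) :=
  hE.commute_proj h.normal h.commute_snd h.commute_star_snd hΔ

end IsNormalSplitting

/-! ### The calculus of jet integrals -/

theorem finite_realZeros {p q : ℝ[X]} (hp : p ≠ 0) (hq : q ≠ 0) : (realZeros p q).Finite := by
  have h1 : {x : ℝ | p.eval x = 0}.Finite := Polynomial.finite_setOfPred_isRoot hp
  have h2 : {x : ℝ | q.eval x = 0}.Finite := Polynomial.finite_setOfPred_isRoot hq
  refine ((h1.prod h2).preimage (f := fun z : ℂ => (z.re, z.im)) ?_).subset fun z hz => hz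
  intro z _ w _ hzw
  exact Complex.ext (congrArg Prod.fst hzw) (congrArg Prod.snd hzw)

namespace SpectralMeasure

variable {H : Type*} [NormedAddCommGroup H] [InnerProductSpace ℂ H] [CompleteSpace H]
  {E : SpectralMeasure H} {M : H →L[ℂ] H} {f g : ℂ → ℂ}

theorem IsSpectralMeasureOf.cfc_eq (hE : E.IsSpectralMeasureOf M) (hM : IsStarNormal M)
    (hf : Continuous f) : cfc f M = E.integral ((spectrum ℂ M).indicator f) := by
  rw [← hE.integral_eq_cfc hM hf.continuousOn]
  exact hE.integral_congr fun z hz => by rw [Set.indicator_of_mem hz]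

theorem isBddBorel_spectrum_indicator (hf : Continuous f) :
    IsBddBorel ((spectrum ℂ M).indicator f) :=
  IsBddBorel.indicator_of_continuousOn (spectrum.isCompact M) hf.continuousOn

theorem IsSpectralMeasureOf.cfc_mul_proj_singleton (hE : E.IsSpectralMeasureOf M)
    (hM : IsStarNormal M) (hf : Continuous f) {w : ℂ} (hw : w ∈ spectrum ℂ M) :
    cfc f M * E.proj {w} = f w • E.proj {w} := by
  rw [hE.cfc_eq hM hf, integral_mul_proj_singleton (isBddBorel_spectrum_indicator hf),
    Set.indicator_of_mem hw]

theorem isBddBorel_indicator_mul {U : Set ℂ} (hU : U ⊆ spectrum ℂ M) (hf : Continuous f)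
    (hg : IsBddBorel (U.indicator g)) : IsBddBorel (U.indicator fun z => f z * g z) := by
  have h : (U.indicator fun z => f z * g z) =
      fun z => (spectrum ℂ M).indicator f z * U.indicator g z := by
    funext z
    by_cases hz : z ∈ U
    · simp [hz, hU hz]
    · simp [hz]
  rw [h]
  exact (isBddBorel_spectrum_indicator hf).mul hg

theorem IsSpectralMeasureOf.cfc_mul_integral (hE : E.IsSpectralMeasureOf M)
    (hM : IsStarNormal M) {U : Set ℂ} (hU : U ⊆ spectrum ℂ M) (hf : Continuous f)
    (hg : IsBddBorel (U.indicator g)) :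
    cfc f M * E.integral (U.indicator g) = E.integral (U.indicator fun z => f z * g z) := by
  rw [hE.cfc_eq hM hf, ← integral_mul (isBddBorel_spectrum_indicator hf) hg]
  congr 1
  funext z
  by_cases hz : z ∈ U
  · simp [hz, hU hz]
  · simp [hz]

theorem integral_indicator_mul {U : Set ℂ} (hf : IsBddBorel (U.indicator f))
    (hg : IsBddBorel (U.indicator g)) :
    E.integral (U.indicator f) * E.integral (U.indicator g) =
      E.integral (U.indicator fun z => f z * g z) := by
  rw [← integral_mul hf hg]
  congr 1
  funext z
  by_cases hz : z ∈ U <;> simp [hz]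

theorem integral_indicator_add {U : Set ℂ} (hf : IsBddBorel (U.indicator f))
    (hg : IsBddBorel (U.indicator g)) :
    E.integral (U.indicator f) + E.integral (U.indicator g) =
      E.integral (U.indicator fun z => f z + g z) := by
  rw [← integral_add hf hg]
  congr 1
  funext z
  by_cases hz : z ∈ U <;> simp [hz]

theorem integral_indicator_congr {U : Set ℂ} (h : ∀ z ∈ U, f z = g z) :
    E.integral (U.indicator f) = E.integral (U.indicator g) := by
  rw [Set.indicator_congr h]

theorem _root_.IsBddBorel.indicator_mul {U : Set ℂ} (hf : IsBddBorel (U.indicator f))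
    (hg : IsBddBorel (U.indicator g)) : IsBddBorel (U.indicator fun z => f z * g z) := by
  have h : (U.indicator fun z => f z * g z) = fun z => U.indicator f z * U.indicator g z := by
    funext z
    by_cases hz : z ∈ U <;> simp [hz]
  rw [h]
  exact hf.mul hg

theorem _root_.IsBddBorel.indicator_add {U : Set ℂ} (hf : IsBddBorel (U.indicator f))
    (hg : IsBddBorel (U.indicator g)) : IsBddBorel (U.indicator fun z => f z + g z) := by
  have h : (U.indicator fun z => f z + g z) = fun z => U.indicator f z + U.indicator g z := by
    funext z
    by_cases hz : z ∈ U <;> simp [hz]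
  rw [h]
  exact hf.add hg

end SpectralMeasure

namespace IsNormalSplitting

open SpectralMeasure

variable {H : Type*} [NormedAddCommGroup H] [InnerProductSpace ℂ H] [CompleteSpace H]
  {p q : ℝ[X]} {M R₁ R₂ : H →L[ℂ] H} {E : SpectralMeasure H}

theorem measurableSet_off (hp : p ≠ 0) (hq : q ≠ 0) :
    MeasurableSet (spectrum ℂ M \ realZeros p q) :=
  measurableSet_spectrum.diff (finite_realZeros hp hq).measurableSet

theorem finite_at (hp : p ≠ 0) (hq : q ≠ 0) : (spectrum ℂ M ∩ realZeros p q).Finite :=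
  (finite_realZeros hp hq).subset Set.inter_subset_right

theorem disjoint_off_at : Disjoint (spectrum ℂ M \ realZeros p q) (spectrum ℂ M ∩ realZeros p q) :=
  Set.disjoint_sdiff_inter

/-- The operator `∫ g dE + ∑ (g₁(w) R₁ + g₂(w) R₂) E{w}` for a normal splitting, the integral being
over the points of the spectrum which are no zeros and the sum over those which are. -/
def jet (p q : ℝ[X]) (M R₁ R₂ : H →L[ℂ] H) (E : SpectralMeasure H) (g g₁ g₂ : ℂ → ℂ) :
    H →L[ℂ] H :=
  E.jetIntegral (spectrum ℂ M \ realZeros p q) (spectrum ℂ M ∩ realZeros p q) R₁ R₂ g g₁ g₂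

theorem ext_of_mul_proj (hp : p ≠ 0) (hq : q ≠ 0) (hE : E.IsSpectralMeasureOf M)
    {X Y : H →L[ℂ] H}
    (h1 : X * E.proj (spectrum ℂ M \ realZeros p q) = Y * E.proj (spectrum ℂ M \ realZeros p q))
    (h2 : ∀ w ∈ spectrum ℂ M ∩ realZeros p q, X * E.proj {w} = Y * E.proj {w}) : X = Y := by
  refine SpectralMeasure.ext_of_mul_proj (measurableSet_off hp hq) (finite_at hp hq)
    disjoint_off_at ?_ h1 h2
  rw [Set.sdiff_union_inter]
  exact hE.1

variable {f f₁ f₂ g g₁ g₂ k k₁ k₂ s t : ℂ → ℂ}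

theorem jet_mul_proj (hp : p ≠ 0) (hq : q ≠ 0)
    (hg : IsBddBorel ((spectrum ℂ M \ realZeros p q).indicator g)) :
    jet p q M R₁ R₂ E g g₁ g₂ * E.proj (spectrum ℂ M \ realZeros p q) =
      E.integral ((spectrum ℂ M \ realZeros p q).indicator g) :=
  jetIntegral_mul_proj (measurableSet_off hp hq) (finite_at hp hq) disjoint_off_at hg

theorem jet_mul_proj_singleton (hp : p ≠ 0) (hq : q ≠ 0)
    (hg : IsBddBorel ((spectrum ℂ M \ realZeros p q).indicator g)) {w : ℂ}
    (hw : w ∈ spectrum ℂ M ∩ realZeros p q) :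
    jet p q M R₁ R₂ E g g₁ g₂ * E.proj {w} = (g₁ w • R₁ + g₂ w • R₂) * E.proj {w} :=
  jetIntegral_mul_proj_singleton (finite_at hp hq) disjoint_off_at hg hw

theorem commute_jet (hM : IsStarNormal M) (hE : E.IsSpectralMeasureOf M) (hp : p ≠ 0) (hq : q ≠ 0)
    {C : H →L[ℂ] H} (h : Commute M C) (h' : Commute (star M) C)
    (h1 : Commute C R₁) (h2 : Commute C R₂)
    (hg : IsBddBorel ((spectrum ℂ M \ realZeros p q).indicator g)) :
    Commute C (jet p q M R₁ R₂ E g g₁ g₂) :=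
  commute_jetIntegral (fun _ hΔ => hE.commute_proj hM h h' hΔ) h1 h2 (finite_at hp hq) hg

theorem jet_zero : jet p q M R₁ R₂ E (fun _ => 0) (fun _ => 0) (fun _ => 0) = 0 := by
  rw [jet, jetIntegral]
  have h : (spectrum ℂ M \ realZeros p q).indicator (fun _ => (0 : ℂ)) = fun _ => 0 := by
    funext z
    simp
  rw [h, integral_const]
  simp

theorem adjoint_jet (h : IsNormalSplitting p q M R₁ R₂) (hE : E.IsSpectralMeasureOf M)
    (hp : p ≠ 0) (hq : q ≠ 0)
    (hg : IsBddBorel ((spectrum ℂ M \ realZeros p q).indicator g)) :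
    ContinuousLinearMap.adjoint (jet p q M R₁ R₂ E g g₁ g₂) =
      jet p q M R₁ R₂ E (fun z => conj (g z)) (fun z => conj (g₁ z)) (fun z => conj (g₂ z)) :=
  adjoint_jetIntegral (h.commute_proj_fst hE) (h.commute_proj_snd hE) h.isSelfAdjoint_fst
    h.isSelfAdjoint_snd (finite_at hp hq) hg

theorem jet_add (hE : E.IsSpectralMeasureOf M) (hp : p ≠ 0) (hq : q ≠ 0)
    (hf : IsBddBorel ((spectrum ℂ M \ realZeros p q).indicator f))
    (hg : IsBddBorel ((spectrum ℂ M \ realZeros p q).indicator g)) :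
    jet p q M R₁ R₂ E (fun z => f z + g z) (fun z => f₁ z + g₁ z) (fun z => f₂ z + g₂ z) =
      jet p q M R₁ R₂ E f f₁ f₂ + jet p q M R₁ R₂ E g g₁ g₂ := by
  refine ext_of_mul_proj hp hq hE ?_ fun w hw => ?_
  · rw [add_mul, jet_mul_proj hp hq hf, jet_mul_proj hp hq hg, jet_mul_proj hp hq
      (hf.indicator_add hg), integral_indicator_add hf hg]
  · rw [add_mul, jet_mul_proj_singleton hp hq hf hw, jet_mul_proj_singleton hp hq hg hw,
      jet_mul_proj_singleton hp hq (hf.indicator_add hg) hw, ← add_mul]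
    congr 1
    module

theorem commute_jet_proj (h : IsNormalSplitting p q M R₁ R₂) (hE : E.IsSpectralMeasureOf M)
    (hp : p ≠ 0) (hq : q ≠ 0) (hg : IsBddBorel ((spectrum ℂ M \ realZeros p q).indicator g))
    {Δ : Set ℂ} (hΔ : MeasurableSet Δ) :
    Commute (jet p q M R₁ R₂ E g g₁ g₂) (E.proj Δ) := by
  refine hE.commute_proj h.normal ?_ ?_ hΔ
  · exact commute_jet h.normal hE hp hq (Commute.refl _) h.normal.star_comm_self
      h.commute_fst h.commute_snd hg
  · exact commute_jet h.normal hE hp hq h.normal.star_comm_self.symm (Commute.refl _)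
      h.commute_star_fst h.commute_star_snd hg

/-- The product rule for jet integrals. Off the zeros it is the multiplicativity of the integral;
at a zero `w` the last summand does not contribute, since `p(Re w) + q(Im w) = 0`. -/
theorem jet_mul (h : IsNormalSplitting p q M R₁ R₂) (hE : E.IsSpectralMeasureOf M)
    (hp : p ≠ 0) (hq : q ≠ 0) (hs : Continuous s) (ht : Continuous t)
    (hf : IsBddBorel ((spectrum ℂ M \ realZeros p q).indicator f))
    (hg : IsBddBorel ((spectrum ℂ M \ realZeros p q).indicator g)) :
    jet p q M R₁ R₂ E (fun z => s z * f z + t z * g z + reImSum p q z * (g z * f z))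
      (fun z => s z * f₁ z + t z * g₁ z) (fun z => s z * f₂ z + t z * g₂ z) =
      cfc s M * jet p q M R₁ R₂ E f f₁ f₂ + cfc t M * jet p q M R₁ R₂ E g g₁ g₂ +
        jet p q M R₁ R₂ E g g₁ g₂ * cfc (fun z => (reImSum p q z : ℂ)) M *
          jet p q M R₁ R₂ E f f₁ f₂ := by
  have hUS : spectrum ℂ M \ realZeros p q ⊆ spectrum ℂ M := Set.sdiff_subset
  have hU := measurableSet_off (M := M) hp hq
  have hsf := isBddBorel_indicator_mul hUS hs hf
  have htg := isBddBorel_indicator_mul hUS ht hg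
  have hgf := hg.indicator_mul hf
  have hrgf := isBddBorel_indicator_mul hUS (continuous_reImSum p q) hgf
  have hall := (hsf.indicator_add htg).indicator_add hrgf
  have hrf := isBddBorel_indicator_mul hUS (continuous_reImSum p q) hf
  refine ext_of_mul_proj hp hq hE ?_ fun w hw => ?_
  · set U := spectrum ℂ M \ realZeros p q with hUdef
    have e1 : jet p q M R₁ R₂ E g g₁ g₂ * cfc (fun z => (reImSum p q z : ℂ)) M *
        jet p q M R₁ R₂ E f f₁ f₂ * E.proj U =
        E.integral (U.indicator fun z => reImSum p q z * (g z * f z)) := by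
      have e2 : cfc (fun z => (reImSum p q z : ℂ)) M * E.integral (U.indicator f) =
          E.proj U * (cfc (fun z => (reImSum p q z : ℂ)) M * E.integral (U.indicator f)) := by
        rw [hE.cfc_mul_integral h.normal hUS (continuous_reImSum p q) hf,
          proj_mul_integral hrf hU, Set.indicator_indicator, Set.inter_self]
      rw [mul_assoc, jet_mul_proj hp hq hf, mul_assoc, e2, ← mul_assoc, jet_mul_proj hp hq hg,
        hE.cfc_mul_integral h.normal hUS (continuous_reImSum p q) hf,
        integral_indicator_mul hg hrf]
      exact integral_indicator_congr fun z _ => by ring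
    rw [add_mul, add_mul, e1, mul_assoc, mul_assoc, jet_mul_proj hp hq hf, jet_mul_proj hp hq hg,
      jet_mul_proj hp hq hall, hE.cfc_mul_integral h.normal hUS hs hf,
      hE.cfc_mul_integral h.normal hUS ht hg, integral_indicator_add hsf htg,
      integral_indicator_add (hsf.indicator_add htg) hrgf]
  · have hws := MeasurableSet.singleton w
    have hr : reImSum p q w = 0 := by rw [reImSum, hw.2.1, hw.2.2, add_zero]
    have e1 : jet p q M R₁ R₂ E g g₁ g₂ * cfc (fun z => (reImSum p q z : ℂ)) M *
        jet p q M R₁ R₂ E f f₁ f₂ * E.proj {w} = 0 := by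
      rw [mul_assoc, (h.commute_jet_proj hE hp hq hf hws).eq, mul_assoc,
        ← mul_assoc (cfc _ M), hE.cfc_mul_proj_singleton h.normal (continuous_reImSum p q) hw.1, hr]
      simp
    have e2 : ∀ (u : ℂ → ℂ) (X : H →L[ℂ] H), Continuous u → Commute X (E.proj {w}) →
        cfc u M * (X * E.proj {w}) = u w • (X * E.proj {w}) := by
      intro u X hu hX
      rw [hX.eq, ← mul_assoc, hE.cfc_mul_proj_singleton h.normal hu hw.1, smul_mul_assoc]
    have e3 : ∀ a b : ℂ, Commute (a • R₁ + b • R₂) (E.proj {w}) := fun a b =>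
      ((h.commute_proj_fst hE _ hws).smul_left a).add_left
        ((h.commute_proj_snd hE _ hws).smul_left b)
    rw [add_mul, add_mul, e1, add_zero, mul_assoc, mul_assoc,
      jet_mul_proj_singleton hp hq hf hw, jet_mul_proj_singleton hp hq hg hw,
      jet_mul_proj_singleton hp hq hall hw, e2 s _ hs (e3 _ _), e2 t _ ht (e3 _ _),
      ← smul_mul_assoc, ← smul_mul_assoc, ← add_mul]
    congr 1
    module

theorem isBddBorel_div (hp : p ≠ 0) (hq : q ≠ 0)
    {u : ℂ → ℂ} (hu : Continuous u) (hle : ∀ z ∈ spectrum ℂ M, ‖u z‖ ≤ |reImSum p q z|) :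
    IsBddBorel ((spectrum ℂ M \ realZeros p q).indicator fun z => u z / reImSum p q z) := by
  refine isBddBorel_indicator (measurableSet_off hp hq) ?_ ⟨1, fun z hz => ?_⟩
  · exact (hu.measurable.div (continuous_reImSum p q).measurable).comp measurable_subtype_coe
  · rw [norm_div, Complex.norm_real, Real.norm_eq_abs]
    exact div_le_one_of_le₀ (hle z hz.1) (abs_nonneg _)

/-- Off the zeros, the equation `X (p(Re M) + q(Im M)) = u(M)` determines `X`, since `p(Re z) +
q(Im z)` does not vanish there. -/
theorem mul_proj_eq_integral_div (h : IsNormalSplitting p q M R₁ R₂)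
    (hE : E.IsSpectralMeasureOf M) (hp : p ≠ 0) (hq : q ≠ 0) {u : ℂ → ℂ} {X : H →L[ℂ] H}
    (hu : Continuous u) (hle : ∀ z ∈ spectrum ℂ M, ‖u z‖ ≤ |reImSum p q z|)
    (hXE : ∀ Δ, MeasurableSet Δ → Commute X (E.proj Δ))
    (hX : X * cfc (fun z => (reImSum p q z : ℂ)) M = cfc u M) :
    X * E.proj (spectrum ℂ M \ realZeros p q) =
      E.integral ((spectrum ℂ M \ realZeros p q).indicator fun z => u z / reImSum p q z) := by
  have hUS : spectrum ℂ M \ realZeros p q ⊆ spectrum ℂ M := Set.sdiff_subset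
  have hU := measurableSet_off (M := M) hp hq
  have hdiv := isBddBorel_div hp hq hu hle
  set U := spectrum ℂ M \ realZeros p q with hUdef
  set r : ℂ → ℂ := fun z => (reImSum p q z : ℂ) with hr
  have hrU : IsBddBorel (U.indicator r) := by
    have h1 := isBddBorel_indicator_mul hUS (continuous_reImSum p q)
      ((IsBddBorel.const 1).indicator hU)
    simpa only [mul_one] using h1
  have hru : ∀ v : ℂ → ℂ, Continuous v →
      cfc v M * E.proj U = E.integral (U.indicator v) := fun v hv => by
    rw [← integral_indicator_one hU,
      hE.cfc_mul_integral h.normal hUS hv ((IsBddBorel.const 1).indicator hU)]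
    simp only [mul_one]
  -- the difference `Y` of both sides is annihilated by the integral of a nonvanishing function
  set Y := X * E.proj U - E.integral (U.indicator fun z => u z / reImSum p q z) with hY
  have hYI : Commute Y (E.integral (U.indicator r)) := by
    refine Commute.sub_left (Commute.mul_left ?_ ?_) ?_
    · exact commute_integral hXE hrU
    · exact (commute_integral_proj hrU hU).symm
    · rw [commute_iff_eq, integral_indicator_mul hdiv hrU, integral_indicator_mul hrU hdiv]
      exact integral_indicator_congr fun z _ => mul_comm _ _
  have h0 : E.integral (U.indicator r) * Y = 0 := by
    rw [← hYI.eq, hY, sub_mul, integral_indicator_mul hdiv hrU, mul_assoc,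
      (commute_integral_proj hrU hU).symm.eq, integral_mul_proj hrU hU, Set.indicator_indicator,
      Set.inter_self, ← hru r (continuous_reImSum p q), ← mul_assoc, hX, hru u hu, sub_eq_zero]
    refine integral_indicator_congr fun z hz => ?_
    have hz0 : (reImSum p q z : ℂ) ≠ 0 := Complex.ofReal_ne_zero.2 (h.reImSum_ne_zero hz)
    rw [div_mul_cancel₀ _ hz0]
  have hsupp : Function.support (U.indicator r) = U := by
    ext z
    rw [Function.mem_support, ne_eq, Set.indicator_apply_eq_zero, Classical.not_imp]
    exact ⟨fun hz => hz.1, fun hz => ⟨hz, Complex.ofReal_ne_zero.2 (h.reImSum_ne_zero hz)⟩⟩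
  have h1 : E.proj U * Y = 0 := by
    ext v
    have h2 := proj_support_apply_eq_zero hrU
      (x := Y v) (congrArg (fun L : H →L[ℂ] H => L v) h0)
    rw [hsupp] at h2
    exact h2
  have h2 : E.proj U * Y = Y := by
    rw [hY, mul_sub, proj_mul_integral hdiv hU, Set.indicator_indicator, Set.inter_self,
      (hXE U hU).eq, ← mul_assoc, proj_mul_self hU]
  exact sub_eq_zero.1 (h2.symm.trans h1)

/-- Two jet integrals whose densities differ by the quotient of `u p + v q` by `p + q` differ by
`u(M) R₁ + v(M) R₂`. -/
theorem jet_eq_add (h : IsNormalSplitting p q M R₁ R₂) (hE : E.IsSpectralMeasureOf M)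
    (hp : p ≠ 0) (hq : q ≠ 0) {u v : ℂ → ℂ} (hu : Continuous u) (hv : Continuous v)
    (hf : IsBddBorel ((spectrum ℂ M \ realZeros p q).indicator f))
    (hg : IsBddBorel ((spectrum ℂ M \ realZeros p q).indicator g))
    (h0 : ∀ z ∈ spectrum ℂ M \ realZeros p q,
      reImSum p q z * f z = reImSum p q z * g z + (u z * p.eval z.re + v z * q.eval z.im))
    (h1 : ∀ w ∈ spectrum ℂ M ∩ realZeros p q, f₁ w = g₁ w + u w)
    (h2 : ∀ w ∈ spectrum ℂ M ∩ realZeros p q, f₂ w = g₂ w + v w) :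
    jet p q M R₁ R₂ E f f₁ f₂ = jet p q M R₁ R₂ E g g₁ g₂ + (cfc u M * R₁ + cfc v M * R₂) := by
  have hUS : spectrum ℂ M \ realZeros p q ⊆ spectrum ℂ M := Set.sdiff_subset
  have hle₁ : ∀ z ∈ spectrum ℂ M, ‖((p.eval z.re : ℝ) : ℂ)‖ ≤ |reImSum p q z| := fun z hz => by
    rw [Complex.norm_real]; exact h.abs_eval_re_le hz
  have hle₂ : ∀ z ∈ spectrum ℂ M, ‖((q.eval z.im : ℝ) : ℂ)‖ ≤ |reImSum p q z| := fun z hz => by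
    rw [Complex.norm_real]; exact h.abs_eval_im_le hz
  have hd₁ := isBddBorel_div hp hq (continuous_eval_re p) hle₁
  have hd₂ := isBddBorel_div hp hq (continuous_eval_im q) hle₂
  have hud := isBddBorel_indicator_mul hUS hu hd₁
  have hvd := isBddBorel_indicator_mul hUS hv hd₂
  refine ext_of_mul_proj hp hq hE ?_ fun w hw => ?_
  · rw [add_mul, add_mul, jet_mul_proj hp hq hf, jet_mul_proj hp hq hg, mul_assoc, mul_assoc,
      h.mul_proj_eq_integral_div hE hp hq (continuous_eval_re p) hle₁ (h.commute_proj_fst hE)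
        h.mul_fst,
      h.mul_proj_eq_integral_div hE hp hq (continuous_eval_im q) hle₂ (h.commute_proj_snd hE)
        h.mul_snd, hE.cfc_mul_integral h.normal hUS hu hd₁,
      hE.cfc_mul_integral h.normal hUS hv hd₂, integral_indicator_add hud hvd,
      integral_indicator_add hg (hud.indicator_add hvd)]
    refine integral_indicator_congr fun z hz => ?_
    have hz0 : (reImSum p q z : ℂ) ≠ 0 := Complex.ofReal_ne_zero.2 (h.reImSum_ne_zero hz)
    refine mul_left_cancel₀ hz0 ((h0 z hz).trans ?_)
    field_simp
  · have hws := MeasurableSet.singleton w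
    rw [add_mul, add_mul, jet_mul_proj_singleton hp hq hf hw, jet_mul_proj_singleton hp hq hg hw,
      mul_assoc, mul_assoc, (h.commute_proj_fst hE _ hws).eq, (h.commute_proj_snd hE _ hws).eq,
      ← mul_assoc, ← mul_assoc, hE.cfc_mul_proj_singleton h.normal hu hw.1,
      hE.cfc_mul_proj_singleton h.normal hv hw.1, smul_mul_assoc, smul_mul_assoc,
      ← (h.commute_proj_fst hE _ hws).eq, ← (h.commute_proj_snd hE _ hws).eq, ← smul_mul_assoc,
      ← smul_mul_assoc, ← add_mul, ← add_mul, h1 w hw, h2 w hw]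
    congr 1
    module

end IsNormalSplitting

/-! ### Growth at the zeros -/

/-- A polynomial vanishes at `a` at most to the order of its multiplicity. -/
theorem isBigO_pow_rootMultiplicity_eval {p : ℝ[X]} (hp : p ≠ 0) (a : ℝ) :
    (fun x : ℝ => |x - a| ^ p.rootMultiplicity a) =O[𝓝 a] fun x => p.eval x := by
  obtain ⟨r, hr, hdvd⟩ := p.exists_eq_pow_rootMultiplicity_mul_and_not_dvd hp a
  have hra : r.eval a ≠ 0 := fun h => hdvd (Polynomial.dvd_iff_isRoot.2 h)
  have h1 : (fun _ => (1 : ℝ)) =O[𝓝 a] fun x => r.eval x := by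
    rw [Asymptotics.isBigO_const_left_iff_pos_le_norm one_ne_zero]
    have h2 : Filter.Tendsto (fun x => ‖r.eval x‖) (𝓝 a) (𝓝 ‖r.eval a‖) :=
      (r.continuous.tendsto a).norm
    have h3 : ‖r.eval a‖ / 2 < ‖r.eval a‖ := half_lt_self (norm_pos_iff.2 hra)
    exact ⟨‖r.eval a‖ / 2, half_pos (norm_pos_iff.2 hra),
      (h2.eventually_const_lt h3).mono fun x hx => hx.le⟩
  have h4 : (fun x : ℝ => |x - a| ^ p.rootMultiplicity a) =O[𝓝 a]
      fun x => (x - a) ^ p.rootMultiplicity a :=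
    Asymptotics.IsBigO.of_bound 1 (Filter.Eventually.of_forall fun x => by simp)
  refine (h4.mul h1).congr (fun x => mul_one _) fun x => ?_
  conv_rhs => rw [hr]
  simp

namespace IsNormalSplitting

variable {H : Type*} [NormedAddCommGroup H] [InnerProductSpace ℂ H] [CompleteSpace H]
  {p q : ℝ[X]} {M R₁ R₂ : H →L[ℂ] H}

/-- On the spectrum `p(Re z) + q(Im z)` dominates both `p(Re z)` and `q(Im z)`, and hence the
gauge. -/
theorem gauge_isBigO (h : IsNormalSplitting p q M R₁ R₂) (hp : p ≠ 0) (hq : q ≠ 0) (w : ℂ) :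
    Symbols.gauge p q w =O[𝓝[spectrum ℂ M \ realZeros p q] w] reImSum p q := by
  have hle : 𝓝[spectrum ℂ M \ realZeros p q] w ≤ 𝓝 w := nhdsWithin_le_nhds
  have h1 : (fun z : ℂ => |(z - w).re| ^ p.rootMultiplicity w.re) =O[𝓝[spectrum ℂ M \
      realZeros p q] w] reImSum p q := by
    have h2 := ((isBigO_pow_rootMultiplicity_eval hp w.re).comp_tendsto
      (Complex.continuous_re.tendsto w)).mono hle
    refine h2.trans (Asymptotics.IsBigO.of_bound 1 ?_)
    filter_upwards [self_mem_nhdsWithin] with z hz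
    rw [one_mul]
    exact h.abs_eval_re_le hz.1
  have h1' : (fun z : ℂ => |(z - w).im| ^ q.rootMultiplicity w.im) =O[𝓝[spectrum ℂ M \
      realZeros p q] w] reImSum p q := by
    have h2 := ((isBigO_pow_rootMultiplicity_eval hq w.im).comp_tendsto
      (Complex.continuous_im.tendsto w)).mono hle
    refine h2.trans (Asymptotics.IsBigO.of_bound 1 ?_)
    filter_upwards [self_mem_nhdsWithin] with z hz
    rw [one_mul]
    exact h.abs_eval_im_le hz.1
  refine Asymptotics.IsBigO.trans (Asymptotics.IsBigO.of_bound 1 ?_)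
    (h1.norm_left.add h1'.norm_left)
  refine Filter.Eventually.of_forall fun z => ?_
  rw [Real.norm_of_nonneg (Symbols.gauge_nonneg w z), one_mul,
    Real.norm_of_nonneg (add_nonneg (norm_nonneg _) (norm_nonneg _))]
  refine max_le ((le_abs_self _).trans (le_add_of_nonneg_right (norm_nonneg _)))
    ((le_abs_self _).trans (le_add_of_nonneg_left (norm_nonneg _)))

/-- A bounded function which is dominated by the gauge at the zeros is a bounded multiple of
`p(Re z) + q(Im z)` on the spectrum, by compactness. -/
theorem exists_bound_div (h : IsNormalSplitting p q M R₁ R₂) (hp : p ≠ 0) (hq : q ≠ 0) {δ : ℂ → ℂ}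
    (hb : ∃ C : ℝ, ∀ z ∈ spectrum ℂ M \ realZeros p q, ‖δ z‖ ≤ C)
    (hδ : ∀ w ∈ spectrum ℂ M ∩ realZeros p q,
      δ =O[𝓝[spectrum ℂ M \ realZeros p q] w] Symbols.gauge p q w) :
    ∃ C : ℝ, ∀ z ∈ spectrum ℂ M \ realZeros p q, ‖δ z / reImSum p q z‖ ≤ C := by
  have key := (spectrum.isCompact (𝕜 := ℂ) M).induction_on
    (p := fun s => ∃ C : ℝ, ∀ z ∈ s ∩ (spectrum ℂ M \ realZeros p q), ‖δ z / reImSum p q z‖ ≤ C)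
    ⟨0, fun z hz => hz.1.elim⟩
    (fun s t hst ⟨C, hC⟩ => ⟨C, fun z hz => hC z ⟨hst hz.1, hz.2⟩⟩)
    (fun s t ⟨C, hC⟩ ⟨D, hD⟩ => ⟨max C D, fun z hz => by
      rcases hz.1 with h1 | h1
      · exact (hC z ⟨h1, hz.2⟩).trans (le_max_left _ _)
      · exact (hD z ⟨h1, hz.2⟩).trans (le_max_right _ _)⟩) ?_
  · obtain ⟨C, hC⟩ := key
    exact ⟨C, fun z hz => hC z ⟨hz.1, hz⟩⟩
  intro w hw
  suffices hO : δ =O[𝓝[spectrum ℂ M \ realZeros p q] w] reImSum p q by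
    obtain ⟨C, hC⟩ := hO.bound
    rw [eventually_nhdsWithin_iff] at hC
    refine ⟨_, mem_nhdsWithin_of_mem_nhds hC, C, fun z hz => ?_⟩
    have h1 := hz.1 hz.2
    rw [norm_div, Complex.norm_real]
    exact div_le_of_le_mul₀ (norm_nonneg _)
      (nonneg_of_mul_nonneg_left ((norm_nonneg _).trans h1)
        (norm_pos_iff.2 (h.reImSum_ne_zero hz.2))) h1
  by_cases hwZ : w ∈ realZeros p q
  · exact (hδ w ⟨hw, hwZ⟩).trans (h.gauge_isBigO hp hq w)
  · obtain ⟨C, hC⟩ := hb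
    have h0 : reImSum p q w ≠ 0 := h.reImSum_ne_zero ⟨hw, hwZ⟩
    have hcont : Continuous (reImSum p q) :=
      (p.continuous.comp Complex.continuous_re).add (q.continuous.comp Complex.continuous_im)
    have h1 : (fun _ => (1 : ℝ)) =O[𝓝[spectrum ℂ M \ realZeros p q] w] reImSum p q := by
      refine Asymptotics.IsBigO.mono ?_ nhdsWithin_le_nhds
      rw [Asymptotics.isBigO_const_left_iff_pos_le_norm one_ne_zero]
      have h3 : ‖reImSum p q w‖ / 2 < ‖reImSum p q w‖ := half_lt_self (norm_pos_iff.2 h0)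
      exact ⟨‖reImSum p q w‖ / 2, half_pos (norm_pos_iff.2 h0),
        ((hcont.tendsto w).norm.eventually_const_lt h3).mono fun x hx => hx.le⟩
    refine Asymptotics.IsBigO.trans (Asymptotics.IsBigO.of_bound C ?_) h1
    filter_upwards [self_mem_nhdsWithin] with z hz
    simpa using hC z hz

end IsNormalSplitting

/-! ### The definitizing polynomials as jet-valued functions -/

namespace Symbols

variable {p q : ℝ[X]} {σ : Set ℂ}

/-- The polynomial `p(z)` as a polynomial in two variables. -/
def fstPoly (p : ℝ[X]) : MvPolynomial (Fin 2) ℂ :=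
  Polynomial.aeval (MvPolynomial.X 0) (p.map (algebraMap ℝ ℂ))

/-- The polynomial `q(w)` as a polynomial in two variables. -/
def sndPoly (q : ℝ[X]) : MvPolynomial (Fin 2) ℂ :=
  Polynomial.aeval (MvPolynomial.X 1) (q.map (algebraMap ℝ ℂ))

theorem eval_fstPoly (p : ℝ[X]) (z : ℂ) :
    MvPolynomial.eval ![(z.re : ℂ), (z.im : ℂ)] (fstPoly p) = ((p.eval z.re : ℝ) : ℂ) := by
  rw [← taylorCoeff_zero_zero, fstPoly, taylorCoeff_aeval_X_zero, if_pos rfl,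
    Polynomial.taylor_coeff_zero, eval_map_ofReal]

theorem eval_sndPoly (q : ℝ[X]) (z : ℂ) :
    MvPolynomial.eval ![(z.re : ℂ), (z.im : ℂ)] (sndPoly q) = ((q.eval z.im : ℝ) : ℂ) := by
  rw [← taylorCoeff_zero_zero, sndPoly, taylorCoeff_aeval_X_one, if_pos rfl,
    Polynomial.taylor_coeff_zero, eval_map_ofReal]

theorem isResidual_fstPoly : (ofPoly (fstPoly p) : Symbols p q σ).IsResidual := by
  refine ⟨fun z hz k hk l hl => ?_, fun ζ => Jet.ext_coeff fun k l h => ?_⟩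
  · rw [entry_ofPoly _ (Or.inr hz) (mem_realIndex_of_lt hz hk hl), fstPoly,
      taylorCoeff_aeval_X_zero, taylor_coeff_eq_zero_of_lt (by rwa [rootMultiplicity_map_ofReal]),
      ite_self]
  · rw [coeff_snd_ofPoly _ _ h, fstPoly, taylorCoeff_aeval_X_zero, taylor_coeff_eq_zero_of_lt h.1,
      ite_self, Jet.coeff_zero]

theorem isResidual_sndPoly : (ofPoly (sndPoly q) : Symbols p q σ).IsResidual := by
  refine ⟨fun z hz k hk l hl => ?_, fun ζ => Jet.ext_coeff fun k l h => ?_⟩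
  · rw [entry_ofPoly _ (Or.inr hz) (mem_realIndex_of_lt hz hk hl), sndPoly,
      taylorCoeff_aeval_X_one, taylor_coeff_eq_zero_of_lt (by rwa [rootMultiplicity_map_ofReal]),
      ite_self]
  · rw [coeff_snd_ofPoly _ _ h, sndPoly, taylorCoeff_aeval_X_one, taylor_coeff_eq_zero_of_lt h.2,
      ite_self, Jet.coeff_zero]

theorem entry_fstPoly_snd (hq : q ≠ 0) {z : ℂ} (hz : z ∈ realZeros p q) :
    (ofPoly (fstPoly p) : Symbols p q σ).entry z 0 (q.rootMultiplicity z.im) = 0 := by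
  have hn : q.rootMultiplicity z.im ≠ 0 := ((Polynomial.rootMultiplicity_pos hq).2 hz.2).ne'
  rw [entry_ofPoly _ (Or.inr hz) (mem_realIndex_snd hz le_rfl), fstPoly, taylorCoeff_aeval_X_zero,
    if_neg hn]

theorem entry_sndPoly_fst (hp : p ≠ 0) {z : ℂ} (hz : z ∈ realZeros p q) :
    (ofPoly (sndPoly q) : Symbols p q σ).entry z (p.rootMultiplicity z.re) 0 = 0 := by
  have hm : p.rootMultiplicity z.re ≠ 0 := ((Polynomial.rootMultiplicity_pos hp).2 hz.1).ne'
  rw [entry_ofPoly _ (Or.inr hz) (mem_realIndex_fst hz le_rfl), sndPoly, taylorCoeff_aeval_X_one,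
    if_neg hm]

theorem entry_fstPoly_fst_ne_zero (hp : p ≠ 0) {z : ℂ} (hz : z ∈ realZeros p q) :
    (ofPoly (fstPoly p) : Symbols p q σ).entry z (p.rootMultiplicity z.re) 0 ≠ 0 := by
  rw [entry_ofPoly _ (Or.inr hz) (mem_realIndex_fst hz le_rfl), fstPoly, taylorCoeff_aeval_X_zero,
    if_pos rfl, ← rootMultiplicity_map_ofReal]
  exact taylor_coeff_rootMultiplicity_ne_zero (map_ne_zero_of_ne_zero hp) _

theorem entry_sndPoly_snd_ne_zero (hq : q ≠ 0) {z : ℂ} (hz : z ∈ realZeros p q) :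
    (ofPoly (sndPoly q) : Symbols p q σ).entry z 0 (q.rootMultiplicity z.im) ≠ 0 := by
  rw [entry_ofPoly _ (Or.inr hz) (mem_realIndex_snd hz le_rfl), sndPoly, taylorCoeff_aeval_X_one,
    if_pos rfl, ← rootMultiplicity_map_ofReal]
  exact taylor_coeff_rootMultiplicity_ne_zero (map_ne_zero_of_ne_zero hq) _

theorem IsResidual.isBigO_gauge {φ : Symbols p q σ} (h : φ.IsResidual) (hφ : φ.IsAdmissible)
    {w : ℂ} (hw : w ∈ σ ∩ realZeros p q) :
    (fun z => φ.entry z 0 0) =O[𝓝[σ \ realZeros p q] w] gauge p q w := by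
  refine (hφ.growth w hw).congr_left fun z => ?_
  rw [taylorSum, Finset.sum_eq_zero, sub_zero]
  intro k hk
  refine Finset.sum_eq_zero fun l hl => ?_
  rw [h.1 w hw.2 k (Finset.mem_range.1 hk) l (Finset.mem_range.1 hl), zero_mul, zero_mul]

end Symbols

/-! ### The splitting given by a definitizable operator -/

namespace DefinitizableNormal

variable {K : Type*} [NormedAddCommGroup K] [InnerProductSpace ℂ K] [CompleteSpace K]
  {J : KreinStructure K} (D : DefinitizableNormal J)

theorem pq_eq : D.pq = Symbols.fstPoly D.p + Symbols.sndPoly D.q := rfl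

theorem eval_pq (z : ℂ) :
    MvPolynomial.eval ![(z.re : ℂ), (z.im : ℂ)] D.pq = (reImSum D.p D.q z : ℂ) := by
  rw [pq_eq, map_add, Symbols.eval_fstPoly, Symbols.eval_sndPoly, reImSum, Complex.ofReal_add]

/-- The values of a polynomial at the pairs `(Re z, Im z)`. -/
def ev (s : MvPolynomial (Fin 2) ℂ) (z : ℂ) : ℂ := MvPolynomial.eval ![(z.re : ℂ), (z.im : ℂ)] s

theorem theta_biPolyEval_eq_cfc (s : MvPolynomial (Fin 2) ℂ) :
    D.theta (biPolyEval s D.A D.B) = cfc (ev s) (D.theta D.N) :=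
  (D.theta_biPolyEval s).trans (D.biPolyEval_theta s)

theorem theta_G : D.theta D.G = cfc (fun z => (reImSum D.p D.q z : ℂ)) (D.theta D.N) := by
  rw [G_eq, theta_biPolyEval_eq_cfc]
  exact congrArg (fun f => cfc f (D.theta D.N)) (funext D.eval_pq)

theorem isNormalSplitting : IsNormalSplitting D.p D.q (D.theta D.N) D.RR₁ D.RR₂ where
  normal := D.isStarNormal_theta_N
  isSelfAdjoint_fst := D.isSelfAdjoint_RR₁
  isSelfAdjoint_snd := D.isSelfAdjoint_RR₂
  nonneg_fst := D.RR₁_nonneg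
  nonneg_snd := D.RR₂_nonneg
  add_eq_one := D.RR₁_add_RR₂
  commute_fst := by
    have h : Commute D.N (J.adj D.N) := D.normal
    exact D.commute_theta_RR₁ (D.commute_A (Commute.refl _) h) (D.commute_B (Commute.refl _) h)
  mul_fst := by
    rw [← theta_G, RR₁_mul_theta_G, realPolyEval_A, theta_biPolyEval_eq_cfc]
    exact congrArg (fun f => cfc f (D.theta D.N)) (funext (Symbols.eval_fstPoly D.p))
  mul_snd := by
    rw [← theta_G, RR₂_mul_theta_G, realPolyEval_B, theta_biPolyEval_eq_cfc]
    exact congrArg (fun f => cfc f (D.theta D.N)) (funext (Symbols.eval_sndPoly D.q))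

theorem commute_biPolyEval_G (s : MvPolynomial (Fin 2) ℂ) :
    Commute (biPolyEval s D.A D.B) D.G :=
  (commute_biPolyEval D.commute_A_G.symm D.commute_B_G.symm s).symm

end DefinitizableNormal

/-! ### Decompositions -/

theorem IsBddBorel.measurable_subtype {U : Set ℂ} {g : ℂ → ℂ} (hg : IsBddBorel (U.indicator g)) :
    Measurable fun z : ↥U => g z := by
  have h : (fun z : ↥U => g z) = fun z : ↥U => U.indicator g z :=
    funext fun z => (Set.indicator_of_mem z.2 g).symm
  rw [h]
  exact hg.measurable.comp measurable_subtype_coe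

theorem IsBddBorel.exists_bound {U : Set ℂ} {g : ℂ → ℂ} (hg : IsBddBorel (U.indicator g)) :
    ∃ C : ℝ, ∀ z ∈ U, ‖g z‖ ≤ C := by
  obtain ⟨C, hC⟩ := hg.bounded
  exact ⟨C, fun z hz => by simpa [hz] using hC z⟩

namespace Symbols

variable {p q : ℝ[X]} {σ : Set ℂ}

theorem map_conj_aeval_X (r : ℝ[X]) (i : Fin 2) :
    MvPolynomial.map (starRingEnd ℂ)
        (Polynomial.aeval (MvPolynomial.X i) (r.map (algebraMap ℝ ℂ))) =
      (Polynomial.aeval (MvPolynomial.X i) (r.map (algebraMap ℝ ℂ)) : MvPolynomial (Fin 2) ℂ) := by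
  induction r using Polynomial.induction_on' with
  | add a b ha hb => rw [Polynomial.map_add, map_add, map_add, ha, hb]
  | monomial n a =>
    rw [Polynomial.map_monomial, Polynomial.aeval_monomial, map_mul, map_pow, MvPolynomial.map_X,
      MvPolynomial.algebraMap_eq, MvPolynomial.map_C]
    simp

end Symbols

namespace DefinitizableNormal

variable {K : Type*} [NormedAddCommGroup K] [InnerProductSpace ℂ K] [CompleteSpace K]
  {J : KreinStructure K} (D : DefinitizableNormal J)

/-- The coefficient `(p_N + q_N)_{m,0}` at `w`. -/
def coeffFst (w : ℂ) : ℂ := (D.polyN D.pq).entry w (D.p.rootMultiplicity w.re) 0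

/-- The coefficient `(p_N + q_N)_{0,n}` at `w`. -/
def coeffSnd (w : ℂ) : ℂ := (D.polyN D.pq).entry w 0 (D.q.rootMultiplicity w.im)

theorem coeffFst_eq {w : ℂ} (hw : w ∈ D.Z) : D.coeffFst w =
    (D.polyN (Symbols.fstPoly D.p)).entry w (D.p.rootMultiplicity w.re) 0 := by
  have h := Symbols.entry_sndPoly_fst (σ := D.sigma) D.definitizing_p.1 hw
  rw [coeffFst, pq_eq, polyN, Symbols.ofPoly_add, Symbols.entry_add, h, add_zero]

theorem coeffSnd_eq {w : ℂ} (hw : w ∈ D.Z) : D.coeffSnd w =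
    (D.polyN (Symbols.sndPoly D.q)).entry w 0 (D.q.rootMultiplicity w.im) := by
  have h := Symbols.entry_fstPoly_snd (σ := D.sigma) D.definitizing_q.1 hw
  rw [coeffSnd, pq_eq, polyN, Symbols.ofPoly_add, Symbols.entry_add, h, zero_add]

theorem coeffFst_ne_zero {w : ℂ} (hw : w ∈ D.Z) : D.coeffFst w ≠ 0 := by
  rw [D.coeffFst_eq hw]
  exact Symbols.entry_fstPoly_fst_ne_zero D.definitizing_p.1 hw

theorem coeffSnd_ne_zero {w : ℂ} (hw : w ∈ D.Z) : D.coeffSnd w ≠ 0 := by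
  rw [D.coeffSnd_eq hw]
  exact Symbols.entry_sndPoly_snd_ne_zero D.definitizing_q.1 hw

theorem star_polyN_pq : star (D.polyN D.pq) = D.polyN D.pq := by
  rw [polyN, ← Symbols.ofPoly_conj, pq, map_add, Symbols.map_conj_aeval_X, Symbols.map_conj_aeval_X]

theorem conj_coeffFst (w : ℂ) : conj (D.coeffFst w) = D.coeffFst w := by
  rw [coeffFst, ← Symbols.entry_star, star_polyN_pq]

theorem conj_coeffSnd (w : ℂ) : conj (D.coeffSnd w) = D.coeffSnd w := by
  rw [coeffSnd, ← Symbols.entry_star, star_polyN_pq]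

theorem entry_polyN (s : MvPolynomial (Fin 2) ℂ) {z : ℂ} (hz : z ∈ D.sigma) :
    (D.polyN s).entry z 0 0 = ev s z := Symbols.entry_ofPoly_zero s (Or.inl hz)

variable {D}
variable {φ ψ : D.M} {s t : MvPolynomial (Fin 2) ℂ} {f f₁ f₂ g g₁ g₂ : ℂ → ℂ}

theorem measurableSet_sigma_diff : MeasurableSet (D.sigma \ D.Z) :=
  IsNormalSplitting.measurableSet_off D.definitizing_p.1 D.definitizing_q.1

theorem IsDecomposition.isBddBorel (h : D.IsDecomposition φ s g g₁ g₂) :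
    IsBddBorel ((D.sigma \ D.Z).indicator g) :=
  isBddBorel_indicator measurableSet_sigma_diff h.measurable h.bounded

/-- A decomposition of `φ` in terms of the residual function `φ - s_N`. -/
theorem isDecomposition_iff : D.IsDecomposition φ s g g₁ g₂ ↔
    (φ - D.polyN s).IsResidual ∧ IsBddBorel ((D.sigma \ D.Z).indicator g) ∧
    (∀ z ∈ D.sigma \ D.Z, (φ - D.polyN s).entry z 0 0 = reImSum D.p D.q z * g z) ∧
    (∀ w ∈ D.sigma ∩ D.Z, (φ - D.polyN s).entry w (D.p.rootMultiplicity w.re) 0 =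
      D.coeffFst w * g₁ w) ∧
    (∀ w ∈ D.sigma ∩ D.Z, (φ - D.polyN s).entry w 0 (D.q.rootMultiplicity w.im) =
      D.coeffSnd w * g₂ w) := by
  simp only [Symbols.entry_sub, sub_eq_iff_eq_add']
  refine ⟨fun h => ⟨h.residual, h.isBddBorel, fun z hz => ?_, h.eq_fst, h.eq_snd⟩,
    fun ⟨h1, h2, h3, h4, h5⟩ =>
      ⟨h1, h2.measurable_subtype, h2.exists_bound, fun z hz => ?_, h4, h5⟩⟩
  · rw [h.eq_off z hz, D.entry_polyN D.pq hz.1, ev, eval_pq]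
  · rw [h3 z hz, D.entry_polyN D.pq hz.1, ev, eval_pq]

variable (D) in
/-- The integral of `(g, g₁, g₂)` with respect to a spectral measure of `Θ(N)`. -/
def jet (E : SpectralMeasure D.V) (g g₁ g₂ : ℂ → ℂ) : D.V →L[ℂ] D.V :=
  IsNormalSplitting.jet D.p D.q (D.theta D.N) D.RR₁ D.RR₂ E g g₁ g₂

theorem isJetIntegral_iff {E : SpectralMeasure D.V}
    (hg : IsBddBorel ((D.sigma \ D.Z).indicator g)) {L : D.V →L[ℂ] D.V} :
    D.IsJetIntegral E g g₁ g₂ L ↔ L = D.jet E g g₁ g₂ := by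
  constructor
  · rintro ⟨I, hI, rfl⟩
    rw [← SpectralMeasure.integral_eq hI]
    rfl
  · rintro rfl
    exact ⟨_, SpectralMeasure.isWeakIntegral_integral hg, rfl⟩

/-- Jet integrals do not depend on the choice of the spectral measure of `Θ(N)`. -/
theorem jet_congr {E E' : SpectralMeasure D.V} (hE : E.IsSpectralMeasureOf (D.theta D.N))
    (hE' : E'.IsSpectralMeasureOf (D.theta D.N)) (hg : IsBddBorel ((D.sigma \ D.Z).indicator g)) :
    D.jet E g g₁ g₂ = D.jet E' g g₁ g₂ := by
  have h1 : E.integral ((D.sigma \ D.Z).indicator g) =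
      E'.integral ((D.sigma \ D.Z).indicator g) := by
    refine SpectralMeasure.integral_eq fun x => ?_
    rw [hE.scalar_eq D.isStarNormal_theta_N hE' x]
    exact SpectralMeasure.isWeakIntegral_integral hg x
  have h2 : ∀ w : ℂ, E.proj {w} = E'.proj {w} := fun w =>
    hE.proj_eq D.isStarNormal_theta_N hE' (MeasurableSet.singleton w)
  change E.integral ((D.sigma \ D.Z).indicator g) + _ =
    E'.integral ((D.sigma \ D.Z).indicator g) + _
  simp only [h1, h2]

variable (D) in
/-- `S` is the value of `φ(N)` for some decomposition of `φ` and a fixed spectral measure `E`. -/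
def IsValueOf (E : SpectralMeasure D.V) (φ : D.M) (S : K →L[ℂ] K) : Prop :=
  ∃ (s : MvPolynomial (Fin 2) ℂ) (g g₁ g₂ : ℂ → ℂ), D.IsDecomposition φ s g g₁ g₂ ∧
    S = biPolyEval s D.A D.B + D.xi (D.jet E g g₁ g₂)

theorem isValue_iff {E : SpectralMeasure D.V} (hE : E.IsSpectralMeasureOf (D.theta D.N))
    {S : K →L[ℂ] K} : D.IsValue φ S ↔ D.IsValueOf E φ S := by
  constructor
  · rintro ⟨E', hE', s, g, g₁, g₂, hd, L, hL, rfl⟩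
    rw [isJetIntegral_iff hd.isBddBorel] at hL
    exact ⟨s, g, g₁, g₂, hd, by rw [hL, jet_congr hE hE' hd.isBddBorel]⟩
  · rintro ⟨s, g, g₁, g₂, hd, rfl⟩
    exact ⟨E, hE, s, g, g₁, g₂, hd, _, (isJetIntegral_iff hd.isBddBorel).2 rfl, rfl⟩

theorem isCompact_sigma : IsCompact D.sigma := spectrum.isCompact (𝕜 := ℂ) (D.theta D.N)

theorem isAdmissible_polyN (s : MvPolynomial (Fin 2) ℂ) : (D.polyN s).IsAdmissible :=
  Symbols.isAdmissible_ofPoly isCompact_sigma s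

/-- Every function of the class `F_N` has a decomposition: `s` interpolates the jets, and the growth
condition makes the quotient of `φ - s_N` and `p(Re z) + q(Im z)` bounded. -/
theorem exists_isDecomposition (hφ : φ ∈ D.F) :
    ∃ (s : MvPolynomial (Fin 2) ℂ) (g g₁ g₂ : ℂ → ℂ), D.IsDecomposition φ s g g₁ g₂ := by
  obtain ⟨s, hs⟩ := Symbols.exists_isResidual_sub_ofPoly D.definitizing_p.1 D.definitizing_q.1 φ
  have hadm : (φ - D.polyN s).IsAdmissible := D.F.sub_mem hφ (isAdmissible_polyN s)
  refine ⟨s, fun z => (φ - D.polyN s).entry z 0 0 / reImSum D.p D.q z,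
    fun w => (φ - D.polyN s).entry w (D.p.rootMultiplicity w.re) 0 / D.coeffFst w,
    fun w => (φ - D.polyN s).entry w 0 (D.q.rootMultiplicity w.im) / D.coeffSnd w,
    isDecomposition_iff.2 ⟨hs, isBddBorel_indicator measurableSet_sigma_diff ?_ ?_,
      fun z hz => ?_, fun w hw => ?_, fun w hw => ?_⟩⟩
  · exact hadm.measurable.div
      ((continuous_reImSum D.p D.q).measurable.comp measurable_subtype_coe)
  · exact D.isNormalSplitting.exists_bound_div D.definitizing_p.1 D.definitizing_q.1 hadm.bounded
      fun w hw => hs.isBigO_gauge hadm hw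
  · rw [mul_div_cancel₀]
    exact Complex.ofReal_ne_zero.2 (D.isNormalSplitting.reImSum_ne_zero hz)
  · rw [mul_div_cancel₀ _ (D.coeffFst_ne_zero hw.2)]
  · rw [mul_div_cancel₀ _ (D.coeffSnd_ne_zero hw.2)]

theorem continuous_ev (s : MvPolynomial (Fin 2) ℂ) : Continuous (ev s) :=
  Symbols.continuous_eval_re_im s

theorem commute_theta_jet {C : K →L[ℂ] K} (hA : Commute C D.A) (hB : Commute C D.B)
    (hC : Commute C D.N) (hC' : Commute C (J.adj D.N)) {E : SpectralMeasure D.V}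
    (hE : E.IsSpectralMeasureOf (D.theta D.N)) (hg : IsBddBorel ((D.sigma \ D.Z).indicator g)) :
    Commute (D.theta C) (D.jet E g g₁ g₂) := by
  have hG := D.commute_G hA hB
  refine IsNormalSplitting.commute_jet D.isStarNormal_theta_N hE D.definitizing_p.1
    D.definitizing_q.1 (D.commute_theta D.commute_N_G hG hC.symm) ?_ (D.commute_theta_RR₁ hA hB)
    (D.commute_theta_RR₂ hA hB) hg
  rw [star_theta_N]
  exact D.commute_theta (D.commute_adj_G D.commute_N_G) hG hC'.symm

theorem commute_N_biPolyEval (s : MvPolynomial (Fin 2) ℂ) :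
    Commute (biPolyEval s D.A D.B) D.N ∧ Commute (biPolyEval s D.A D.B) (J.adj D.N) := by
  have hA := (commute_biPolyEval (Commute.refl _) D.commute_A_B s).symm
  have hB := (commute_biPolyEval D.commute_A_B.symm (Commute.refl _) s).symm
  constructor
  · rw [N_eq]
    exact hA.add_right (hB.smul_right _)
  · rw [adj_N_eq]
    exact hA.sub_right (hB.smul_right _)

/-! ### Values of the functional calculus -/

section Values

variable {E : SpectralMeasure D.V} {S T : K →L[ℂ] K}

/-- The value of `φ(N)` does not depend on the decomposition. The difference `r` of the two
polynomials is residual, so that `r = u p + v q`, and both `r(A, B)` and the difference of the two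
jet integrals are given by `u(M) R₁ R₁* + v(M) R₂ R₂*` for `M = Θ(N)`. -/
theorem IsValueOf.unique (hE : E.IsSpectralMeasureOf (D.theta D.N)) (hS : D.IsValueOf E φ S)
    (hT : D.IsValueOf E φ T) : S = T := by
  obtain ⟨s, f, f₁, f₂, hf, rfl⟩ := hS
  obtain ⟨t, g, g₁, g₂, hg, rfl⟩ := hT
  obtain ⟨hfr, hfb, hf0, hf1, hf2⟩ := isDecomposition_iff.1 hf
  obtain ⟨hgr, hgb, hg0, hg1, hg2⟩ := isDecomposition_iff.1 hg
  have hst : s = t + (s - t) := (add_sub_cancel t s).symm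
  set r := s - t with hr
  have hsum : φ - D.polyN t = φ - D.polyN s + D.polyN r := by
    rw [hst, polyN, polyN, polyN, Symbols.ofPoly_add]
    abel
  have hrr : (D.polyN r).IsResidual := by
    have h1 : D.polyN r = φ - D.polyN t + (-1) * (φ - D.polyN s) := by
      rw [hsum]; ring
    rw [h1, mul_comm]
    exact hgr.add (hfr.mul _)
  obtain ⟨u, v, huv⟩ := Symbols.exists_eq_of_isResidual_ofPoly D.definitizing_p.1
    D.definitizing_q.1 hrr
  change r = u * Symbols.fstPoly D.p + v * Symbols.sndPoly D.q at huv
  have hpoly : D.polyN r = D.polyN (Symbols.fstPoly D.p) * D.polyN u +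
      D.polyN (Symbols.sndPoly D.q) * D.polyN v := by
    rw [huv, polyN, Symbols.ofPoly_add, Symbols.ofPoly_mul, Symbols.ofPoly_mul,
      mul_comm (Symbols.ofPoly u), mul_comm (Symbols.ofPoly v)]
  have hjet : D.jet E g g₁ g₂ = D.jet E f f₁ f₂ +
      (cfc (ev u) (D.theta D.N) * D.RR₁ + cfc (ev v) (D.theta D.N) * D.RR₂) := by
    refine D.isNormalSplitting.jet_eq_add hE D.definitizing_p.1 D.definitizing_q.1
      (continuous_ev u) (continuous_ev v) hgb hfb (fun z hz => ?_) (fun w hw => ?_) fun w hw => ?_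
    · rw [← hg0 z hz, ← hf0 z hz, hsum, Symbols.entry_add, D.entry_polyN _ hz.1, huv, ev, map_add,
        map_mul, map_mul, Symbols.eval_fstPoly, Symbols.eval_sndPoly]
      rfl
    · refine mul_left_cancel₀ (D.coeffFst_ne_zero hw.2) ?_
      rw [← hg1 w hw, mul_add, ← hf1 w hw, hsum, Symbols.entry_add, hpoly, Symbols.entry_add,
        Symbols.isResidual_fstPoly.entry_mul_fst D.definitizing_q.1 _ hw.2,
        Symbols.isResidual_sndPoly.entry_mul_fst D.definitizing_q.1 _ hw.2,
        ← D.coeffFst_eq hw.2, Symbols.entry_sndPoly_fst D.definitizing_p.1 hw.2, zero_mul, add_zero,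
        D.entry_polyN u hw.1]
    · refine mul_left_cancel₀ (D.coeffSnd_ne_zero hw.2) ?_
      rw [← hg2 w hw, mul_add, ← hf2 w hw, hsum, Symbols.entry_add, hpoly, Symbols.entry_add,
        Symbols.isResidual_fstPoly.entry_mul_snd D.definitizing_p.1 _ hw.2,
        Symbols.isResidual_sndPoly.entry_mul_snd D.definitizing_p.1 _ hw.2,
        ← D.coeffSnd_eq hw.2, Symbols.entry_fstPoly_snd D.definitizing_q.1 hw.2, zero_mul, zero_add,
        D.entry_polyN v hw.1]
  have hop : biPolyEval r D.A D.B =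
      D.xi (cfc (ev u) (D.theta D.N) * D.RR₁ + cfc (ev v) (D.theta D.N) * D.RR₂) := by
    rw [xi_add, ← theta_biPolyEval_eq_cfc, ← theta_biPolyEval_eq_cfc,
      ← D.mul_xi (D.commute_biPolyEval_G u), ← D.mul_xi (D.commute_biPolyEval_G v), xi_RR₁, xi_RR₂,
      realPolyEval_A, realPolyEval_B, ← biPolyEval_mul _ _ D.commute_A_B,
      ← biPolyEval_mul _ _ D.commute_A_B, ← biPolyEval_add, huv]
    rfl
  rw [hjet, xi_add, ← hop, hst, biPolyEval_add]
  abel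

theorem IsValueOf.add (hE : E.IsSpectralMeasureOf (D.theta D.N)) (hS : D.IsValueOf E φ S)
    (hT : D.IsValueOf E ψ T) : D.IsValueOf E (φ + ψ) (S + T) := by
  obtain ⟨s, f, f₁, f₂, hf, rfl⟩ := hS
  obtain ⟨t, g, g₁, g₂, hg, rfl⟩ := hT
  obtain ⟨hfr, hfb, hf0, hf1, hf2⟩ := isDecomposition_iff.1 hf
  obtain ⟨hgr, hgb, hg0, hg1, hg2⟩ := isDecomposition_iff.1 hg
  have hsum : φ + ψ - D.polyN (s + t) = φ - D.polyN s + (ψ - D.polyN t) := by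
    rw [polyN, polyN, polyN, Symbols.ofPoly_add]
    abel
  refine ⟨s + t, fun z => f z + g z, fun z => f₁ z + g₁ z, fun z => f₂ z + g₂ z,
    isDecomposition_iff.2 ?_, ?_⟩
  · rw [hsum]
    refine ⟨hfr.add hgr, hfb.indicator_add hgb, fun z hz => ?_, fun w hw => ?_, fun w hw => ?_⟩
    · rw [Symbols.entry_add, hf0 z hz, hg0 z hz, mul_add]
    · rw [Symbols.entry_add, hf1 w hw, hg1 w hw, mul_add]
    · rw [Symbols.entry_add, hf2 w hw, hg2 w hw, mul_add]
  · have h : D.jet E (fun z => f z + g z) (fun z => f₁ z + g₁ z) (fun z => f₂ z + g₂ z) =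
        D.jet E f f₁ f₂ + D.jet E g g₁ g₂ :=
      IsNormalSplitting.jet_add hE D.definitizing_p.1 D.definitizing_q.1 hfb hgb
    rw [h, xi_add, biPolyEval_add]
    abel

/-- The values are multiplicative, because `Ξ(X) Ξ(Y) = Ξ(X Θ(p(A) + q(B)) Y)` corresponds to the
last term of the product rule for jet integrals. -/
theorem IsValueOf.mul (hE : E.IsSpectralMeasureOf (D.theta D.N)) (hS : D.IsValueOf E φ S)
    (hT : D.IsValueOf E ψ T) : D.IsValueOf E (φ * ψ) (S * T) := by
  obtain ⟨s, f, f₁, f₂, hf, rfl⟩ := hS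
  obtain ⟨t, g, g₁, g₂, hg, rfl⟩ := hT
  obtain ⟨hfr, hfb, hf0, hf1, hf2⟩ := isDecomposition_iff.1 hf
  obtain ⟨hgr, hgb, hg0, hg1, hg2⟩ := isDecomposition_iff.1 hg
  have hp := D.definitizing_p.1
  have hq := D.definitizing_q.1
  have hUS : D.sigma \ D.Z ⊆ spectrum ℂ (D.theta D.N) := Set.sdiff_subset
  -- `φ ψ - (s t)_N = δ t_N + ε s_N + δ ε` with `δ = φ - s_N` and `ε = ψ - t_N`
  set δ := φ - D.polyN s with hδ
  set ε := ψ - D.polyN t with hε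
  have hprod : φ * ψ - D.polyN (s * t) = δ * D.polyN t + ε * D.polyN s + δ * ε := by
    rw [polyN, Symbols.ofPoly_mul, hδ, hε]
    ring
  have hε0 : ∀ w ∈ D.Z, ε.entry w 0 0 = 0 := fun w hw =>
    hgr.1 w hw 0 ((Polynomial.rootMultiplicity_pos hp).2 hw.1) 0
      ((Polynomial.rootMultiplicity_pos hq).2 hw.2)
  refine ⟨s * t, fun z => ev s z * g z + ev t z * f z + reImSum D.p D.q z * (f z * g z),
    fun z => ev s z * g₁ z + ev t z * f₁ z, fun z => ev s z * g₂ z + ev t z * f₂ z,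
    isDecomposition_iff.2 ?_, ?_⟩
  · rw [hprod]
    refine ⟨((hfr.mul _).add (hgr.mul _)).add (hfr.mul _),
      ((SpectralMeasure.isBddBorel_indicator_mul hUS (continuous_ev s) hgb).indicator_add
        (SpectralMeasure.isBddBorel_indicator_mul hUS (continuous_ev t) hfb)).indicator_add
        (SpectralMeasure.isBddBorel_indicator_mul hUS (continuous_reImSum _ _)
          (hfb.indicator_mul hgb)), fun z hz => ?_, fun w hw => ?_, fun w hw => ?_⟩
    · rw [Symbols.entry_add, Symbols.entry_add, Symbols.entry_mul_zero, Symbols.entry_mul_zero,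
        Symbols.entry_mul_zero, hf0 z hz, hg0 z hz, D.entry_polyN s hz.1, D.entry_polyN t hz.1]
      ring
    · rw [Symbols.entry_add, Symbols.entry_add, hfr.entry_mul_fst hq _ hw.2,
        hgr.entry_mul_fst hq _ hw.2, hfr.entry_mul_fst hq _ hw.2, hf1 w hw, hg1 w hw,
        D.entry_polyN s hw.1, D.entry_polyN t hw.1, hε0 w hw.2]
      ring
    · rw [Symbols.entry_add, Symbols.entry_add, hfr.entry_mul_snd hp _ hw.2,
        hgr.entry_mul_snd hp _ hw.2, hfr.entry_mul_snd hp _ hw.2, hf2 w hw, hg2 w hw,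
        D.entry_polyN s hw.1, D.entry_polyN t hw.1, hε0 w hw.2]
      ring
  · have h : D.jet E (fun z => ev s z * g z + ev t z * f z + reImSum D.p D.q z * (f z * g z))
        (fun z => ev s z * g₁ z + ev t z * f₁ z) (fun z => ev s z * g₂ z + ev t z * f₂ z) =
        cfc (ev s) (D.theta D.N) * D.jet E g g₁ g₂ + cfc (ev t) (D.theta D.N) * D.jet E f f₁ f₂ +
          D.jet E f f₁ f₂ * cfc (fun z => (reImSum D.p D.q z : ℂ)) (D.theta D.N) *
            D.jet E g g₁ g₂ :=
      D.isNormalSplitting.jet_mul hE hp hq (continuous_ev s) (continuous_ev t) hgb hfb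
    have hc : Commute (D.theta (biPolyEval t D.A D.B)) (D.jet E f f₁ f₂) :=
      commute_theta_jet (commute_biPolyEval (Commute.refl _) D.commute_A_B t).symm
        (commute_biPolyEval D.commute_A_B.symm (Commute.refl _) t).symm
        (commute_N_biPolyEval t).1 (commute_N_biPolyEval t).2 hE hfb
    rw [h, xi_add, xi_add, ← theta_biPolyEval_eq_cfc, ← theta_biPolyEval_eq_cfc, ← theta_G, hc.eq,
      ← xi_mul_xi, ← D.mul_xi (D.commute_biPolyEval_G s), ← D.xi_mul (D.commute_biPolyEval_G t),
      biPolyEval_mul _ _ D.commute_A_B, add_mul, mul_add, mul_add]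
    abel

theorem IsValueOf.star (hE : E.IsSpectralMeasureOf (D.theta D.N)) (hS : D.IsValueOf E φ S) :
    D.IsValueOf E (star φ) (J.adj S) := by
  obtain ⟨s, f, f₁, f₂, hf, rfl⟩ := hS
  obtain ⟨hfr, hfb, hf0, hf1, hf2⟩ := isDecomposition_iff.1 hf
  refine ⟨MvPolynomial.map (starRingEnd ℂ) s, fun z => conj (f z), fun z => conj (f₁ z),
    fun z => conj (f₂ z), isDecomposition_iff.2 ?_, ?_⟩
  · have hsub : Star.star φ - D.polyN (MvPolynomial.map (starRingEnd ℂ) s) =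
        Star.star (φ - D.polyN s) := by
      rw [star_sub, polyN, Symbols.ofPoly_conj]
    have hconj : ((D.sigma \ D.Z).indicator fun z => conj (f z)) =
        fun z => conj ((D.sigma \ D.Z).indicator f z) := by
      funext z
      by_cases hz : z ∈ D.sigma \ D.Z <;> simp [hz]
    rw [hsub]
    refine ⟨hfr.star, by rw [hconj]; exact hfb.star, fun z hz => ?_, fun w hw => ?_,
      fun w hw => ?_⟩
    · rw [Symbols.entry_star, hf0 z hz, map_mul, Complex.conj_ofReal]
    · rw [Symbols.entry_star, hf1 w hw, map_mul, conj_coeffFst]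
    · rw [Symbols.entry_star, hf2 w hw, map_mul, conj_coeffSnd]
  · have h : ContinuousLinearMap.adjoint (D.jet E f f₁ f₂) =
        D.jet E (fun z => conj (f z)) (fun z => conj (f₁ z)) (fun z => conj (f₂ z)) :=
      D.isNormalSplitting.adjoint_jet hE D.definitizing_p.1 D.definitizing_q.1 hfb
    rw [J.adj_add, adj_biPolyEval, adj_xi, h]

/-- An operator `C` that commutes with `N` and `N*` also commutes with `Ξ(L)`, because `Θ(C)`
commutes with `L`. -/
theorem IsValueOf.mem_bicommutant (hE : E.IsSpectralMeasureOf (D.theta D.N))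
    (hS : D.IsValueOf E φ S) : S ∈ D.bicommutant := by
  obtain ⟨s, f, f₁, f₂, hf, rfl⟩ := hS
  refine Subalgebra.mem_centralizer_iff ℂ |>.2 fun C hC => ?_
  have h1 : Commute C D.N := (hC D.N (Or.inl rfl)).symm
  have h2 : Commute C (J.adj D.N) := (hC _ (Or.inr rfl)).symm
  have hA := D.commute_A h1 h2
  have hB := D.commute_B h1 h2
  have hG := D.commute_G hA hB
  have h3 : C * D.xi (D.jet E f f₁ f₂) = D.xi (D.jet E f f₁ f₂) * C := by
    rw [D.mul_xi hG, D.xi_mul hG, (commute_theta_jet hA hB h1 h2 hE hf.isBddBorel).eq]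
  rw [mul_add, add_mul, h3, (commute_biPolyEval hA hB s).eq]

end Values

theorem isValueOf_polyN (E : SpectralMeasure D.V) (s : MvPolynomial (Fin 2) ℂ) :
    D.IsValueOf E (D.polyN s) (biPolyEval s D.A D.B) := by
  refine ⟨s, fun _ => 0, fun _ => 0, fun _ => 0, isDecomposition_iff.2 ?_, ?_⟩
  · have h0 : ∀ z k l, (D.polyN s - D.polyN s).entry z k l = 0 := fun z k l => by
      rw [Symbols.entry_sub, sub_self]
    refine ⟨⟨fun z _ k _ l _ => h0 z k l, fun ζ => sub_self _⟩, ?_, fun z _ => ?_, fun w _ => ?_,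
      fun w _ => ?_⟩
    · exact (IsBddBorel.const 0).indicator measurableSet_sigma_diff
    · rw [h0, mul_zero]
    · rw [h0, mul_zero]
    · rw [h0, mul_zero]
  · have h : D.jet E (fun _ => 0) (fun _ => 0) (fun _ => 0) = 0 := IsNormalSplitting.jet_zero
    rw [h]
    ext x
    simp [xi_apply]

theorem isValueOf_algebraMap (E : SpectralMeasure D.V) (c : ℂ) :
    D.IsValueOf E (algebraMap ℂ D.M c) (algebraMap ℂ (K →L[ℂ] K) c) := by
  have h := isValueOf_polyN E (D := D) (MvPolynomial.C c)
  rwa [biPolyEval_C, polyN, Symbols.ofPoly_C, ← Algebra.algebraMap_eq_smul_one] at h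

end DefinitizableNormal

end

theorem mainTheorem1 {K : Type*} [NormedAddCommGroup K] [InnerProductSpace ℂ K] [CompleteSpace K]
    (J : KreinStructure K) (D : DefinitizableNormal J) :
    D.T ∘L D.theta D.N = D.N ∘L D.T ∧
    ∃ Φ : D.F →ₐ[ℂ] D.bicommutant,
      (∀ (φ : D.F) (S : K →L[ℂ] K), D.IsValue φ S ↔ S = Φ φ) ∧
      (∀ φ : D.F, (Φ (star φ) : K →L[ℂ] K) = J.adj (Φ φ)) ∧
      ∀ s : MvPolynomial (Fin 2) ℂ, ∃ hs : D.polyN s ∈ D.F,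
        (Φ ⟨D.polyN s, hs⟩ : K →L[ℂ] K) = biPolyEval s D.A D.B := by
  refine ⟨D.T_theta D.commute_N_G, ?_⟩
  obtain ⟨E, hE, -⟩ := exists_isSpectralMeasureOf D.isStarNormal_theta_N
  have hex : ∀ φ : D.F, ∃ S, D.IsValueOf E φ S := fun φ => by
    obtain ⟨s, g, g₁, g₂, hd⟩ := DefinitizableNormal.exists_isDecomposition φ.2
    exact ⟨_, s, g, g₁, g₂, hd, rfl⟩
  choose v hv using hex
  have huniq : ∀ {φ : D.F} {S : K →L[ℂ] K}, D.IsValueOf E φ S → v φ = S := fun {φ S} h =>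
    (hv φ).unique hE h
  let Φ : D.F →ₐ[ℂ] D.bicommutant :=
    { toFun := fun φ => ⟨v φ, (hv φ).mem_bicommutant hE⟩
      map_one' := Subtype.ext (huniq (by
        simpa using DefinitizableNormal.isValueOf_algebraMap (D := D) E 1))
      map_mul' := fun φ ψ => Subtype.ext (huniq ((hv φ).mul hE (hv ψ)))
      map_zero' := Subtype.ext (huniq (by
        simpa using DefinitizableNormal.isValueOf_algebraMap (D := D) E 0))
      map_add' := fun φ ψ => Subtype.ext (huniq ((hv φ).add hE (hv ψ)))
      commutes' := fun c => Subtype.ext (huniq (DefinitizableNormal.isValueOf_algebraMap E c)) }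
  refine ⟨Φ, fun φ S => ?_, fun φ => huniq ((hv φ).star hE), fun s =>
    ⟨DefinitizableNormal.isAdmissible_polyN s, huniq (DefinitizableNormal.isValueOf_polyN E s)⟩⟩
  rw [DefinitizableNormal.isValue_iff hE]
  exact ⟨fun h => (huniq h).symm, fun h => h ▸ hv φ⟩
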